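/- Setting. Let $d\ge 1$, $\alpha\ge 1$ and $C_0\ge 2$ (with $C_0>2$ if $d=1$). Write $\|\cdot\|$ for the sup norm on $\mathbb{R}^d$ and $\lfloor\alpha\rfloor$ for the largest integer strictly less than $\alpha$. Let $\mathcal{H}_d(\alpha,C_0)$ be the class of functions $g:[0,1]^d\to[0,1]$ that are $\lfloor\alpha\rfloor$ times differentiable, with $|g^{(s)}(x)|\le C_0$ for $1\le|s|\le\lfloor\alpha\rfloor$ and $|g^{(s)}(x)-g^{(s)}(x')|\le C_0\|x-x'\|^{\alpha-\lfloor\alpha\rfloor}$ for $|s|=\lfloor\alpha\rfloor$ and $x,x'\in[0,1]^d$. Let $\mathcal{F}=\mathcal{F}^{\rm cartoon}(\alpha,C_0)$ be the set of functions $f=\mathbf{1}_{\Omega}f_\Omega+\mathbf{1}_{\Omega^c}f_{\Omega^c}$ on $[0,1]^d$ with $f_\Omega,f_{\Omega^c}\in\mathcal{H}_d(\alpha,C_0)$ and $\inf_{\partial\Omega}|f_\Omega-f_{\Omega^c}|\ge 1/C_0$, where $\Omega\subset(0,1)^d$ is the image of the open Euclidean unit ball under an injective map $\phi:\mathbb{R}^d\to\mathbb{R}^d$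 such that $\phi$ and $\phi^{-1}$ are $C_0$-Lipschitz for $\|\cdot\|$. For $i\in\{1,\dots,n\}^d$ let $x_i=((i_1-\tfrac12)/n,\dots,(i_d-\tfrac12)/n)$, and observe $y_i=f(x_i)+\varepsilon_i$, where the $\varepsilon_i$ are uncorrelated with mean $0$ and variance $\sigma^2$. For $h>0$ let $\omega_{i,j}=\mathbf{1}\{\|x_i-x_j\|\le h\}$, and let $\hat f_h$ be either the local average $\hat f_i=\sum_j\omega_{i,j}y_j/\sum_j\omega_{i,j}$, or the local polynomial estimator of a fixed degree $r\ge\lfloor\alpha\rfloor$: $\hat f_i=\hat a_0$, where $\hat a$ minimises $\sum_j\omega_{i,j}\bigl(y_j-\sum_{|s|\le r}a_s(x_j-x_i)^s\bigr)^2$ (and $\hat f_i=y_i$ if this does not determine $\hat a_0$ uniquely). Let $$\mathcal{R}_n(h)=\sup_{f\in\mathcal{F}}\frac1{n^d}\sum_i\mathbb{E}(\hat f_i-f(x_i))^2,\qquad h^{\rm LF}=\mathcal{R}^{\rm LF}=(\sigma^2/n^d)^{1/(d+1)} .$$ Theorem. The following hold for all $n$ and $\sigma>0$ with $n\sigma^2\ge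 M$ and $n^d/\sigma^2\ge M$, for a large enough constant $M$ (hence, for each fixed $\sigma>0$, for all large $n$). All constants, $M$ included, are positive and depend only on $d$, $\alpha$, $C_0$ and the estimator (local average, or the degree $r$), and on the other constants named below. 1. $c\,\mathcal{R}^{\rm LF}\le\inf_{h>0}\mathcal{R}_n(h)\le C\,\mathcal{R}^{\rm LF}$ for some $c,C$. 2. For all $0<a\le b$ there are $C,M$ such that $\mathcal{R}_n(h)\le C\,\mathcal{R}^{\rm LF}$ whenever $a\,h^{\rm LF}\le h\le b\,h^{\rm LF}$. 3. For every $K\ge1$ there are $a,b,M$ such that every $h>0$ with $\mathcal{R}_n(h)\le K\inf_{h'>0}\mathcal{R}_n(h')$ satisfies $a\,h^{\rm LF}\le h\le b\,h^{\rm LF}$. The same holds when the estimator is clipped to $[0,1]$, except that the lower bound in 1 and the whole of 3 are then asserted for independent noise with $\mathbb{E}\varepsilon_i^4\le\kappa\sigma^4$, the constants depending on $\kappa$ as well. -/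

import Mathlib

open MeasureTheory ProbabilityTheory
open scoped ENNReal

universe u

noncomputable section

namespace LinearFilter

/-! Points of `ℝ^d` are functions `Fin d → ℝ`, whose norm is the sup norm. -/

/-- The closed unit cube `[0,1]^d`. -/
def cube (d : ℕ) : Set (Fin d → ℝ) := Set.Icc 0 1

/-- The largest integer strictly less than `α` (for `α > 0`). -/
def strictFloor (α : ℝ) : ℕ := ⌈α⌉₊ - 1

/-- The partial derivative `∂^m g / ∂x_{t 0} ⋯ ∂x_{t (m-1)}` at a point `x` of the cube, for a list
`t` of `m` coordinate directions. Listing direction `k` exactly `s k` times gives the derivative of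
multi-index `s`, and every multi-index of order `m` arises in this way. -/
def partialDeriv {d : ℕ} (m : ℕ) (g : (Fin d → ℝ) → ℝ) (t : Fin m → Fin d) (x : Fin d → ℝ) : ℝ :=
  iteratedFDerivWithin ℝ m g (cube d) x (fun k => Pi.single (t k) 1)

/-- The Hölder class `H_d(α, C₀)` of functions `[0,1]^d → [0,1]` (values off the cube play no
role). Since the derivatives of top order are Hölder continuous, being differentiable
`strictFloor α` times is the same as being `C^{strictFloor α}`. -/
structure HolderClass (d : ℕ) (α C₀ : ℝ) (g : (Fin d → ℝ) → ℝ) : Prop where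
  mem_unit : ∀ x ∈ cube d, g x ∈ Set.Icc (0 : ℝ) 1
  smooth : ContDiffOn ℝ (strictFloor α : ℕ) g (cube d)
  deriv_bound : ∀ m : ℕ, 1 ≤ m → m ≤ strictFloor α → ∀ t : Fin m → Fin d, ∀ x ∈ cube d,
    |partialDeriv m g t x| ≤ C₀
  deriv_holder : ∀ t : Fin (strictFloor α) → Fin d, ∀ x ∈ cube d, ∀ x' ∈ cube d,
    |partialDeriv (strictFloor α) g t x - partialDeriv (strictFloor α) g t x'|
      ≤ C₀ * ‖x - x'‖ ^ (α - (strictFloor α : ℝ))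

/-- The open Euclidean unit ball of `ℝ^d`. -/
def euclideanBall (d : ℕ) : Set (Fin d → ℝ) := {x | ∑ k, x k ^ 2 < 1}

/-- `Ω ⊆ (0,1)^d` is the image of the Euclidean unit ball under an injective map `φ` of `ℝ^d` such
that `φ` and `φ⁻¹` are both `C₀`-Lipschitz for the sup norm. -/
def IsForeground (d : ℕ) (C₀ : ℝ) (Ω : Set (Fin d → ℝ)) : Prop :=
  (∀ x ∈ Ω, ∀ k, 0 < x k ∧ x k < 1) ∧
  ∃ φ : (Fin d → ℝ) → (Fin d → ℝ), Function.Injective φ ∧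
    (∀ x y, ‖φ x - φ y‖ ≤ C₀ * ‖x - y‖) ∧
    (∀ x y, ‖x - y‖ ≤ C₀ * ‖φ x - φ y‖) ∧
    Ω = φ '' euclideanBall d

open Classical in
/-- The cartoon class: two Hölder pieces, glued along the boundary of a bi-Lipschitz ball, with a
jump of at least `1 / C₀` all along that boundary. -/
def cartoonClass (d : ℕ) (α C₀ : ℝ) : Set ((Fin d → ℝ) → ℝ) :=
  {f | ∃ (Ω : Set (Fin d → ℝ)) (fin fout : (Fin d → ℝ) → ℝ),
    IsForeground d C₀ Ω ∧ HolderClass d α C₀ fin ∧ HolderClass d α C₀ fout ∧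
    (∀ x ∈ frontier Ω, 1 / C₀ ≤ |fin x - fout x|) ∧
    ∀ x ∈ cube d, f x = if x ∈ Ω then fin x else fout x}

/-- Pixels of the `n × ⋯ × n` image. -/
abbrev Pixel (d n : ℕ) : Type := Fin d → Fin n

/-- The design point of pixel `i`; the coordinates of a pixel run from `0` to `n - 1`, so the
`k`-th coordinate is `((i k + 1) - 1/2) / n`. -/
def gridPoint {d n : ℕ} (i : Pixel d n) : Fin d → ℝ := fun k => ((i k : ℝ) + 1 / 2) / n

open Classical in
/-- The box kernel weights `ω_{i,j} = 1{‖x_i - x_j‖_∞ ≤ h}`. -/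
def boxWeight {d n : ℕ} (h : ℝ) (i j : Pixel d n) : ℝ :=
  if ‖gridPoint i - gridPoint j‖ ≤ h then 1 else 0

/-- The local average at pixel `i`. -/
def localAverage {d n : ℕ} (h : ℝ) (y : Pixel d n → ℝ) (i : Pixel d n) : ℝ :=
  (∑ j, boxWeight h i j * y j) / ∑ j, boxWeight h i j

/-- The multi-indices `s ∈ ℕ^d` of order `|s| ≤ r`. -/
def multiIndices (d r : ℕ) : Finset (Fin d → ℕ) :=
  (Fintype.piFinset fun _ => Finset.range (r + 1)).filter fun s => ∑ k, s k ≤ r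

theorem mem_multiIndices {d r : ℕ} {s : Fin d → ℕ} : s ∈ multiIndices d r ↔ ∑ k, s k ≤ r := by
  simp only [multiIndices, Finset.mem_filter, Fintype.mem_piFinset, Finset.mem_range,
    and_iff_right_iff_imp]
  intro h k
  have := Finset.single_le_sum (f := s) (fun _ _ => Nat.zero_le _) (Finset.mem_univ k)
  omega

/-- The multi-index `0`, as an index of the coefficient vectors of degree `r`. -/
def zeroIndex (d r : ℕ) : multiIndices d r := ⟨0, mem_multiIndices.2 (by simp)⟩

/-- The locally weighted least squares criterion at pixel `i`, for the polynomial
`x ↦ ∑_{|s| ≤ r} a_s (x - x_i)^s`. -/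
def lprCriterion {d n : ℕ} (r : ℕ) (h : ℝ) (y : Pixel d n → ℝ) (i : Pixel d n)
    (a : multiIndices d r → ℝ) : ℝ :=
  ∑ j, boxWeight h i j *
    (y j - ∑ s : multiIndices d r, a s * ∏ k, (gridPoint j k - gridPoint i k) ^ (s.1 k)) ^ 2

/-- `v` is the constant coefficient of some minimiser of the least squares criterion. -/
def IsLprValue {d n : ℕ} (r : ℕ) (h : ℝ) (y : Pixel d n → ℝ) (i : Pixel d n) (v : ℝ) : Prop :=
  ∃ a : multiIndices d r → ℝ,
    (∀ b, lprCriterion r h y i a ≤ lprCriterion r h y i b) ∧ a (zeroIndex d r) = v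

open Classical in
/-- Local polynomial regression of degree `r` at pixel `i`: the constant coefficient of the least
squares fit if that number is uniquely determined, and the observation `y_i` otherwise. -/
def localPolynomial {d n : ℕ} (r : ℕ) (h : ℝ) (y : Pixel d n → ℝ) (i : Pixel d n) : ℝ :=
  if hv : ∃! v, IsLprValue r h y i v then hv.choose else y i

/-- The two forms of the linear filter. -/
inductive Method where
  | average : Method
  | polynomial (r : ℕ) : Method

/-- The linear filter with bandwidth `h`. -/
def linearFilter {d n : ℕ} (method : Method) (h : ℝ) (y : Pixel d n → ℝ) (i : Pixel d n) : ℝ :=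
  match method with
  | .average => localAverage h y i
  | .polynomial r => localPolynomial r h y i

/-- The estimator: the linear filter itself (`clip = false`), or the linear filter clipped to
`[0,1]` (`clip = true`). -/
def estimator {d n : ℕ} (method : Method) (clip : Bool) (h : ℝ) (y : Pixel d n → ℝ)
    (i : Pixel d n) : ℝ :=
  if clip then max 0 (min 1 (linearFilter method h y i)) else linearFilter method h y i

/-- Noise that is uncorrelated, centred and of variance `σ²`. -/
structure IsWhiteNoise {ι S : Type*} [MeasurableSpace S] (μ : Measure S) (σ : ℝ)
    (ε : ι → S → ℝ) : Prop where
  memLp : ∀ i, MemLp (ε i) 2 μ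
  mean : ∀ i, ∫ ω, ε i ω ∂μ = 0
  var : ∀ i, ∫ ω, ε i ω ^ 2 ∂μ = σ ^ 2
  uncorrelated : ∀ i j, i ≠ j → ∫ ω, ε i ω * ε j ω ∂μ = 0

/-- The noise variables are independent, with kurtosis at most `κ`. -/
structure IsIndepKurtosis {ι S : Type*} [MeasurableSpace S] (μ : Measure S) (σ κ : ℝ)
    (ε : ι → S → ℝ) : Prop where
  indep : iIndepFun ε μ
  memLp : ∀ i, MemLp (ε i) 4 μ
  fourth : ∀ i, ∫ ω, ε i ω ^ 4 ∂μ ≤ κ * σ ^ 4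

/-- `MSE_f = n^{-d} ∑_i E (f̂_i - f(x_i))²` for the observations `y_j = f(x_j) + ε_j`. -/
def mse {d n : ℕ} {S : Type*} [MeasurableSpace S] (μ : Measure S) (ε : Pixel d n → S → ℝ)
    (method : Method) (clip : Bool) (h : ℝ) (f : (Fin d → ℝ) → ℝ) : ℝ≥0∞ :=
  (∑ i : Pixel d n, ∫⁻ ω, ENNReal.ofReal
    ((estimator method clip h (fun j => f (gridPoint j) + ε j ω) i - f (gridPoint i)) ^ 2) ∂μ)
    / (n : ℝ≥0∞) ^ d

/-- The worst-case MSE over the cartoon class. -/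
def risk {d n : ℕ} {S : Type*} [MeasurableSpace S] (μ : Measure S) (ε : Pixel d n → S → ℝ)
    (α C₀ : ℝ) (method : Method) (clip : Bool) (h : ℝ) : ℝ≥0∞ :=
  ⨆ f ∈ cartoonClass d α C₀, mse μ ε method clip h f

/-- The worst-case MSE optimised over the bandwidth. -/
def optimalRisk {d n : ℕ} {S : Type*} [MeasurableSpace S] (μ : Measure S) (ε : Pixel d n → S → ℝ)
    (α C₀ : ℝ) (method : Method) (clip : Bool) : ℝ≥0∞ :=
  ⨅ (h : ℝ) (_ : 0 < h), risk μ ε α C₀ method clip h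

/-- `(σ² / n^d)^{1/(d+1)}`, which is both the rate and the order of the optimal bandwidth. -/
def rate (d n : ℕ) (σ : ℝ) : ℝ := (σ ^ 2 / (n : ℝ) ^ d) ^ (1 / ((d : ℝ) + 1))

/-- The asymptotic regime: `n σ²` and `n^d / σ²` are both at least `M`. For a fixed `σ > 0` this
holds for all large `n`; it says that `rate d n σ` is large compared with the pixel size `1 / n`
and small compared with `1`. -/
def Regime (d n : ℕ) (σ M : ℝ) : Prop := 0 < σ ∧ M ≤ n * σ ^ 2 ∧ M * σ ^ 2 ≤ (n : ℝ) ^ d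

end LinearFilter

end

noncomputable section

namespace LinearFilter

/-! The squared error at a pixel splits into squared bias and variance. For `h ≤ 1` a window holds
about `(n h)^d` pixels, so the variance is of order `σ² / (n h)^d`. The bias is governed by the
jump: a fraction of order `h` of the pixels have windows crossing the boundary of `Ω`, where the
error may be of order one; at all other pixels the image is Lipschitz across the window and the
squared bias is at most of order `h² ≤ h`. The sum `h + σ² / (n h)^d` is balanced exactly at the
order of `rate`.

The upper bound `exists_risk_le` rests on two facts. First, both filters are least squares fits,
hence linear with weights given by a reproducing kernel; `exists_abs_kernel_le` bounds these weights
by the reciprocal of the number of pixels. The bound comes from explicit weights (averaged Lagrange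
interpolation) and so is uniform over all windows, also those cut off by the border. Second,
`exists_card_boundaryPixels_le` counts the pixels near the boundary by pulling the grid back under
`φ` to separated points of a thin annulus. Pixels outside `Ω` need preimages too, so `φ` must be
onto: `surjective_of_bilipschitz`, a Lipschitz form of invariance of domain derived from the
no-retraction theorem.

The lower bounds use one image, a disc of height `3/4` on a background of `1/4`. The variance is
bounded below by Cauchy-Schwarz, as the weights sum to one. For the bias, `exists_abs_filter_sub_le`
shows that a shift by a small fraction of the window width barely changes the filter output, whereas
between a pixel inside the disc and its shift outside the image drops by `1/2`; one of the two
pixels must then have a large error. `exists_jump_pixels` provides a fraction of order `min h 1` of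
such pairs.

Clipping only reduces the error, so upper bounds are unaffected. For lower bounds it acts at worst
like a truncation of the squared error, which bounded kurtosis controls
(`exists_le_lintegral_error`). Finally, a bandwidth far below the rate has too much variance and one
far above it too much bias, which localises all nearly optimal bandwidths. -/

/-! ### Bi-Lipschitz self-maps of `ℝ^d` are surjective -/

/-- The polynomial `t ↦ det (1 + t A)` can be recovered at `1` from its values at `d + 1` nodes. -/
theorem exists_det_one_add_eq_sum {d : ℕ} (v : Fin (d + 1) → ℝ) (hv : Function.Injective v) :
    ∃ c : Fin (d + 1) → ℝ, ∀ A : (Fin d → ℝ) →L[ℝ] (Fin d → ℝ),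
      (1 + A).det = ∑ j, c j * (1 + v j • A).det := by
  refine ⟨fun j => (Lagrange.basis Finset.univ v j).eval 1, fun A => ?_⟩
  set N : Matrix (Fin d) (Fin d) ℝ := LinearMap.toMatrix' (A : (Fin d → ℝ) →ₗ[ℝ] (Fin d → ℝ))
    with hN
  set p : Polynomial ℝ :=
    ((Polynomial.X : Polynomial ℝ) • N.map Polynomial.C + (1 : Matrix (Fin d) (Fin d) ℝ).map
      Polynomial.C).det with hp
  have key : ∀ t : ℝ, (1 + t • A).det = p.eval t := by
    intro t
    rw [hp, ← Polynomial.coe_evalRingHom, RingHom.map_det, ContinuousLinearMap.det,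
      ← LinearMap.det_toMatrix']
    congr 1
    ext i j
    by_cases hij : i = j <;>
      simp [hN, LinearMap.toMatrix'_apply, hij] <;> ring
  have hdeg : p.degree < (Finset.univ : Finset (Fin (d + 1))).card := by
    refine lt_of_le_of_lt Polynomial.degree_le_natDegree ?_
    have := Polynomial.natDegree_det_X_add_C_le N 1
    rw [Fintype.card_fin] at this
    rw [Finset.card_univ, Fintype.card_fin]
    exact_mod_cast Nat.lt_succ_of_le this
  have h1 : (1 + A).det = p.eval 1 := by rw [← key 1, one_smul]
  rw [h1]
  conv_lhs => rw [Lagrange.eq_interpolate (s := Finset.univ) (v := v) hv.injOn hdeg]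
  rw [Lagrange.interpolate_apply, Polynomial.eval_finsetSum]
  refine Finset.sum_congr rfl fun j _ => ?_
  rw [key, Polynomial.eval_mul, Polynomial.eval_C, mul_comm]

/-- Along `t ↦ det (1 + t A)` the determinant starts at `1`; a zero for some `t ∈ [0,1]` would give
`x = -t A x` with `x ≠ 0`, impossible for a strict contraction. -/
theorem det_one_add_pos_of_norm_lt_one {d : ℕ} (A : (Fin d → ℝ) →L[ℝ] (Fin d → ℝ))
    (hA : ‖A‖ < 1) : 0 < (1 + A).det := by
  by_contra hneg
  push Not at hneg
  have hcont : Continuous fun t : ℝ => (1 + t • A).det :=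
    ContinuousLinearMap.continuous_det.comp (by fun_prop)
  have h0 : (1 + (0 : ℝ) • A).det = 1 := by simp [ContinuousLinearMap.det]
  have h1 : (1 + (1 : ℝ) • A).det ≤ 0 := by simpa using hneg
  obtain ⟨t, ht, htz⟩ := intermediate_value_Icc' (zero_le_one' ℝ) hcont.continuousOn
    (show (0 : ℝ) ∈ Set.Icc _ _ from ⟨h1, by rw [h0]; exact zero_le_one⟩)
  have htz' : LinearMap.det ((1 + t • A : (Fin d → ℝ) →L[ℝ] (Fin d → ℝ)) :
      (Fin d → ℝ) →ₗ[ℝ] (Fin d → ℝ)) = 0 := htz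
  obtain ⟨x, hx, hx0⟩ := (Submodule.ne_bot_iff _).1
    (LinearMap.bot_lt_ker_of_det_eq_zero htz').ne'
  have hxe : x + t • A x = 0 := by simpa using hx
  have hx1 : ‖x‖ = |t| * ‖A x‖ := by
    conv_lhs => rw [eq_neg_of_add_eq_zero_left hxe]
    rw [norm_neg, norm_smul, Real.norm_eq_abs]
  have h2 := A.le_opNorm x
  have h3 : 0 < ‖x‖ := norm_pos_iff.2 hx0
  have h4 : |t| ≤ 1 := abs_le.2 ⟨by linarith [ht.1], ht.2⟩
  nlinarith [norm_nonneg (A x), mul_le_mul_of_nonneg_right h4 (norm_nonneg (A x))]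

/-- Lebesgue measure is the `d`-dimensional Hausdorff measure, which a `K`-Lipschitz map enlarges at
most by the factor `K ^ d`. -/
theorem volume_lipschitz_image_eq_zero {d : ℕ} {K : NNReal} {f : (Fin d → ℝ) → (Fin d → ℝ)}
    (hf : LipschitzWith K f) {s : Set (Fin d → ℝ)} (hs : volume s = 0) : volume (f '' s) = 0 := by
  rw [← hausdorffMeasure_pi_real] at hs ⊢
  have := hf.hausdorffMeasure_image_le (d := (Fintype.card (Fin d) : ℝ)) (by positivity) s
  rw [hs, mul_zero] at this
  exact le_antisymm this bot_le

theorem bijOn_ball_of_bijective {d : ℕ} {g : (Fin d → ℝ) → (Fin d → ℝ)} (hg : Function.Bijective g)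
    {R : ℝ} (hout : ∀ x, R ≤ ‖x‖ → g x = x) : g '' Metric.ball 0 R = Metric.ball 0 R := by
  ext y
  simp only [Set.mem_image, mem_ball_zero_iff]
  constructor
  · rintro ⟨x, hx, rfl⟩
    by_contra hy
    have := hg.1 (hout (g x) (not_lt.1 hy))
    rw [this] at hy
    exact hy hx
  · intro hy
    obtain ⟨x, rfl⟩ := hg.2 y
    refine ⟨x, ?_, rfl⟩
    by_contra hx
    rw [hout x (not_lt.1 hx)] at hy
    exact hx hy

/-- The perturbation `t • w` is a contraction, so `x = y - t • w x` has a unique solution by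
Banach's fixed point theorem. -/
theorem bijective_add_smul_of_lipschitz {d : ℕ} {K : NNReal} {w : (Fin d → ℝ) → (Fin d → ℝ)}
    (hw : LipschitzWith K w) {t : ℝ} (ht : |t| * K < 1) :
    Function.Bijective fun x => x + t • w x := by
  have hLip : ∀ x y, ‖t • w x - t • w y‖ ≤ |t| * K * ‖x - y‖ := fun x y => by
    rw [← smul_sub, norm_smul, Real.norm_eq_abs, mul_assoc]
    gcongr
    simpa [dist_eq_norm] using hw.dist_le_mul x y
  constructor
  · intro x y hxy
    have h := hLip x y
    have hxy' : x + t • w x = y + t • w y := hxy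
    have h1 : x - y = -(t • w x - t • w y) := by
      rw [eq_comm, neg_eq_iff_add_eq_zero]
      have : x + t • w x - (y + t • w y) = 0 := sub_eq_zero.2 hxy'
      rw [← this]; abel
    have h2 : ‖x - y‖ = ‖t • w x - t • w y‖ := by rw [h1, norm_neg]
    by_contra hne
    have h3 : 0 < ‖x - y‖ := norm_pos_iff.2 (sub_ne_zero.2 hne)
    nlinarith
  · intro y
    have hc : ContractingWith (Real.toNNReal (|t| * K)) fun x => y - t • w x := by
      refine ⟨by rw [← Real.toNNReal_one]; exact (Real.toNNReal_lt_toNNReal_iff one_pos).2 ht,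
        LipschitzWith.of_dist_le_mul fun x z => ?_⟩
      rw [Real.coe_toNNReal _ (by positivity), dist_eq_norm, dist_eq_norm, sub_sub_sub_cancel_left,
        norm_sub_rev]
      exact hLip x z
    refine ⟨hc.fixedPoint, ?_⟩
    have h : y - t • w hc.fixedPoint = hc.fixedPoint := hc.fixedPoint_isFixedPt
    change hc.fixedPoint + t • w hc.fixedPoint = y
    exact (sub_eq_iff_eq_add.1 h).symm

/-- There is no Lipschitz retraction of a ball onto its boundary sphere. -/
theorem no_lipschitz_retraction {d : ℕ} {K : NNReal} {w : (Fin d → ℝ) → (Fin d → ℝ)}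
    (hw : LipschitzWith K w) {R : ℝ} (hR : 0 < R) (hout : ∀ x, R ≤ ‖x‖ → w x = 0)
    (hin : ∀ x, ‖x‖ < R → ‖x + w x‖ = R) : False := by
  classical
  set B : Set (Fin d → ℝ) := Metric.ball 0 R with hB
  set D : Set (Fin d → ℝ) := B ∩ {x | DifferentiableAt ℝ w x} with hD
  have hDm : MeasurableSet D := Metric.isOpen_ball.measurableSet.inter
    (measurableSet_of_differentiableAt ℝ w)
  have hBD : volume (B \ D) = 0 := by
    refine measure_mono_null (t := {x | ¬ DifferentiableAt ℝ w x}) ?_ hw.ae_differentiableAt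
    rintro x ⟨hx, hx'⟩ hd
    exact hx' ⟨hx, hd⟩
  have hvolD : volume D = volume B := by
    refine le_antisymm (measure_mono Set.inter_subset_left) ?_
    calc volume B ≤ volume (D ∪ B \ D) := measure_mono (by
            intro x hx; by_cases h : x ∈ D
            · exact Or.inl h
            · exact Or.inr ⟨hx, h⟩)
      _ ≤ volume D + volume (B \ D) := measure_union_le _ _
      _ = volume D := by rw [hBD, add_zero]
  have hBfin : volume B ≠ ⊤ := measure_ball_lt_top.ne
  have hBpos : 0 < volume.real B :=
    ENNReal.toReal_pos (Metric.isOpen_ball.measure_pos volume ⟨0, by simpa [hB] using hR⟩).ne' hBfin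
  -- the area formula for `x ↦ x + t w x`
  have area : ∀ t : ℝ, |t| * K < 1 →
      IntegrableOn (fun x => (1 + t • fderiv ℝ w x).det) D ∧
        ∫ x in D, (1 + t • fderiv ℝ w x).det = volume.real B := by
    intro t ht
    set g : (Fin d → ℝ) → (Fin d → ℝ) := fun x => x + t • w x with hg
    have hbij : Function.Bijective g := bijective_add_smul_of_lipschitz hw ht
    have himg : g '' B = B := bijOn_ball_of_bijective hbij fun x hx => by simp [hg, hout x hx]
    have hgL : LipschitzWith (1 + ‖t‖₊ * K) g := by
      have h1 : LipschitzWith (‖t‖₊ * K) fun x => t • w x := by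
        refine LipschitzWith.of_dist_le_mul fun x y => ?_
        rw [dist_smul₀, NNReal.coe_mul, mul_assoc]
        exact mul_le_mul_of_nonneg_left (hw.dist_le_mul x y) (norm_nonneg _)
      exact LipschitzWith.id.add h1
    have hvol : volume (g '' D) = volume B := by
      refine le_antisymm ((measure_mono (Set.image_mono Set.inter_subset_left)).trans
        (congrArg volume himg).le) ?_
      calc volume B = volume (g '' B) := by rw [himg]
        _ ≤ volume (g '' D ∪ g '' (B \ D)) := measure_mono (by
            rw [← Set.image_union]
            refine Set.image_mono fun x hx => ?_
            by_cases h : x ∈ D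
            · exact Or.inl h
            · exact Or.inr ⟨hx, h⟩)
        _ ≤ volume (g '' D) + volume (g '' (B \ D)) := measure_union_le _ _
        _ = volume (g '' D) := by rw [volume_lipschitz_image_eq_zero hgL hBD, add_zero]
    have hder : ∀ x ∈ D, HasFDerivWithinAt g (1 + t • fderiv ℝ w x) D x := fun x hx =>
      ((hasFDerivAt_id x).add (hx.2.hasFDerivAt.const_smul t)).hasFDerivWithinAt
    have hA := lintegral_abs_det_fderiv_eq_addHaar_image volume hDm hder hbij.1.injOn
    rw [hvol] at hA
    have hpos : ∀ x, 0 < (1 + t • fderiv ℝ w x).det := fun x => by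
      refine det_one_add_pos_of_norm_lt_one _ (lt_of_le_of_lt ?_ ht)
      rw [norm_smul, Real.norm_eq_abs]
      gcongr
      exact norm_fderiv_le_of_lipschitz ℝ hw
    simp_rw [abs_of_pos (hpos _)] at hA
    have hmeas : Measurable fun x => (1 + t • fderiv ℝ w x).det :=
      ContinuousLinearMap.continuous_det.measurable.comp
        (((measurable_fderiv ℝ w).const_smul t).const_add 1)
    constructor
    · refine ⟨hmeas.aestronglyMeasurable, ?_⟩
      rw [hasFiniteIntegral_iff_ofReal (Filter.Eventually.of_forall fun x => (hpos x).le), hA]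
      exact hBfin.lt_top
    · rw [integral_eq_lintegral_of_nonneg_ae (Filter.Eventually.of_forall fun x => (hpos x).le)
        hmeas.aestronglyMeasurable, hA]
      rfl
  -- nodes at which the area formula applies
  set v : Fin (d + 1) → ℝ := fun j => (j : ℝ) / ((d + 1) * (K + 1)) with hv
  have hden : (0 : ℝ) < (d + 1) * (K + 1) := by positivity
  have hvinj : Function.Injective v := fun i j hij => by
    have : (i : ℝ) = j := (div_left_inj' hden.ne').1 hij
    exact Fin.ext (by exact_mod_cast this)
  have hvsmall : ∀ j, |v j| * K < 1 := fun j => by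
    have hj : (j : ℝ) < d + 1 := by exact_mod_cast j.2
    have hK : (0 : ℝ) ≤ K := K.2
    rw [hv, abs_of_nonneg (by positivity), div_mul_eq_mul_div, div_lt_one hden]
    nlinarith [mul_nonneg (sub_pos.2 hj).le hK]
  obtain ⟨c, hc⟩ := exists_det_one_add_eq_sum v hvinj
  -- The interpolation identity at `A = 0`, where all determinants equal `1`.
  have hcsum : ∑ j, c j = 1 := by
    have := hc 0
    simpa [ContinuousLinearMap.det] using this.symm
  -- The integral of the determinant equals the volume of the ball for small `t`. It is a polynomial
  -- in `t`, so the value persists at `t = 1`, where `x ↦ x + w x` is no longer injective.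
  have hone : ∫ x in D, (1 + fderiv ℝ w x).det = volume.real B := by
    rw [setIntegral_congr_fun hDm fun x _ => hc (fderiv ℝ w x),
      integral_finsetSum _ fun j _ => (area (v j) (hvsmall j)).1.const_mul _]
    simp_rw [integral_const_mul, (area _ (hvsmall _)).2]
    rw [← Finset.sum_mul, hcsum, one_mul]
  -- A map into the sphere has singular derivative: with the sup norm, some coordinate is locally
  -- extremal, so a whole row of the derivative vanishes.
  have hzero : ∫ x in D, (1 + fderiv ℝ w x).det = 0 := by
    refine (setIntegral_congr_fun hDm fun x hx => ?_).trans (integral_zero _ ℝ)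
    change LinearMap.det ((1 + fderiv ℝ w x : (Fin d → ℝ) →L[ℝ] (Fin d → ℝ)) :
      (Fin d → ℝ) →ₗ[ℝ] (Fin d → ℝ)) = 0
    have hxR : ‖x‖ < R := by simpa [hB] using hx.1
    -- a coordinate of modulus `R` is extremal
    have hk : ∃ k, |(x + w x) k| = R := by
      by_contra hcon
      push Not at hcon
      have : ‖x + w x‖ < R := (pi_norm_lt_iff hR).2 fun k =>
        lt_of_le_of_ne (((norm_le_pi_norm _ k)).trans (hin x hxR).le) (hcon k)
      exact this.ne (hin x hxR)
    obtain ⟨k, hk⟩ := hk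
    have hder : HasFDerivAt (fun z => (z + w z) k)
        ((ContinuousLinearMap.proj k).comp (1 + fderiv ℝ w x)) x :=
      (ContinuousLinearMap.proj (R := ℝ) (φ := fun _ : Fin d => ℝ) k).hasFDerivAt.comp x
        ((hasFDerivAt_id x).add hx.2.hasFDerivAt)
    have hle : ∀ᶠ z in nhds x, |(z + w z) k| ≤ R := by
      filter_upwards [Metric.isOpen_ball.mem_nhds hx.1] with z hz
      rw [← hin z (by simpa [hB] using hz)]
      exact norm_le_pi_norm (z + w z) k
    have hloc : IsLocalExtr (fun z => (z + w z) k) x := by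
      rcases abs_eq hR.le |>.1 hk with h | h
      · exact Or.inr (by filter_upwards [hle] with z hz; rw [h]; exact (abs_le.1 hz).2)
      · exact Or.inl (by filter_upwards [hle] with z hz; rw [h]; exact (abs_le.1 hz).1)
    have hz := hloc.hasFDerivAt_eq_zero hder
    by_contra hne
    have hsurj := (LinearMap.equivOfDetNeZero _ hne).surjective (Pi.single k 1)
    obtain ⟨y, hy⟩ := hsurj
    have h1 : (((ContinuousLinearMap.proj k).comp (1 + fderiv ℝ w x) :
      (Fin d → ℝ) →L[ℝ] ℝ)) y = 0 := by rw [hz]; rfl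
    have h2 : (((1 + fderiv ℝ w x : (Fin d → ℝ) →L[ℝ] (Fin d → ℝ))) y) k = 0 := h1
    have h3 : ((1 + fderiv ℝ w x : (Fin d → ℝ) →L[ℝ] (Fin d → ℝ))) y = Pi.single k 1 := hy
    rw [h3] at h2
    simp at h2
  rw [hzero] at hone
  exact hBpos.ne hone

/-- Radial projection to the unit sphere is Lipschitz away from the origin; this makes the
retraction built from a zero-free map Lipschitz. -/
theorem norm_inv_smul_sub_le {E : Type*} [NormedAddCommGroup E] [NormedSpace ℝ E] {a b : E}
    (ha : a ≠ 0) (hb : b ≠ 0) : ‖‖a‖⁻¹ • a - ‖b‖⁻¹ • b‖ ≤ 2 / ‖a‖ * ‖a - b‖ := by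
  have ha' : 0 < ‖a‖ := norm_pos_iff.2 ha
  have hb' : 0 < ‖b‖ := norm_pos_iff.2 hb
  have h1 : ‖a‖⁻¹ • a - ‖b‖⁻¹ • b = ‖a‖⁻¹ • (a - b) + (‖a‖⁻¹ - ‖b‖⁻¹) • b := by module
  have h2 : |‖a‖⁻¹ - ‖b‖⁻¹| * ‖b‖ = |‖b‖ - ‖a‖| / ‖a‖ := by
    rw [inv_sub_inv ha'.ne' hb'.ne', abs_div, abs_of_pos (mul_pos ha' hb')]
    field_simp
  rw [h1]
  refine (norm_add_le _ _).trans ?_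
  rw [norm_smul, norm_smul, Real.norm_eq_abs, Real.norm_eq_abs, h2, abs_of_pos (inv_pos.2 ha')]
  have h3 := abs_norm_sub_norm_le b a
  rw [norm_sub_rev] at h3
  rw [← div_eq_inv_mul, ← add_div, div_mul_eq_mul_div]
  gcongr
  linarith

/-- A map which is Lipschitz on a closed ball and vanishes outside its interior is Lipschitz. -/
theorem norm_sub_le_of_eq_zero_outside {E : Type*} [NormedAddCommGroup E] [NormedSpace ℝ E]
    {f : E → E} {C R : ℝ} (hC : 0 ≤ C)
    (hf : ∀ x y, ‖x‖ ≤ R → ‖y‖ ≤ R → ‖f x - f y‖ ≤ C * ‖x - y‖) (h0 : ∀ x, R ≤ ‖x‖ → f x = 0)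
    (x y : E) : ‖f x - f y‖ ≤ C * ‖x - y‖ := by
  have key : ∀ x y, ‖x‖ ≤ R → R ≤ ‖y‖ → ‖f x - f y‖ ≤ C * ‖x - y‖ := by
    intro x y hx hy
    -- The segment from `x` to `y` meets the sphere of radius `R`, where `f` vanishes; compare `x`
    -- with that point.
    have hcont : Continuous fun t : ℝ => ‖x + t • (y - x)‖ := by fun_prop
    obtain ⟨t, ht, htR⟩ := intermediate_value_Icc (zero_le_one' ℝ) hcont.continuousOn
      (show R ∈ Set.Icc _ _ from ⟨by simpa using hx, by simpa using hy⟩)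
    have htR' : ‖x + t • (y - x)‖ = R := htR
    have h := hf x _ hx htR'.le
    rw [h0 _ htR'.ge] at h
    rw [h0 y hy]
    refine h.trans (mul_le_mul_of_nonneg_left ?_ hC)
    rw [sub_add_cancel_left, norm_neg, norm_smul, Real.norm_eq_abs, abs_of_nonneg ht.1,
      norm_sub_rev y x]
    exact mul_le_of_le_one_left (norm_nonneg _) ht.2
  rcases le_total ‖x‖ R with hx | hx <;> rcases le_total ‖y‖ R with hy | hy
  · exact hf x y hx hy
  · exact key x y hx hy
  · rw [norm_sub_rev, norm_sub_rev x]; exact key y x hy hx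
  · rw [h0 x hx, h0 y hy, sub_zero, norm_zero]; positivity

/-- A Lipschitz map at bounded distance from the identity has a zero. -/
theorem exists_zero_of_lipschitz_near_id {d : ℕ} {F : (Fin d → ℝ) → (Fin d → ℝ)} {C ρ : ℝ}
    (hC : 0 ≤ C) (hρ : 0 < ρ) (hF : ∀ x y, ‖F x - F y‖ ≤ C * ‖x - y‖)
    (hid : ∀ x, ‖F x - x‖ ≤ ρ) : ∃ x, F x = 0 := by
  by_contra hne
  push Not at hne
  -- A cutoff equal to `1` for `‖x‖ ≤ ρ` and to `0` for `‖x‖ ≥ 2 * ρ`. It lets `H` interpolate from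
  -- `F` to the identity without creating zeros: `H x = 0` forces `‖x‖ ≤ ρ`, where `H = F`.
  set χ : (Fin d → ℝ) → ℝ := fun x => max 0 (min 1 (2 - ‖x‖ / ρ)) with hχ
  have hχ0 : ∀ x, 0 ≤ χ x := fun x => le_max_left _ _
  have hχ1 : ∀ x, χ x ≤ 1 := fun x => max_le zero_le_one (min_le_left _ _)
  have hχL : ∀ x y, |χ x - χ y| ≤ ‖x - y‖ / ρ := by
    intro x y
    have h1 : |χ x - χ y| ≤ |(2 - ‖x‖ / ρ) - (2 - ‖y‖ / ρ)| := by
      refine (le_trans (by simpa [hχ, max_comm] using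
        abs_max_sub_max_le_abs (min 1 (2 - ‖x‖ / ρ)) (min 1 (2 - ‖y‖ / ρ)) 0) ?_)
      have := abs_min_sub_min_le_max 1 (2 - ‖x‖ / ρ) 1 (2 - ‖y‖ / ρ)
      simpa using this
    refine h1.trans ?_
    rw [sub_sub_sub_cancel_left, ← sub_div, abs_div, abs_of_pos hρ, norm_sub_rev]
    gcongr
    exact abs_norm_sub_norm_le y x
  set H : (Fin d → ℝ) → (Fin d → ℝ) := fun x => x + χ x • (F x - x) with hH
  have hHL : ∀ x y, ‖H x - H y‖ ≤ (C + 3) * ‖x - y‖ := by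
    intro x y
    have e : H x - H y = (x - y) + χ x • ((F x - F y) - (x - y)) + (χ x - χ y) • (F y - y) := by
      simp only [hH]; module
    rw [e]
    have h1 : ‖χ x • ((F x - F y) - (x - y))‖ ≤ (C + 1) * ‖x - y‖ := by
      rw [norm_smul, Real.norm_eq_abs, abs_of_nonneg (hχ0 x)]
      refine (mul_le_of_le_one_left (norm_nonneg _) (hχ1 x)).trans ?_
      refine (norm_sub_le _ _).trans ?_
      linarith [hF x y]
    have h2 : ‖(χ x - χ y) • (F y - y)‖ ≤ ‖x - y‖ := by
      rw [norm_smul, Real.norm_eq_abs]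
      calc |χ x - χ y| * ‖F y - y‖ ≤ ‖x - y‖ / ρ * ρ :=
            mul_le_mul (hχL x y) (hid y) (norm_nonneg _) (by positivity)
        _ = ‖x - y‖ := div_mul_cancel₀ _ hρ.ne'
    have := norm_add₃_le (a := x - y) (b := χ x • ((F x - F y) - (x - y)))
      (c := (χ x - χ y) • (F y - y))
    linarith
  have hHc : Continuous H := by
    have : LipschitzWith (Real.toNNReal (C + 3)) H := LipschitzWith.of_dist_le_mul fun x y => by
      rw [Real.coe_toNNReal _ (by positivity), dist_eq_norm, dist_eq_norm]; exact hHL x y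
    exact this.continuous
  have hHne : ∀ x, H x ≠ 0 := by
    intro x hx
    rcases le_or_gt ‖x‖ ρ with h | h
    · have h1 : χ x = 1 := by
        have : 1 ≤ 2 - ‖x‖ / ρ := by
          have := (div_le_one hρ).2 h
          linarith
        simp [hχ, this]
      apply hne x
      simpa [hH, h1] using hx
    · have h1 : x = -(χ x • (F x - x)) := eq_neg_of_add_eq_zero_left hx
      have h2 : ‖x‖ ≤ ρ := by
        rw [h1, norm_neg, norm_smul, Real.norm_eq_abs, abs_of_nonneg (hχ0 x)]
        exact (mul_le_of_le_one_left (norm_nonneg _) (hχ1 x)).trans (hid x)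
      linarith
  have hHid : ∀ x, 2 * ρ ≤ ‖x‖ → H x = x := by
    intro x hx
    have h1 : χ x = 0 := by
      have : 2 - ‖x‖ / ρ ≤ 0 := by
        have := (le_div_iff₀ hρ).2 hx
        linarith
      simp only [hχ]
      exact max_eq_left ((min_le_right _ _).trans this)
    simp [hH, h1]
  obtain ⟨x₀, -, hx₀⟩ := (isCompact_closedBall (0 : Fin d → ℝ) (2 * ρ)).exists_isMinOn
    ⟨0, by simp [hρ.le]⟩ hHc.norm.continuousOn
  set δ : ℝ := ‖H x₀‖ with hδ
  have hδ0 : 0 < δ := norm_pos_iff.2 (hHne x₀)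
  have hδH : ∀ x, ‖x‖ ≤ 2 * ρ → δ ≤ ‖H x‖ := fun x hx => hx₀ (by simpa using hx)
  -- Chosen so that `x + w x` is the radial projection of `H x` to the sphere of radius `2 * ρ`,
  -- which would be a Lipschitz retraction.
  set w : (Fin d → ℝ) → (Fin d → ℝ) := fun x =>
    if ‖x‖ ≤ 2 * ρ then (2 * ρ) • (‖H x‖⁻¹ • H x) - x else 0 with hw
  have hw0 : ∀ x, 2 * ρ ≤ ‖x‖ → w x = 0 := by
    intro x hx
    rcases hx.eq_or_lt with h | h
    · simp only [hw, h.symm.le, if_true]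
      rw [hHid x hx, smul_smul, h, mul_inv_cancel₀ (by rw [← h]; positivity), one_smul, sub_self]
    · simp [hw, not_le.2 h]
  set L : ℝ := 2 * ρ * (2 / δ * (C + 3)) + 1 with hL
  have hLpos : 0 ≤ L := by positivity
  have hwL : ∀ x y, ‖x‖ ≤ 2 * ρ → ‖y‖ ≤ 2 * ρ → ‖w x - w y‖ ≤ L * ‖x - y‖ := by
    intro x y hx hy
    simp only [hw, hx, hy, if_true]
    rw [sub_sub_sub_comm, ← smul_sub]
    refine (norm_sub_le _ _).trans ?_
    rw [norm_smul, Real.norm_eq_abs, abs_of_pos (by positivity : (0 : ℝ) < 2 * ρ), hL, add_mul,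
      one_mul, mul_assoc (2 * ρ)]
    gcongr
    refine (norm_inv_smul_sub_le (hHne x) (hHne y)).trans ?_
    rw [mul_assoc]
    gcongr
    · exact hδH x hx
    · exact hHL x y
  have hwLip : LipschitzWith (Real.toNNReal L) w := LipschitzWith.of_dist_le_mul fun x y => by
    rw [Real.coe_toNNReal _ hLpos, dist_eq_norm, dist_eq_norm]
    exact norm_sub_le_of_eq_zero_outside hLpos hwL hw0 x y
  refine no_lipschitz_retraction hwLip (R := 2 * ρ) (by positivity) hw0 fun x hx => ?_
  simp only [hw, hx.le, if_true, add_sub_cancel]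
  rw [norm_smul, norm_smul, norm_inv, norm_norm, inv_mul_cancel₀ (norm_ne_zero_iff.2 (hHne x)),
    mul_one, Real.norm_eq_abs, abs_of_pos (by positivity)]

/-- The map pushing the ball of radius `ε` around `c` radially onto its boundary. -/
theorem norm_push_sub_push_le {E : Type*} [NormedAddCommGroup E] [NormedSpace ℝ E] {ε δ : ℝ}
    (hε : 0 < ε) (hδ : 0 < δ) {a b : E} (ha : δ ≤ ‖a‖) (hb : δ ≤ ‖b‖) :
    ‖max 1 (ε / ‖a‖) • a - max 1 (ε / ‖b‖) • b‖ ≤ (1 + 2 * ε / δ) * ‖a - b‖ := by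
  have ha' : 0 < ‖a‖ := hδ.trans_le ha
  have hb' : 0 < ‖b‖ := hδ.trans_le hb
  have e : max 1 (ε / ‖a‖) • a - max 1 (ε / ‖b‖) • b =
      max 1 (ε / ‖a‖) • (a - b) + (max 1 (ε / ‖a‖) - max 1 (ε / ‖b‖)) • b := by module
  have h1 : max 1 (ε / ‖a‖) ≤ 1 + ε / δ := max_le (by linarith [div_pos hε hδ])
    ((div_le_div_of_nonneg_left hε.le hδ ha).trans (by linarith))
  have h2 : |max 1 (ε / ‖a‖) - max 1 (ε / ‖b‖)| ≤ |ε / ‖a‖ - ε / ‖b‖| := by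
    simpa using abs_max_sub_max_le_max 1 (ε / ‖a‖) 1 (ε / ‖b‖)
  have h3 : |ε / ‖a‖ - ε / ‖b‖| * ‖b‖ = ε / ‖a‖ * |‖b‖ - ‖a‖| := by
    rw [div_sub_div _ _ ha'.ne' hb'.ne', abs_div, abs_of_pos (mul_pos ha' hb'), mul_comm ‖a‖ ε,
      ← mul_sub, abs_mul, abs_of_pos hε]
    field_simp
  rw [e]
  refine (norm_add_le _ _).trans ?_
  rw [norm_smul, norm_smul, Real.norm_eq_abs, Real.norm_eq_abs,
    abs_of_pos (zero_lt_one.trans_le (le_max_left _ _))]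
  have h4 := abs_norm_sub_norm_le b a
  rw [norm_sub_rev] at h4
  have h5 : |max 1 (ε / ‖a‖) - max 1 (ε / ‖b‖)| * ‖b‖ ≤ ε / δ * ‖a - b‖ := by
    refine (mul_le_mul_of_nonneg_right h2 hb'.le).trans ?_
    rw [h3]
    gcongr
  have h6 := mul_le_mul_of_nonneg_right h1 (norm_nonneg (a - b))
  have h7 : (1 + 2 * ε / δ) * ‖a - b‖ = (1 + ε / δ) * ‖a - b‖ + ε / δ * ‖a - b‖ := by ring
  linarith

/-- A special case of invariance of domain: a map of `ℝ^d` into itself which is Lipschitz with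
Lipschitz inverse is onto. -/
theorem surjective_of_bilipschitz {d : ℕ} {φ : (Fin d → ℝ) → (Fin d → ℝ)} {C : ℝ} (hC : 0 < C)
    (hφ : ∀ x y, ‖φ x - φ y‖ ≤ C * ‖x - y‖) (hφ' : ∀ x y, ‖x - y‖ ≤ C * ‖φ x - φ y‖) :
    Function.Surjective φ := by
  rw [← Set.range_eq_univ]
  by_contra hns
  have hinj : Function.Injective φ := fun x y hxy => by
    have := hφ' x y
    rw [hxy, sub_self, norm_zero, mul_zero] at this
    exact sub_eq_zero.1 (norm_le_zero_iff.1 this)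
  have hφanti : AntilipschitzWith (Real.toNNReal C) φ := AntilipschitzWith.of_le_mul_dist
    fun x y => by rw [Real.coe_toNNReal _ hC.le, dist_eq_norm, dist_eq_norm]; exact hφ' x y
  have hφL : LipschitzWith (Real.toNNReal C) φ := LipschitzWith.of_dist_le_mul
    fun x y => by rw [Real.coe_toNNReal _ hC.le, dist_eq_norm, dist_eq_norm]; exact hφ x y
  have hclosed : IsClosed (Set.range φ) := hφanti.isClosed_range hφL.uniformContinuous
  obtain ⟨q, hq⟩ := nonempty_frontier_iff.2 ⟨Set.range_nonempty φ, hns⟩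
  obtain ⟨u, rfl⟩ : q ∈ Set.range φ := hclosed.frontier_subset hq
  -- a Lipschitz left inverse, normalised to vanish at `φ u`
  obtain ⟨G, hGL, hG⟩ : ∃ G : (Fin d → ℝ) → (Fin d → ℝ), LipschitzWith (Real.toNNReal C) G ∧
      ∀ x, G (φ x) = x - u := by
    have : LipschitzOnWith (Real.toNNReal C) (fun y => Function.invFun φ y - u) (Set.range φ) := by
      refine LipschitzOnWith.of_dist_le_mul ?_
      rintro _ ⟨x, rfl⟩ _ ⟨y, rfl⟩
      rw [dist_sub_right, Function.leftInverse_invFun hinj, Function.leftInverse_invFun hinj]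
      exact hφanti.le_mul_dist x y
    obtain ⟨G, hG, hG'⟩ := this.extend_pi
    refine ⟨G, hG, fun x => ?_⟩
    rw [← hG' ⟨x, rfl⟩]
    simp only [Function.leftInverse_invFun hinj x]
  have hGL' : ∀ x y, ‖G x - G y‖ ≤ C * ‖x - y‖ := fun x y => by
    have := hGL.dist_le_mul x y
    rwa [Real.coe_toNNReal _ hC.le, dist_eq_norm, dist_eq_norm] at this
  obtain ⟨c, hc, hcq⟩ : ∃ c, c ∉ Set.range φ ∧ ‖φ u - c‖ < 1 / 2 := by
    rw [frontier_eq_closure_inter_closure] at hq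
    obtain ⟨c, hc, h⟩ := Metric.mem_closure_iff.1 hq.2 (1 / 2) (by norm_num)
    exact ⟨c, hc, by rwa [dist_eq_norm] at h⟩
  obtain ⟨δ, hδ, hδc⟩ : ∃ δ > 0, ∀ x, δ ≤ ‖φ x - c‖ := by
    obtain ⟨δ, hδ, h⟩ := Metric.isOpen_iff.1 hclosed.isOpen_compl c hc
    refine ⟨δ, hδ, fun x => ?_⟩
    by_contra hx
    exact h (show φ x ∈ Metric.ball c δ by
      rw [Metric.mem_ball, dist_eq_norm]; exact not_le.1 hx) ⟨x, rfl⟩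
  -- The image of the sphere is a null set and cannot fill a ball around `0`, so a small translation
  -- by `c'` moves zero off it.
  obtain ⟨c', hc', hc's⟩ : ∃ c', c' ∉ G '' Metric.sphere c 1 ∧ ‖c'‖ < 1 / (2 * C) := by
    by_contra hcon
    push Not at hcon
    have hsub : Metric.ball (0 : Fin d → ℝ) (1 / (2 * C)) ⊆ G '' Metric.sphere c 1 := by
      intro x hx
      by_contra hx'
      exact absurd (hcon x hx') (not_le.2 (by simpa using hx))
    have h0 : volume (G '' Metric.sphere c 1) = 0 :=
      volume_lipschitz_image_eq_zero hGL (Measure.addHaar_sphere_of_ne_zero _ _ one_ne_zero)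
    exact (Metric.isOpen_ball.measure_pos volume ⟨(0 : Fin d → ℝ), by simp [hC]⟩).ne'
      (measure_mono_null hsub h0)
  -- `P` expels the unit ball around the missed point `c`. It is Lipschitz on the range of `φ`,
  -- which stays at distance `δ` from `c`. The resulting `F` is at bounded distance from the
  -- identity and yet will turn out to have no zero.
  set P : (Fin d → ℝ) → (Fin d → ℝ) := fun y => c + max 1 (1 / ‖y - c‖) • (y - c) with hP
  set F : (Fin d → ℝ) → (Fin d → ℝ) := fun x => G (P (φ (x + u))) - c' with hF
  have hFL : ∀ x y, ‖F x - F y‖ ≤ C * ((1 + 2 * 1 / δ) * C) * ‖x - y‖ := by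
    intro x y
    simp only [hF, sub_sub_sub_cancel_right]
    refine (hGL' _ _).trans ?_
    rw [mul_assoc, mul_assoc]
    refine mul_le_mul_of_nonneg_left ?_ hC.le
    simp only [hP, add_sub_add_left_eq_sub]
    refine (norm_push_sub_push_le one_pos hδ (hδc _) (hδc _)).trans ?_
    refine mul_le_mul_of_nonneg_left ?_ (by positivity)
    rw [sub_sub_sub_cancel_right]
    simpa using hφ (x + u) (y + u)
  have hPfar : ∀ y, 1 ≤ ‖y - c‖ → P y = y := fun y hy => by
    have : 1 / ‖y - c‖ ≤ 1 := (div_le_one (by linarith)).2 hy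
    simp only [hP, max_eq_left this, one_smul, add_sub_cancel]
  have hPnear : ∀ y, 0 < ‖y - c‖ → ‖y - c‖ ≤ 1 → ‖P y - c‖ = 1 ∧ ‖P y - y‖ ≤ 1 := fun y hy0 hy => by
    have h1 : 1 ≤ 1 / ‖y - c‖ := (le_div_iff₀ hy0).2 (by linarith)
    simp only [hP, max_eq_right h1]
    constructor
    · rw [add_sub_cancel_left, norm_smul, Real.norm_eq_abs, abs_of_pos (by positivity),
        one_div_mul_cancel hy0.ne']
    · have : c + (1 / ‖y - c‖) • (y - c) - y = (1 / ‖y - c‖ - 1) • (y - c) := by module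
      rw [this, norm_smul, Real.norm_eq_abs, abs_of_nonneg (by linarith), sub_mul,
        one_div_mul_cancel hy0.ne']
      linarith
  obtain ⟨x, hx⟩ := exists_zero_of_lipschitz_near_id (F := F) (ρ := C + 1 / (2 * C))
    (by positivity) (by positivity) hFL (fun x => by
      have h1 : ‖G (P (φ (x + u))) - G (φ (x + u))‖ ≤ C := by
        rcases le_total 1 ‖φ (x + u) - c‖ with h | h
        · rw [hPfar _ h, sub_self, norm_zero]; exact hC.le
        · refine (hGL' _ _).trans ?_
          exact mul_le_of_le_one_right hC.le (hPnear _ (hδ.trans_le (hδc _)) h).2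
      have h2 : F x - x = (G (P (φ (x + u))) - G (φ (x + u))) - c' := by
        rw [hG, add_sub_cancel_right]; simp only [hF]; abel
      rw [h2]
      exact (norm_sub_le _ _).trans (add_le_add h1 hc's.le))
  have hx' : G (P (φ (x + u))) = c' := sub_eq_zero.1 hx
  -- If `P` fixes `φ (x + u)`, then `x = c'` is so small that `φ (x + u)` lies within `1/2` of `φ
  -- u`, hence less than `1` from `c`. Otherwise `c'` lies in the image of the sphere, which was
  -- excluded.
  rcases le_total 1 ‖φ (x + u) - c‖ with h | h
  · rw [hPfar _ h, hG, add_sub_cancel_right] at hx'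
    have h1 := hφ (x + u) u
    rw [add_sub_cancel_right, hx'] at h1
    have h2 : ‖φ (x + u) - c‖ ≤ ‖φ (x + u) - φ u‖ + ‖φ u - c‖ := norm_sub_le_norm_sub_add_norm_sub _ _ _
    rw [hx'] at h2 h
    have h3 : C * ‖c'‖ < 1 / 2 := by
      calc C * ‖c'‖ < C * (1 / (2 * C)) := mul_lt_mul_of_pos_left hc's hC
        _ = 1 / 2 := by field_simp
    linarith
  · exact hc' ⟨_, by
      rw [Metric.mem_sphere, dist_eq_norm]
      exact (hPnear _ (hδ.trans_le (hδc _)) h).1, hx'⟩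

/-! ### Pixels close to the boundary of the foreground -/

/-- The Euclidean norm on `Fin d → ℝ`. -/
def euclNorm {d : ℕ} (x : Fin d → ℝ) : ℝ := ‖WithLp.toLp 2 x‖

theorem euclNorm_lt_one_iff {d : ℕ} (x : Fin d → ℝ) : euclNorm x < 1 ↔ x ∈ euclideanBall d := by
  have h : euclNorm x ^ 2 = ∑ k, x k ^ 2 := by
    rw [euclNorm, EuclideanSpace.norm_sq_eq]
    simp
  rw [euclideanBall, Set.mem_ofPred_eq, ← h,
    sq_lt_one_iff₀ (show 0 ≤ euclNorm x from norm_nonneg _)]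

theorem euclNorm_le {d : ℕ} (x : Fin d → ℝ) : euclNorm x ≤ d * ‖x‖ := by
  refine abs_le_of_sq_le_sq' ?_ (by positivity) |>.2
  rw [euclNorm, EuclideanSpace.norm_sq_eq]
  calc ∑ k, ‖(WithLp.toLp 2 x : EuclideanSpace ℝ (Fin d)) k‖ ^ 2 ≤ ∑ _k : Fin d, ‖x‖ ^ 2 :=
        Finset.sum_le_sum fun k _ => by
          gcongr
          exact norm_le_pi_norm x k
    _ = d * ‖x‖ ^ 2 := by simp
    _ ≤ (d * ‖x‖) ^ 2 := by
        rw [mul_pow]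
        gcongr
        have : d ≤ d ^ 2 := Nat.le_self_pow two_ne_zero d
        exact_mod_cast this

theorem abs_euclNorm_sub_le {d : ℕ} (x y : Fin d → ℝ) :
    |euclNorm x - euclNorm y| ≤ d * ‖x - y‖ :=
  (abs_norm_sub_norm_le (WithLp.toLp 2 x) (WithLp.toLp 2 y)).trans (euclNorm_le (x - y))

theorem euclNorm_smul {d : ℕ} (c : ℝ) (x : Fin d → ℝ) : euclNorm (c • x) = |c| * euclNorm x := by
  simp [euclNorm, norm_smul]

open scoped Pointwise in
theorem volume_euclNorm_lt {d : ℕ} {R : ℝ} (hR : 0 < R) :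
    volume {x : Fin d → ℝ | euclNorm x < R} =
      ENNReal.ofReal (R ^ d) * volume {x : Fin d → ℝ | euclNorm x < 1} := by
  have h : {x : Fin d → ℝ | euclNorm x < R} = R • {x : Fin d → ℝ | euclNorm x < 1} := by
    ext x
    rw [Set.mem_smul_set_iff_inv_smul_mem₀ hR.ne', Set.mem_ofPred_eq, Set.mem_ofPred_eq,
      euclNorm_smul, abs_of_pos (inv_pos.2 hR), inv_mul_lt_one₀ hR]
  rw [h, Measure.addHaar_smul, Module.finrank_fin_fun, abs_of_pos (pow_pos hR _)]

theorem volume_euclNorm_lt_one_lt_top (d : ℕ) :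
    volume {x : Fin d → ℝ | euclNorm x < 1} < ⊤ := by
  refine lt_of_le_of_lt (measure_mono fun x hx => ?_)
    (measure_closedBall_lt_top (x := (0 : Fin d → ℝ)) (r := 1))
  rw [mem_closedBall_zero_iff, pi_norm_le_iff_of_nonneg zero_le_one]
  intro k
  exact (PiLp.norm_apply_le (WithLp.toLp 2 x : EuclideanSpace ℝ (Fin d)) k).trans (le_of_lt hx)

theorem volume_euclNorm_lt_ne_top {d : ℕ} {R : ℝ} (hR : 0 < R) :
    volume {x : Fin d → ℝ | euclNorm x < R} ≠ ⊤ := by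
  rw [volume_euclNorm_lt hR]
  exact ENNReal.mul_ne_top ENNReal.ofReal_ne_top (volume_euclNorm_lt_one_lt_top d).ne

theorem continuous_euclNorm (d : ℕ) : Continuous (euclNorm : (Fin d → ℝ) → ℝ) :=
  (PiLp.continuous_toLp 2 _).norm

theorem one_add_pow_sub_one_sub_pow_le (d : ℕ) {T : ℝ} (h0 : 0 ≤ T) (h1 : T ≤ 1) :
    (1 + T) ^ d - (1 - T) ^ d ≤ d * 2 ^ d * T := by
  induction d with
  | zero => simp
  | succ d ih =>
    have h2 : (1 + T) ^ d ≤ 2 ^ d := by gcongr; linarith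
    have h3 : (1 - T) ^ d ≤ 2 ^ d := by
      refine (pow_le_one₀ (by linarith) (by linarith)).trans (one_le_pow₀ (by norm_num))
    have h4 : T * ((1 + T) ^ d + (1 - T) ^ d) ≤ T * (2 ^ d + 2 ^ d) := by gcongr
    have h5 : (0 : ℝ) ≤ d * 2 ^ d * T := by positivity
    push_cast
    rw [pow_succ, pow_succ, pow_succ]
    nlinarith

/-- By scaling, the volume is a difference of `d`-th powers of the two radii times that of the unit
ball. -/
theorem volume_annulus_le (d : ℕ) {T : ℝ} (h0 : 0 ≤ T) (h1 : T < 1) :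
    volume.real {x : Fin d → ℝ | 1 - T ≤ euclNorm x ∧ euclNorm x < 1 + T} ≤
      d * 2 ^ d * T * volume.real {x : Fin d → ℝ | euclNorm x < 1} := by
  have hm : MeasurableSet {x : Fin d → ℝ | euclNorm x < 1 - T} :=
    measurableSet_lt (continuous_euclNorm d).measurable measurable_const
  have e : {x : Fin d → ℝ | 1 - T ≤ euclNorm x ∧ euclNorm x < 1 + T} =
      {x | euclNorm x < 1 + T} \ {x | euclNorm x < 1 - T} := by
    ext x
    simp [and_comm]
  have hr : ∀ R : ℝ, 0 < R → volume.real {x : Fin d → ℝ | euclNorm x < R} =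
      R ^ d * volume.real {x : Fin d → ℝ | euclNorm x < 1} := fun R hR => by
    rw [Measure.real, volume_euclNorm_lt hR, ENNReal.toReal_mul,
      ENNReal.toReal_ofReal (pow_nonneg hR.le _)]
    rfl
  have hsub : {x : Fin d → ℝ | euclNorm x < 1 - T} ⊆ {x | euclNorm x < 1 + T} := fun x hx => by
    rw [Set.mem_ofPred_eq] at hx ⊢
    linarith
  rw [e, measureReal_sdiff hsub hm (volume_euclNorm_lt_ne_top (by linarith)),
    hr (1 + T) (by linarith), hr (1 - T) (by linarith), ← sub_mul]
  gcongr
  exact one_add_pow_sub_one_sub_pow_le d h0 h1.le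

/-- Separated points of an annulus: the packing bound. -/
theorem card_mul_pow_le_of_separated {d : ℕ} {ι : Type*} (A : Finset ι) (u : ι → Fin d → ℝ)
    {δ T : ℝ} (hδ : 0 < δ) (hT0 : 0 ≤ T) (hT : T < 1)
    (hsep : ∀ i ∈ A, ∀ j ∈ A, i ≠ j → 2 * δ ≤ ‖u i - u j‖)
    (hu : ∀ i ∈ A, 1 - T + d * δ ≤ euclNorm (u i) ∧ euclNorm (u i) ≤ 1 + T - d * δ) :
    A.card * (2 * δ) ^ d ≤ d * 2 ^ d * T * volume.real {x : Fin d → ℝ | euclNorm x < 1} := by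
  refine le_trans ?_ (volume_annulus_le d hT0 hT)
  have hfin : volume {x : Fin d → ℝ | 1 - T ≤ euclNorm x ∧ euclNorm x < 1 + T} ≠ ⊤ := by
    refine ne_top_of_le_ne_top (volume_euclNorm_lt_ne_top (R := 1 + T) (by linarith))
      (measure_mono fun x hx => ?_)
    rw [Set.mem_ofPred_eq] at hx ⊢
    exact hx.2
  have hdisj : Set.PairwiseDisjoint (↑A) fun i => Metric.ball (u i) δ := by
    intro i hi j hj hij
    refine Metric.ball_disjoint_ball ?_
    rw [dist_eq_norm]
    linarith [hsep i hi j hj hij]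
  have hsub : (⋃ i ∈ A, Metric.ball (u i) δ) ⊆
      {x : Fin d → ℝ | 1 - T ≤ euclNorm x ∧ euclNorm x < 1 + T} := by
    intro x hx
    simp only [Set.mem_iUnion, Metric.mem_ball, dist_eq_norm] at hx
    obtain ⟨i, hi, hx⟩ := hx
    have h1 := abs_le.1 (abs_euclNorm_sub_le x (u i))
    -- For `d = 0` the strict inequality below degenerates, but then `euclNorm (u i) = 0` already
    -- contradicts the lower bound `1 - T > 0`.
    rcases Nat.eq_zero_or_pos d with hd | hd
    · subst hd
      have : x = u i := Subsingleton.elim _ _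
      have h0 : euclNorm (u i) ≤ 0 := by simpa using euclNorm_le (u i)
      have := (hu i hi).1
      simp at this
      linarith
    have h2 : (d : ℝ) * ‖x - u i‖ < d * δ := by
      have : (0 : ℝ) < d := by exact_mod_cast hd
      gcongr
    have h3 := hu i hi
    constructor <;> linarith
  calc (A.card : ℝ) * (2 * δ) ^ d = ∑ i ∈ A, volume.real (Metric.ball (u i) δ) := by
        simp [Measure.real, Real.volume_pi_ball _ hδ, hδ.le]
    _ = volume.real (⋃ i ∈ A, Metric.ball (u i) δ) :=
        (measureReal_biUnion_finset hdisj (fun i _ => Metric.isOpen_ball.measurableSet)).symm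
    _ ≤ _ := measureReal_mono hsub hfin

theorem inv_le_norm_gridPoint_sub {d n : ℕ} (hn : 0 < n) {i j : Pixel d n} (hij : i ≠ j) :
    1 / (n : ℝ) ≤ ‖gridPoint i - gridPoint j‖ := by
  obtain ⟨k, hk⟩ := Function.ne_iff.1 hij
  refine le_trans ?_ (norm_le_pi_norm _ k)
  have hn' : (0 : ℝ) < n := by exact_mod_cast hn
  have hk' : ((i k : ℕ) : ℤ) - (j k : ℕ) ≠ 0 := fun h => hk (Fin.ext (by omega))
  have h1 : (1 : ℝ) ≤ |((i k : ℕ) : ℝ) - ((j k : ℕ) : ℝ)| := by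
    exact_mod_cast Int.one_le_abs hk'
  have h2 : gridPoint i k - gridPoint j k = (((i k : ℕ) : ℝ) - ((j k : ℕ) : ℝ)) / n := by
    simp only [gridPoint]; ring
  rw [Pi.sub_apply, h2, Real.norm_eq_abs, abs_div, abs_of_pos hn']
  gcongr

theorem card_pixel (d n : ℕ) : Fintype.card (Pixel d n) = n ^ d := by simp

open Classical in
/-- The pixels whose window of radius `h` meets both the foreground and the background. -/
def boundaryPixels {d n : ℕ} (Ω : Set (Fin d → ℝ)) (h : ℝ) : Finset (Pixel d n) :=
  Finset.univ.filter fun i => ∃ j : Pixel d n, ‖gridPoint i - gridPoint j‖ ≤ h ∧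
    (gridPoint i ∈ Ω ↔ gridPoint j ∉ Ω)

theorem mem_boundaryPixels {d n : ℕ} {Ω : Set (Fin d → ℝ)} {h : ℝ} {i : Pixel d n} :
    i ∈ boundaryPixels Ω h ↔ ∃ j : Pixel d n, ‖gridPoint i - gridPoint j‖ ≤ h ∧
      (gridPoint i ∈ Ω ↔ gridPoint j ∉ Ω) := by
  simp [boundaryPixels]

/-- If a window of radius `h` crosses the boundary, the preimages under `φ` of its two pixels lie on
different sides of the unit sphere and within `C₀ h` of each other, so the centre is pulled back to
an annulus of width of order `h`. As `φ` is `C₀`-Lipschitz, preimages of distinct grid points are `1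
/ (C₀ n)` apart, and packing bounds their number. -/
theorem exists_card_boundaryPixels_le (d : ℕ) {C₀ : ℝ} (hC : 0 < C₀) :
    ∃ C : ℝ, 0 < C ∧ ∀ (n : ℕ) (h : ℝ), 1 ≤ n * h → ∀ Ω, IsForeground d C₀ Ω →
      ((boundaryPixels Ω h : Finset (Pixel d n)).card : ℝ) ≤ C * h * n ^ d := by
  -- The term `d * C₀` covers the distance of the preimages from the sphere, the next one the radii
  -- `1 / (2 * C₀ * n)` of the packed balls, using `1 / n ≤ h`; `d` also converts sup norm to
  -- Euclidean norm.
  set T₁ : ℝ := d * C₀ + 2 * d * (1 / (2 * C₀)) + 1 with hT₁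
  have hT₁pos : 0 < T₁ := by positivity
  set V : ℝ := volume.real {x : Fin d → ℝ | euclNorm x < 1} with hV
  have hV0 : 0 ≤ V := measureReal_nonneg
  refine ⟨T₁ + C₀ ^ d * (d * 2 ^ d * T₁ * V), by positivity, ?_⟩
  rintro n h hnh Ω ⟨-, φ, -, hφ, hφ', rfl⟩
  have hn0 : n ≠ 0 := by
    rintro rfl
    norm_num at hnh
  have hn : (0 : ℝ) < n := by exact_mod_cast Nat.pos_of_ne_zero hn0
  have hh : 0 < h := pos_of_mul_pos_right (zero_lt_one.trans_le hnh) hn.le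
  set A : Finset (Pixel d n) := boundaryPixels (φ '' euclideanBall d) h with hA
  -- For large `h` the total number of pixels is already an adequate bound.
  rcases le_or_gt 1 (T₁ * h) with hT | hT
  · have h1 : (A.card : ℝ) ≤ n ^ d := by
      have := Finset.card_le_univ A
      rw [card_pixel] at this
      exact_mod_cast this
    have h2 : (1 : ℝ) * n ^ d ≤ T₁ * h * n ^ d := by gcongr
    have h3 : 0 ≤ C₀ ^ d * (d * 2 ^ d * T₁ * V) * h * n ^ d := by positivity
    nlinarith
  have hsurj := surjective_of_bilipschitz hC hφ hφ'
  have hinj : Function.Injective φ := fun x y hxy => by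
    have := hφ' x y
    rw [hxy, sub_self, norm_zero, mul_zero] at this
    exact sub_eq_zero.1 (norm_le_zero_iff.1 this)
  choose u hu using fun i : Pixel d n => hsurj (gridPoint i)
  have hmem : ∀ i, gridPoint i ∈ φ '' euclideanBall d ↔ euclNorm (u i) < 1 := fun i => by
    rw [← hu, hinj.mem_set_image, euclNorm_lt_one_iff]
  have hinvn : 1 / (n : ℝ) ≤ h := by
    rw [div_le_iff₀ hn]
    linarith
  have hdδ : 2 * d * (1 / (2 * C₀ * n)) ≤ (T₁ - d * C₀) * h := by
    have e : 2 * d * (1 / (2 * C₀ * n)) = 2 * d * (1 / (2 * C₀)) * (1 / (n : ℝ)) := by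
      field_simp
    rw [e, hT₁, add_assoc, add_sub_cancel_left]
    gcongr
    linarith
  have key := card_mul_pow_le_of_separated A u (δ := 1 / (2 * C₀ * n)) (T := T₁ * h)
    (by positivity) (by positivity) hT (by
      intro i _ j _ hij
      have h1 := hφ (u i) (u j)
      rw [hu, hu] at h1
      have h2 := (inv_le_norm_gridPoint_sub (Nat.pos_of_ne_zero hn0) hij).trans h1
      have e : 2 * (1 / (2 * C₀ * n)) = 1 / (n : ℝ) / C₀ := by field_simp
      rw [e, div_le_iff₀ hC]
      linarith) (by
      intro i hi
      obtain ⟨j, hij, hiff⟩ := mem_boundaryPixels.1 hi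
      rw [hmem, hmem, not_lt] at hiff
      have h1 := hφ' (u i) (u j)
      rw [hu, hu] at h1
      have h2 : ‖u i - u j‖ ≤ C₀ * h := h1.trans (mul_le_mul_of_nonneg_left hij hC.le)
      have h3 : |euclNorm (u i) - euclNorm (u j)| ≤ d * (C₀ * h) :=
        (abs_euclNorm_sub_le _ _).trans (mul_le_mul_of_nonneg_left h2 (Nat.cast_nonneg d))
      have h4 := abs_le.1 h3
      have h5 : 0 ≤ d * (1 / (2 * C₀ * n)) := by positivity
      rcases lt_or_ge (euclNorm (u i)) 1 with h6 | h6
      · have := hiff.1 h6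
        constructor <;> nlinarith
      · have : euclNorm (u j) < 1 := by
          by_contra hcon
          exact absurd (hiff.2 (not_lt.1 hcon)) (not_lt.2 h6)
        constructor <;> nlinarith)
  have e : (2 * (1 / (2 * C₀ * n))) ^ d = 1 / (C₀ ^ d * (n : ℝ) ^ d) := by
    rw [← mul_pow, ← one_div_pow]
    congr 1
    field_simp
  rw [e, mul_one_div, div_le_iff₀ (by positivity)] at key
  have h3 : 0 ≤ T₁ * h * (n : ℝ) ^ d := by positivity
  calc (A.card : ℝ) ≤ d * 2 ^ d * (T₁ * h) * V * (C₀ ^ d * n ^ d) := key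
    _ ≤ (T₁ + C₀ ^ d * (d * 2 ^ d * T₁ * V)) * h * n ^ d := by nlinarith

/-! ### The Hölder class -/

/-- Either `strictFloor α = 0`, so that `α = 1` and the Hölder condition itself is a Lipschitz
condition, or the first partial derivatives are bounded and the mean value inequality applies on the
convex cube. -/
theorem HolderClass.norm_sub_le {d : ℕ} {α C₀ : ℝ} (hα : 1 ≤ α) (hC : 0 ≤ C₀)
    {g : (Fin d → ℝ) → ℝ} (hd : 1 ≤ d) (hg : HolderClass d α C₀ g) {x y : Fin d → ℝ}
    (hx : x ∈ cube d) (hy : y ∈ cube d) : |g x - g y| ≤ d * C₀ * ‖x - y‖ := by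
  have hd' : (1 : ℝ) ≤ d := by exact_mod_cast hd
  rcases Nat.eq_zero_or_pos (strictFloor α) with h0 | h0
  · have hα1 : α = 1 := by
      have h1 : ⌈α⌉₊ ≤ 1 := by unfold strictFloor at h0; omega
      have h2 := Nat.ceil_le.1 h1
      push_cast at h2
      linarith
    have h := hg.deriv_holder
    rw [h0] at h
    have h1 := h Fin.elim0 x hx y hy
    simp only [partialDeriv, iteratedFDerivWithin_zero_apply, hα1] at h1
    norm_num at h1
    refine h1.trans ?_
    rw [mul_assoc]
    exact le_mul_of_one_le_left (by positivity) hd'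
  · have hconv : Convex ℝ (cube d) := convex_Icc 0 1
    have hne : (interior (cube d)).Nonempty := by
      refine ⟨fun _ => 1 / 2, ?_⟩
      rw [cube, ← Set.pi_univ_Icc, interior_pi_set Set.finite_univ]
      intro k _
      simp only [Pi.zero_apply, Pi.one_apply, interior_Icc, Set.mem_Ioo]
      norm_num
    have hud : UniqueDiffOn ℝ (cube d) := uniqueDiffOn_convex hconv hne
    have hdiff : DifferentiableOn ℝ g (cube d) :=
      hg.smooth.differentiableOn (by exact_mod_cast h0.ne')
    have hb : ∀ z ∈ cube d, ‖fderivWithin ℝ g (cube d) z‖ ≤ d * C₀ := by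
      intro z hz
      refine ContinuousLinearMap.opNorm_le_bound _ (by positivity) fun v => ?_
      have hv : v = ∑ k, v k • (Pi.single k (1 : ℝ) : Fin d → ℝ) := by
        ext l
        simp [Finset.sum_apply, Pi.single_apply]
      have hk : ∀ k, |fderivWithin ℝ g (cube d) z (Pi.single k 1)| ≤ C₀ := fun k => by
        have := hg.deriv_bound 1 le_rfl h0 (fun _ => k) z hz
        rwa [partialDeriv, iteratedFDerivWithin_one_apply (hud z hz)] at this
      conv_lhs => rw [hv]
      rw [map_sum]
      calc ‖∑ k, fderivWithin ℝ g (cube d) z (v k • Pi.single k 1)‖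
          ≤ ∑ k : Fin d, ‖v‖ * C₀ := by
            refine norm_sum_le_of_le _ fun k _ => ?_
            rw [map_smul, norm_smul]
            exact mul_le_mul (norm_le_pi_norm v k) (hk k) (abs_nonneg _) (norm_nonneg _)
        _ = d * C₀ * ‖v‖ := by simp; ring
    have := hconv.norm_image_sub_le_of_norm_fderivWithin_le hdiff hb hy hx
    simpa [Real.norm_eq_abs] using this

theorem HolderClass.const (d : ℕ) {α C₀ : ℝ} (hC : 0 ≤ C₀) {v : ℝ} (hv : v ∈ Set.Icc (0 : ℝ) 1) :
    HolderClass d α C₀ fun _ => v where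
  mem_unit _ _ := hv
  smooth := contDiffOn_const
  deriv_bound m hm _ t x _ := by
    rw [partialDeriv, iteratedFDerivWithin_const_of_ne (by omega)]
    simpa using hC
  deriv_holder t x _ x' _ := by
    -- A derivative of order zero is `v` itself and need not vanish, so this order is treated apart.
    rcases Nat.eq_zero_or_pos (strictFloor α) with h0 | h0
    · have : ∀ z, partialDeriv (strictFloor α) (fun _ => v) t z = v := by
        rw [h0] at t
        intro z
        have : ∀ (m : ℕ) (t : Fin m → Fin d), m = 0 →
            partialDeriv m (fun _ => v) t z = v := by
          rintro m t rfl
          simp [partialDeriv]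
        exact this _ _ h0
      rw [this, this, sub_self, abs_zero]
      positivity
    · rw [partialDeriv, partialDeriv, iteratedFDerivWithin_const_of_ne (by omega)]
      simp only [Pi.zero_apply, zero_apply, sub_zero, abs_zero]
      positivity

/-! ### Reproducing weights for polynomials on a box of pixels -/

theorem abs_prod_le_pow {ι : Type*} (s : Finset ι) (f : ι → ℝ) {B : ℝ}
    (hf : ∀ i ∈ s, |f i| ≤ B) : |∏ i ∈ s, f i| ≤ B ^ s.card := by
  rw [Finset.abs_prod]
  exact (Finset.prod_le_prod (fun _ _ => abs_nonneg _) hf).trans (by rw [Finset.prod_const])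

/-- Telescoping, one factor at a time; `1 ≤ B` allows all powers of `B` to be rounded up. It
transfers Lipschitz dependence from one-dimensional weights to their products. -/
theorem abs_prod_sub_prod_le {ι : Type*} (s : Finset ι) (f g : ι → ℝ) {B ε : ℝ} (hB : 1 ≤ B)
    (hε : 0 ≤ ε) (hf : ∀ i ∈ s, |f i| ≤ B) (hg : ∀ i ∈ s, |g i| ≤ B)
    (hfg : ∀ i ∈ s, |f i - g i| ≤ ε) :
    |∏ i ∈ s, f i - ∏ i ∈ s, g i| ≤ s.card * B ^ s.card * ε := by
  classical
  induction s using Finset.induction_on with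
  | empty => simp
  | insert i s hi ih =>
    rw [Finset.prod_insert hi, Finset.prod_insert hi, Finset.card_insert_of_notMem hi]
    have ih' := ih (fun j hj => hf j (Finset.mem_insert_of_mem hj))
      (fun j hj => hg j (Finset.mem_insert_of_mem hj))
      (fun j hj => hfg j (Finset.mem_insert_of_mem hj))
    have h1 := abs_prod_le_pow s f fun j hj => hf j (Finset.mem_insert_of_mem hj)
    have e : f i * ∏ j ∈ s, f j - g i * ∏ j ∈ s, g j =
        (f i - g i) * ∏ j ∈ s, f j + g i * (∏ j ∈ s, f j - ∏ j ∈ s, g j) := by ring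
    rw [e]
    refine (abs_add_le _ _).trans ?_
    rw [abs_mul, abs_mul]
    have h2 : |f i - g i| * |∏ j ∈ s, f j| ≤ ε * B ^ s.card :=
      mul_le_mul (hfg i (Finset.mem_insert_self _ _)) h1 (abs_nonneg _) hε
    have h3 : |g i| * |∏ j ∈ s, f j - ∏ j ∈ s, g j| ≤ B * (s.card * B ^ s.card * ε) :=
      mul_le_mul (hg i (Finset.mem_insert_self _ _)) ih' (abs_nonneg _) (by linarith)
    have h4 : ε * B ^ s.card ≤ ε * B ^ (s.card + 1) :=
      mul_le_mul_of_nonneg_left (pow_le_pow_right₀ hB (Nat.le_succ _)) hε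
    push_cast
    calc _ ≤ ε * B ^ (s.card + 1) + B * (s.card * B ^ s.card * ε) := by linarith
      _ = (s.card + 1) * B ^ (s.card + 1) * ε := by ring

/-- On `m ≥ r + 1` consecutive integers there are weights of size `O(1 / m)` that reproduce the
values of polynomials of degree `r` at all points of a neighbourhood, and that depend in a
Lipschitz manner on this point. -/
theorem exists_lagrange_weights (r : ℕ) : ∃ C : ℝ, 1 ≤ C ∧ ∀ a m : ℕ, r + 1 ≤ m →
    ∃ w : ℝ → ℕ → ℝ,
      (∀ p : Polynomial ℝ, p.natDegree ≤ r → ∀ t,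
        ∑ j ∈ Finset.Ico a (a + m), w t j * p.eval (j : ℝ) = p.eval t) ∧
      (∀ t, (a : ℝ) - m ≤ t → t ≤ a + 2 * m → ∀ j, |w t j| ≤ C / m) ∧
      (∀ t t', (a : ℝ) - m ≤ t → t ≤ a + 2 * m → (a : ℝ) - m ≤ t' → t' ≤ a + 2 * m → ∀ j,
        |w t j - w t' j| ≤ C / m * (|t - t'| / m)) := by
  set B : ℝ := 4 * (r + 1) with hB
  have hr1 : (1 : ℝ) ≤ r + 1 := by linarith [(Nat.cast_nonneg r : (0 : ℝ) ≤ r)]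
  have hB1 : 1 ≤ B := by rw [hB]; linarith
  refine ⟨4 * (r + 1) ^ 4 * B ^ r, ?_, fun a m hm => ?_⟩
  · have h1 : (1 : ℝ) ≤ (r + 1) ^ 4 := one_le_pow₀ hr1
    have h2 : (1 : ℝ) ≤ B ^ r := one_le_pow₀ hB1
    nlinarith
  -- A single interpolation on `r + 1` nodes would give weights of size `O(1)`. The nodes are
  -- therefore spaced by `q ≈ m / (r + 1)`, and the interpolations on the `q` translates of this
  -- family are averaged, which makes each weight `O(1 / q)`.
  set q : ℕ := m / (r + 1) with hq
  have hq1 : 1 ≤ q := (Nat.one_le_div_iff (Nat.succ_pos r)).2 hm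
  have hqm : (r + 1) * q ≤ m := Nat.mul_div_le m (r + 1)
  have hmq : (m : ℝ) ≤ 2 * (r + 1) * q := by
    have h1 : m < (q + 1) * (r + 1) := by
      have := Nat.lt_mul_div_succ m (Nat.succ_pos r)
      rw [← hq] at this
      calc m < (r + 1) * (q + 1) := this
        _ = _ := mul_comm _ _
    have h2 : m ≤ 2 * (r + 1) * q := by nlinarith
    exact_mod_cast h2
  have hq0 : (0 : ℝ) < q := by exact_mod_cast hq1
  have hm0 : (0 : ℝ) < m := by exact_mod_cast (Nat.succ_pos r).trans_le hm
  have hqinv : 1 / (q : ℝ) ≤ 2 * (r + 1) / m := by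
    rw [div_le_div_iff₀ hq0 hm0]
    linarith
  set v : ℕ → ℕ → ℝ := fun s k => ((a + k * q + s : ℕ) : ℝ) with hv
  set L : ℕ → ℕ → Polynomial ℝ := fun s k => Lagrange.basis (Finset.range (r + 1)) (v s) k with hL
  have hvinj : ∀ s, Function.Injective (v s) := fun s k l hkl => by
    have h : a + k * q + s = a + l * q + s := by
      simp only [hv] at hkl
      exact_mod_cast hkl
    have : k * q = l * q := by omega
    exact Nat.eq_of_mul_eq_mul_right hq1 this
  have hvm : ∀ s k, s < q → k ≤ r → a + k * q + s < a + m := fun s k hs hk => by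
    have : k * q + q ≤ (r + 1) * q := by nlinarith
    omega
  -- the factors of the Lagrange polynomials
  have hLeval : ∀ s k t, (L s k).eval t =
      ∏ l ∈ (Finset.range (r + 1)).erase k, (v s k - v s l)⁻¹ * (t - v s l) := fun s k t => by
    simp only [hL, Lagrange.basis, Lagrange.basisDivisor, Polynomial.eval_prod, Polynomial.eval_mul,
      Polynomial.eval_C, Polynomial.eval_sub, Polynomial.eval_X]
  have hinv : ∀ s k l, k ≠ l → |(v s k - v s l)⁻¹| ≤ 1 / q := fun s k l hkl => by
    have e : v s k - v s l = ((k : ℝ) - l) * q := by simp only [hv]; push_cast; ring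
    have h1 : (1 : ℝ) ≤ |(k : ℝ) - l| := by
      have : (k : ℤ) - l ≠ 0 := fun h => hkl (by omega)
      exact_mod_cast Int.one_le_abs this
    rw [e, abs_inv, abs_mul, abs_of_pos hq0, ← one_div]
    apply one_div_le_one_div_of_le hq0
    nlinarith
  have hfac : ∀ s k l t, s < q → l ≤ r → k ≠ l → (a : ℝ) - m ≤ t → t ≤ a + 2 * m →
      |(v s k - v s l)⁻¹ * (t - v s l)| ≤ B := by
    intro s k l t hs hl hkl ht1 ht2
    have h1 : (v s l : ℝ) < a + m := by
      have := hvm s l hs hl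
      simp only [hv]; exact_mod_cast this
    have h2 : (a : ℝ) ≤ v s l := by
      simp only [hv]
      have : a ≤ a + l * q + s := by omega
      exact_mod_cast this
    have h3 : |t - v s l| ≤ 2 * m := abs_le.2 ⟨by linarith, by linarith⟩
    rw [abs_mul]
    calc _ ≤ 2 * (r + 1) / (m : ℝ) * (2 * m) :=
          mul_le_mul ((hinv s k l hkl).trans hqinv) h3 (abs_nonneg _) (by positivity)
      _ = B := by rw [hB]; field_simp; norm_num
  have hcard : ∀ k, k ≤ r → ((Finset.range (r + 1)).erase k).card = r := fun k hk => by
    rw [Finset.card_erase_of_mem (by simpa using Nat.lt_succ_of_le hk), Finset.card_range]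
    simp
  have hLbd : ∀ s k t, s < q → k ≤ r → (a : ℝ) - m ≤ t → t ≤ a + 2 * m →
      |(L s k).eval t| ≤ B ^ r := by
    intro s k t hs hk ht1 ht2
    rw [hLeval]
    refine (abs_prod_le_pow (B := B) _ _ fun l hl => ?_).trans (by rw [hcard k hk])
    have hl' := Finset.mem_erase.1 hl
    exact hfac s k l t hs (Nat.lt_succ_iff.1 (Finset.mem_range.1 hl'.2)) hl'.1.symm ht1 ht2
  have hLlip : ∀ s k t t', s < q → k ≤ r → (a : ℝ) - m ≤ t → t ≤ a + 2 * m →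
      (a : ℝ) - m ≤ t' → t' ≤ a + 2 * m →
      |(L s k).eval t - (L s k).eval t'| ≤ r * B ^ r * (2 * (r + 1) / m * |t - t'|) := by
    intro s k t t' hs hk ht1 ht2 ht1' ht2'
    rw [hLeval, hLeval]
    refine (abs_prod_sub_prod_le (B := B) (ε := 2 * (r + 1) / m * |t - t'|) _ _ _ hB1
      (by positivity) ?_ ?_ ?_).trans (by rw [hcard k hk])
    · intro l hl
      have hl' := Finset.mem_erase.1 hl
      exact hfac s k l t hs (Nat.lt_succ_iff.1 (Finset.mem_range.1 hl'.2)) hl'.1.symm ht1 ht2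
    · intro l hl
      have hl' := Finset.mem_erase.1 hl
      exact hfac s k l t' hs (Nat.lt_succ_iff.1 (Finset.mem_range.1 hl'.2)) hl'.1.symm ht1' ht2'
    · intro l hl
      have hl' := Finset.mem_erase.1 hl
      rw [← mul_sub, sub_sub_sub_cancel_right, abs_mul]
      gcongr
      exact (hinv s k l hl'.1.symm).trans hqinv
  -- averages of the Lagrange weights over the `q` families of nodes
  set w : ℝ → ℕ → ℝ := fun t j => ∑ k ∈ Finset.range (r + 1), ∑ s ∈ Finset.range q,
    if j = a + k * q + s then (L s k).eval t / q else 0 with hw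
  -- For given `k`, at most one translate `s` has `j` as its `k`-th node, so no more than `r + 1`
  -- terms survive.
  have hsingle : ∀ (j : ℕ) (F : ℕ → ℕ → ℝ) (b : ℝ), 0 ≤ b →
      (∀ s k, s < q → k ≤ r → |F s k| ≤ b) →
      |∑ k ∈ Finset.range (r + 1), ∑ s ∈ Finset.range q,
        if j = a + k * q + s then F s k else 0| ≤ (r + 1) * b := by
    intro j F b hb hF
    refine (Finset.abs_sum_le_sum_abs _ _).trans ?_
    calc _ ≤ ∑ _k ∈ Finset.range (r + 1), b := Finset.sum_le_sum fun k hk => ?_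
      _ = (r + 1) * b := by simp
    have hk' := Nat.lt_succ_iff.1 (Finset.mem_range.1 hk)
    by_cases hex : ∃ s₀ ∈ Finset.range q, j = a + k * q + s₀
    · obtain ⟨s₀, hs₀, rfl⟩ := hex
      rw [Finset.sum_eq_single s₀ (fun s _ hs => if_neg fun h => hs (by omega))
        (fun h => absurd hs₀ h), if_pos rfl]
      exact hF s₀ k (Finset.mem_range.1 hs₀) hk'
    · push Not at hex
      rw [Finset.sum_eq_zero fun s hs => if_neg (hex s hs), abs_zero]
      exact hb
  refine ⟨w, fun p hp t => ?_, fun t ht1 ht2 j => ?_, fun t t' ht1 ht2 ht1' ht2' j => ?_⟩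
  · have hrep : ∀ s, ∑ k ∈ Finset.range (r + 1), (L s k).eval t * p.eval (v s k) = p.eval t := by
      intro s
      have hdeg : p.degree < (Finset.range (r + 1)).card := by
        rw [Finset.card_range]
        refine lt_of_le_of_lt Polynomial.degree_le_natDegree ?_
        exact_mod_cast Nat.lt_succ_of_le hp
      conv_rhs => rw [Lagrange.eq_interpolate (s := Finset.range (r + 1)) (v := v s)
        (hvinj s).injOn hdeg]
      rw [Lagrange.interpolate_apply, Polynomial.eval_finsetSum]
      exact Finset.sum_congr rfl fun k _ => by
        rw [Polynomial.eval_mul, Polynomial.eval_C, mul_comm]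
    calc ∑ j ∈ Finset.Ico a (a + m), w t j * p.eval (j : ℝ)
        = ∑ k ∈ Finset.range (r + 1), ∑ s ∈ Finset.range q, ∑ j ∈ Finset.Ico a (a + m),
            if j = a + k * q + s then (L s k).eval t / q * p.eval (j : ℝ) else 0 := by
          simp only [hw, Finset.sum_mul, ite_mul, zero_mul]
          rw [Finset.sum_comm]
          exact Finset.sum_congr rfl fun k _ => Finset.sum_comm
      _ = ∑ k ∈ Finset.range (r + 1), ∑ s ∈ Finset.range q,
            (L s k).eval t / q * p.eval (v s k) := by
          refine Finset.sum_congr rfl fun k hk => Finset.sum_congr rfl fun s hs => ?_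
          rw [Finset.sum_ite_eq', if_pos]
          rw [Finset.mem_Ico]
          exact ⟨by omega, hvm s k (Finset.mem_range.1 hs)
            (Nat.lt_succ_iff.1 (Finset.mem_range.1 hk))⟩
      _ = ∑ s ∈ Finset.range q, (1 / q) * ∑ k ∈ Finset.range (r + 1),
            (L s k).eval t * p.eval (v s k) := by
          rw [Finset.sum_comm]
          refine Finset.sum_congr rfl fun s _ => ?_
          rw [Finset.mul_sum]
          exact Finset.sum_congr rfl fun k _ => by ring
      _ = p.eval t := by
          simp only [hrep, Finset.sum_const, Finset.card_range, nsmul_eq_mul]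
          field_simp
  · refine (hsingle j _ (B ^ r * (2 * (r + 1) / m)) (by positivity) fun s k hs hk => ?_).trans ?_
    · rw [abs_div, abs_of_pos hq0, div_eq_mul_one_div]
      exact mul_le_mul (hLbd s k t hs hk ht1 ht2) hqinv (by positivity) (by positivity)
    · have e : (r + 1) * (B ^ r * (2 * (r + 1) / m)) = 2 * (r + 1 : ℝ) ^ 2 * B ^ r / m := by ring
      rw [e]
      gcongr
      all_goals first | exact hr1 | norm_num
  · have e : w t j - w t' j = ∑ k ∈ Finset.range (r + 1), ∑ s ∈ Finset.range q,
        if j = a + k * q + s then ((L s k).eval t - (L s k).eval t') / q else 0 := by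
      simp only [hw, ← Finset.sum_sub_distrib]
      refine Finset.sum_congr rfl fun k _ => Finset.sum_congr rfl fun s _ => ?_
      split_ifs
      · ring
      · ring
    rw [e]
    refine (hsingle j _ (r * B ^ r * (2 * (r + 1) / m * |t - t'|) * (2 * (r + 1) / m))
      (by positivity) fun s k hs hk => ?_).trans ?_
    · rw [abs_div, abs_of_pos hq0, div_eq_mul_one_div]
      exact mul_le_mul (hLlip s k t t' hs hk ht1 ht2 ht1' ht2') hqinv (by positivity)
        (by positivity)
    · have e : (r + 1) * (r * B ^ r * (2 * (r + 1) / m * |t - t'|) * (2 * (r + 1) / m)) =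
          4 * ((r : ℝ) * (r + 1) ^ 3) * B ^ r / m * (|t - t'| / m) := by ring
      rw [e]
      gcongr
      have : (r + 1 : ℝ) ^ 4 = (r + 1) * (r + 1) ^ 3 := by ring
      rw [this]
      gcongr
      linarith

/-- The box of the pixels `j` with `a k ≤ j k < a k + m k` for all `k`. -/
def pixelBox {d n : ℕ} (a m : Fin d → ℕ) : Finset (Pixel d n) :=
  Fintype.piFinset fun k => Finset.univ.filter fun j : Fin n => a k ≤ j ∧ (j : ℕ) < a k + m k

theorem mem_pixelBox {d n : ℕ} {a m : Fin d → ℕ} {j : Pixel d n} :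
    j ∈ pixelBox a m ↔ ∀ k, a k ≤ j k ∧ (j k : ℕ) < a k + m k := by
  simp [pixelBox]

theorem sum_filter_interval {n a m : ℕ} (h : a + m ≤ n) (f : ℕ → ℝ) :
    ∑ j ∈ Finset.univ.filter (fun j : Fin n => a ≤ j ∧ (j : ℕ) < a + m), f j =
      ∑ j ∈ Finset.Ico a (a + m), f j := by
  refine Finset.sum_bij (fun j _ => (j : ℕ)) (fun j hj => by simpa using hj)
    (fun i _ j _ hij => Fin.ext hij) (fun j hj => ?_) fun _ _ => rfl
  have hj' := Finset.mem_Ico.1 hj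
  exact ⟨⟨j, by omega⟩, by simpa using hj', rfl⟩

theorem card_filter_interval {n a m : ℕ} (h : a + m ≤ n) :
    (Finset.univ.filter (fun j : Fin n => a ≤ j ∧ (j : ℕ) < a + m)).card = m := by
  have := sum_filter_interval h fun _ => (1 : ℝ)
  simp only [Finset.sum_const, Nat.card_Ico, add_tsub_cancel_left, nsmul_eq_mul, mul_one] at this
  exact_mod_cast this

theorem card_pixelBox {d n : ℕ} {a m : Fin d → ℕ} (h : ∀ k, a k + m k ≤ n) :
    ((pixelBox a m : Finset (Pixel d n)).card : ℝ) = ∏ k, (m k : ℝ) := by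
  rw [pixelBox, Fintype.card_piFinset]
  push_cast
  exact Finset.prod_congr rfl fun k _ => by rw [card_filter_interval (h k)]

/-- The coordinates of a pixel, as real numbers. -/
def pixelCoord {d n : ℕ} (j : Pixel d n) : Fin d → ℝ := fun k => ((j k : ℕ) : ℝ)

/-- A threefold enlargement of a box of pixels. -/
def IsNearBox {d : ℕ} (a m : Fin d → ℕ) (z : Fin d → ℝ) : Prop :=
  ∀ k, (a k : ℝ) - m k ≤ z k ∧ z k ≤ a k + 2 * m k

theorem isNearBox_of_mem {d n : ℕ} {a m : Fin d → ℕ} {j : Pixel d n} (hj : j ∈ pixelBox a m) :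
    IsNearBox a m (pixelCoord j) := fun k => by
  have h := mem_pixelBox.1 hj k
  have h1 : (a k : ℝ) ≤ (j k : ℕ) := by exact_mod_cast h.1
  have h2 : ((j k : ℕ) : ℝ) < a k + m k := by exact_mod_cast h.2
  have h3 : (0 : ℝ) ≤ m k := Nat.cast_nonneg _
  constructor <;> simp only [pixelCoord] <;> linarith

/-- Products of the one-dimensional weights: each exponent of a monomial of total degree at most `r`
is at most `r`, so the sum factorises. Multiplying each factor by its side length makes it bounded
by a constant, and the estimates reduce to products of bounded numbers. -/
theorem exists_box_weights (d r : ℕ) : ∃ C : ℝ, 1 ≤ C ∧ ∀ (n : ℕ) (a m : Fin d → ℕ),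
    (∀ k, r + 1 ≤ m k) → (∀ k, a k + m k ≤ n) →
    ∃ w : (Fin d → ℝ) → Pixel d n → ℝ,
      (∀ P : MvPolynomial (Fin d) ℝ, P.totalDegree ≤ r → ∀ z,
        ∑ j ∈ pixelBox a m, w z j * P.eval (pixelCoord j) = P.eval z) ∧
      (∀ z, IsNearBox a m z → ∀ j, |w z j| ≤ C / ∏ k, (m k : ℝ)) ∧
      (∀ z z' ε, 0 ≤ ε → IsNearBox a m z → IsNearBox a m z' → (∀ k, |z k - z' k| ≤ ε * m k) →
        ∀ j, |w z j - w z' j| ≤ C / (∏ k, (m k : ℝ)) * ε) := by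
  obtain ⟨C, hC1, hC⟩ := exists_lagrange_weights r
  refine ⟨(d + 1) * C ^ d * C, ?_, fun n a m hm hn => ?_⟩
  · have h1 : (1 : ℝ) ≤ C ^ d := one_le_pow₀ hC1
    have h2 : (1 : ℝ) ≤ d + 1 := by linarith [(Nat.cast_nonneg d : (0 : ℝ) ≤ d)]
    exact one_le_mul_of_one_le_of_one_le (one_le_mul_of_one_le_of_one_le h2 h1) hC1
  choose w hw1 hw2 hw3 using fun k => hC (a k) (m k) (hm k)
  have hm0 : ∀ k, (0 : ℝ) < m k := fun k => by exact_mod_cast (Nat.succ_pos r).trans_le (hm k)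
  have hN : 0 < ∏ k, (m k : ℝ) := Finset.prod_pos fun k _ => hm0 k
  have hC0 : 0 < C := one_pos.trans_le hC1
  have hCd : (0 : ℝ) ≤ C ^ d := by positivity
  have hscale : ∀ (z : Fin d → ℝ) (j : Pixel d n),
      ∏ k, w k (z k) (j k) = (∏ k, m k * w k (z k) (j k)) / ∏ k, (m k : ℝ) := fun z j => by
    rw [Finset.prod_mul_distrib, mul_div_cancel_left₀ _ hN.ne']
  have hbd : ∀ z, IsNearBox a m z → ∀ (j : Pixel d n), ∀ k ∈ Finset.univ,
      |m k * w k (z k) (j k)| ≤ C := fun z hz j k _ => by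
    rw [abs_mul, abs_of_pos (hm0 k)]
    calc _ ≤ (m k : ℝ) * (C / m k) :=
          mul_le_mul_of_nonneg_left (hw2 k _ (hz k).1 (hz k).2 _) (hm0 k).le
      _ = C := mul_div_cancel₀ _ (hm0 k).ne'
  refine ⟨fun z j => ∏ k, w k (z k) (j k), fun P hP z => ?_, fun z hz j => ?_,
    fun z z' ε hε hz hz' hzz j => ?_⟩
  · simp only [MvPolynomial.eval_eq', Finset.mul_sum]
    rw [Finset.sum_comm]
    refine Finset.sum_congr rfl fun s hs => ?_
    have hsr : ∀ k, s k ≤ r := fun k =>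
      ((MvPolynomial.degreeOf_le_totalDegree P k).trans hP |> fun h =>
        (MvPolynomial.degreeOf_le_iff.1 h s hs))
    have h1 : ∀ k, ∑ j ∈ Finset.univ.filter (fun j : Fin n => a k ≤ j ∧ (j : ℕ) < a k + m k),
        w k (z k) j * ((j : ℕ) : ℝ) ^ s k = z k ^ s k := fun k => by
      rw [sum_filter_interval (hn k) fun j => w k (z k) j * (j : ℝ) ^ s k]
      have := hw1 k (Polynomial.X ^ s k) (by simpa using hsr k) (z k)
      simpa using this
    calc ∑ j ∈ pixelBox a m, (∏ k, w k (z k) (j k)) *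
            (MvPolynomial.coeff s P * ∏ k, pixelCoord j k ^ s k)
        = MvPolynomial.coeff s P * ∑ j ∈ pixelBox a m,
            ∏ k, w k (z k) (j k) * ((j k : ℕ) : ℝ) ^ s k := by
          rw [Finset.mul_sum]
          refine Finset.sum_congr rfl fun j _ => ?_
          rw [Finset.prod_mul_distrib]
          simp only [pixelCoord]
          ring
      _ = MvPolynomial.coeff s P * ∏ k, z k ^ s k := by
          rw [pixelBox, ← Finset.prod_univ_sum _
            fun k (j : Fin n) => w k (z k) j * ((j : ℕ) : ℝ) ^ s k]
          simp only [h1]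
  · simp only [hscale]
    rw [abs_div, abs_of_pos hN]
    gcongr
    refine (abs_prod_le_pow (B := C) _ _ (hbd z hz j)).trans ?_
    rw [Finset.card_univ, Fintype.card_fin]
    have : C ^ d * 1 ≤ C ^ d * ((d + 1) * C) := by
      gcongr
      exact one_le_mul_of_one_le_of_one_le
        (by linarith [(Nat.cast_nonneg d : (0 : ℝ) ≤ d)]) hC1
    linarith
  · simp only [hscale]
    rw [← sub_div, abs_div, abs_of_pos hN, div_mul_eq_mul_div]
    gcongr
    refine (abs_prod_sub_prod_le (B := C) (ε := C * ε) _ _ _ hC1 (by positivity) (hbd z hz j)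
      (hbd z' hz' j) fun k _ => ?_).trans ?_
    · rw [← mul_sub, abs_mul, abs_of_pos (hm0 k)]
      calc _ ≤ (m k : ℝ) * (C / m k * (|z k - z' k| / m k)) :=
            mul_le_mul_of_nonneg_left
              (hw3 k _ _ (hz k).1 (hz k).2 (hz' k).1 (hz' k).2 _) (hm0 k).le
        _ = C * (|z k - z' k| / m k) := by have := (hm0 k).ne'; field_simp
        _ ≤ C * ε := by
            gcongr
            rw [div_le_iff₀ (hm0 k)]
            exact hzz k
    · rw [Finset.card_univ, Fintype.card_fin]
      have : 0 ≤ C ^ d * (C * ε) := by positivity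
      nlinarith

/-! ### Least squares and reproducing kernels -/

/-- `P` is the least squares fit of degree `r` to the data `y` on the pixels in `Q`. -/
structure IsFit {d n : ℕ} (r : ℕ) (Q : Finset (Pixel d n)) (y : Pixel d n → ℝ)
    (P : MvPolynomial (Fin d) ℝ) : Prop where
  deg : P.totalDegree ≤ r
  orth : ∀ R : MvPolynomial (Fin d) ℝ, R.totalDegree ≤ r →
    ∑ j ∈ Q, (y j - P.eval (pixelCoord j)) * R.eval (pixelCoord j) = 0

/-- `P` represents evaluation at the pixel `i` on polynomials of degree `r`, with respect to the
inner product of `ℓ²(Q)`. -/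
structure IsKernel {d n : ℕ} (r : ℕ) (Q : Finset (Pixel d n)) (i : Pixel d n)
    (P : MvPolynomial (Fin d) ℝ) : Prop where
  deg : P.totalDegree ≤ r
  repro : ∀ R : MvPolynomial (Fin d) ℝ, R.totalDegree ≤ r →
    ∑ j ∈ Q, P.eval (pixelCoord j) * R.eval (pixelCoord j) = R.eval (pixelCoord i)

theorem totalDegree_sub_le {d r : ℕ} {P R : MvPolynomial (Fin d) ℝ} (hP : P.totalDegree ≤ r)
    (hR : R.totalDegree ≤ r) : (P - R).totalDegree ≤ r :=
  (MvPolynomial.totalDegree_sub P R).trans (max_le hP hR)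

/-- The orthogonal projection of the data to the finite-dimensional space of restrictions to `Q`.
The polynomial need not be unique when `Q` is small. -/
theorem exists_isFit {d n : ℕ} (r : ℕ) (Q : Finset (Pixel d n)) (y : Pixel d n → ℝ) :
    ∃ P, IsFit r Q y P := by
  classical
  let T : MvPolynomial.restrictTotalDegree (Fin d) ℝ r →ₗ[ℝ] EuclideanSpace ℝ (Pixel d n) :=
    { toFun := fun P => WithLp.toLp 2 fun j => if j ∈ Q then P.1.eval (pixelCoord j) else 0
      map_add' := fun P R => by
        ext j
        by_cases hj : j ∈ Q <;> simp [hj]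
      map_smul' := fun c P => by
        ext j
        by_cases hj : j ∈ Q <;> simp [hj] }
  let y' : EuclideanSpace ℝ (Pixel d n) := WithLp.toLp 2 y
  obtain ⟨P, hP⟩ : (LinearMap.range T).starProjection y' ∈ LinearMap.range T :=
    Submodule.starProjection_apply_mem _ _
  refine ⟨P.1, (MvPolynomial.mem_restrictTotalDegree _ _ _).1 P.2, fun R hR => ?_⟩
  have h := Submodule.sub_starProjection_mem_orthogonal (K := LinearMap.range T) y'
  rw [← hP, Submodule.mem_orthogonal'] at h
  have h1 := h (T ⟨R, (MvPolynomial.mem_restrictTotalDegree _ _ _).2 hR⟩) ⟨_, rfl⟩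
  rw [PiLp.inner_apply] at h1
  rw [← h1, ← Finset.sum_filter_add_sum_filter_not Finset.univ (· ∈ Q)]
  rw [Finset.filter_univ_mem, Finset.sum_congr rfl fun j (hj : j ∈ Q) => ?_]
  · rw [left_eq_add]
    refine Finset.sum_eq_zero fun j hj => ?_
    simp [T, (Finset.mem_filter.1 hj).2]
  · simp [T, y', hj, mul_comm]

/-- The kernel is the fit to the indicator of `i`: orthogonality of its residual to `R` is the
reproducing identity, because `i ∈ Q`. -/
theorem exists_isKernel {d n : ℕ} (r : ℕ) {Q : Finset (Pixel d n)} {i : Pixel d n} (hi : i ∈ Q) :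
    ∃ P, IsKernel r Q i P := by
  classical
  obtain ⟨P, hP⟩ := exists_isFit r Q fun j => if j = i then 1 else 0
  refine ⟨P, hP.deg, fun R hR => ?_⟩
  have h := hP.orth R hR
  simp only [sub_mul, Finset.sum_sub_distrib, ite_mul, one_mul, zero_mul, Finset.sum_ite_eq', hi,
    if_true] at h
  linarith

/-- The residual of the fit is orthogonal to the kernel, and the kernel reproduces the fit. This
exhibits the fitted value as a linear functional of the data. -/
theorem IsKernel.sum_mul_eq {d n r : ℕ} {Q : Finset (Pixel d n)} {i : Pixel d n}
    {K P : MvPolynomial (Fin d) ℝ} {y : Pixel d n → ℝ} (hK : IsKernel r Q i K)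
    (hP : IsFit r Q y P) :
    ∑ j ∈ Q, K.eval (pixelCoord j) * y j = P.eval (pixelCoord i) := by
  rw [← hK.repro P hP.deg, ← sub_eq_zero, ← Finset.sum_sub_distrib, ← hP.orth K hK.deg]
  exact Finset.sum_congr rfl fun j _ => by ring

theorem IsKernel.sum_eq_one {d n r : ℕ} {Q : Finset (Pixel d n)} {i : Pixel d n}
    {K : MvPolynomial (Fin d) ℝ} (hK : IsKernel r Q i K) :
    ∑ j ∈ Q, K.eval (pixelCoord j) = 1 := by
  simpa using hK.repro 1 (by simp)

/-- The kernel reproduces itself, so the variance factor of the filter is a diagonal value of the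
kernel. -/
theorem IsKernel.sum_sq_eq {d n r : ℕ} {Q : Finset (Pixel d n)} {i : Pixel d n}
    {K : MvPolynomial (Fin d) ℝ} (hK : IsKernel r Q i K) :
    ∑ j ∈ Q, K.eval (pixelCoord j) ^ 2 = K.eval (pixelCoord i) := by
  rw [← hK.repro K hK.deg]
  exact Finset.sum_congr rfl fun j _ => sq _

/-- Cauchy-Schwarz for weights that sum to one: averaging over `Q` cannot reduce the variance by
more than its size. -/
theorem IsKernel.inv_card_le {d n r : ℕ} {Q : Finset (Pixel d n)} {i : Pixel d n}
    {K : MvPolynomial (Fin d) ℝ} (hK : IsKernel r Q i K) :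
    1 / (Q.card : ℝ) ≤ ∑ j ∈ Q, K.eval (pixelCoord j) ^ 2 := by
  have h := sq_sum_le_card_mul_sum_sq (s := Q) (f := fun j => K.eval (pixelCoord j))
  rw [hK.sum_eq_one, one_pow] at h
  have hQ : (0 : ℝ) < Q.card := by
    rcases Q.eq_empty_or_nonempty with rfl | hQ
    · simp at h
      linarith
    · exact_mod_cast hQ.card_pos
  rw [div_le_iff₀ hQ]
  linarith

/-- The kernel of a large box is of the order of the reciprocal of the number of pixels, also in a
neighbourhood of the box. -/
theorem exists_abs_kernel_le (d r : ℕ) : ∃ C : ℝ, 1 ≤ C ∧ ∀ (n : ℕ) (a m : Fin d → ℕ),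
    (∀ k, r + 1 ≤ m k) → (∀ k, a k + m k ≤ n) → ∀ (i : Pixel d n), i ∈ pixelBox a m →
    ∀ K, IsKernel r (pixelBox a m) i K → ∀ z, IsNearBox a m z →
      |K.eval z| ≤ C / ∏ k, (m k : ℝ) := by
  obtain ⟨C, hC1, hC⟩ := exists_box_weights d r
  refine ⟨C ^ 2, one_le_pow₀ hC1, fun n a m hm hn i hi K hK z hz => ?_⟩
  obtain ⟨w, hw1, hw2, -⟩ := hC n a m hm hn
  have hC0 : 0 < C := one_pos.trans_le hC1
  have hN : 0 < ∏ k, (m k : ℝ) := Finset.prod_pos fun k _ => by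
    exact_mod_cast (Nat.succ_pos r).trans_le (hm k)
  set N : ℝ := ∏ k, (m k : ℝ) with hNdef
  have hcard : ((pixelBox a m : Finset (Pixel d n)).card : ℝ) = N := card_pixelBox hn
  -- Expand `K.eval z` in the explicit weights and apply Cauchy-Schwarz; the sum of squares of `K`
  -- is its own value at `i`.
  have key : ∀ z, IsNearBox a m z → K.eval z ^ 2 ≤ C ^ 2 / N * K.eval (pixelCoord i) := by
    intro z hz
    rw [← hw1 K hK.deg z, ← hK.sum_sq_eq]
    have h1 := Finset.sum_mul_sq_le_sq_mul_sq (pixelBox a m : Finset (Pixel d n)) (w z)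
      fun j => K.eval (pixelCoord j)
    refine h1.trans ?_
    gcongr
    calc ∑ j ∈ pixelBox a m, w z j ^ 2 ≤ ∑ _j ∈ (pixelBox a m : Finset (Pixel d n)), (C / N) ^ 2 :=
          Finset.sum_le_sum fun j _ => by
            rw [← sq_abs]
            exact pow_le_pow_left₀ (abs_nonneg _) (hw2 z hz j) 2
      _ = C ^ 2 / N := by
          rw [Finset.sum_const, nsmul_eq_mul, hcard]
          field_simp
  have hpos : 0 ≤ K.eval (pixelCoord i) := by
    rw [← hK.sum_sq_eq]
    exact Finset.sum_nonneg fun j _ => sq_nonneg _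
  have hi1 := key _ (isNearBox_of_mem hi)
  -- At `z = pixelCoord i` the previous inequality bounds a square by a multiple of its root, hence
  -- bounds the root.
  have hi2 : K.eval (pixelCoord i) ≤ C ^ 2 / N := by
    by_contra hcon
    push Not at hcon
    have : 0 < C ^ 2 / N := by positivity
    nlinarith
  have h2 := key z hz
  refine abs_le_of_sq_le_sq ?_ (by positivity)
  calc K.eval z ^ 2 ≤ C ^ 2 / N * (C ^ 2 / N) := h2.trans (by gcongr)
    _ = (C ^ 2 / N) ^ 2 := by ring

theorem IsKernel.abs_sum_mul_le {d n : ℕ} {a m : Fin d → ℕ} {C B : ℝ}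
    {r : ℕ} (hm : ∀ k, r + 1 ≤ m k) (hn : ∀ k, a k + m k ≤ n)
    {K : MvPolynomial (Fin d) ℝ}
    (hK : ∀ z, IsNearBox a m z → |K.eval z| ≤ C / ∏ k, (m k : ℝ))
    {y : Pixel d n → ℝ} (hy : ∀ j ∈ pixelBox a m, |y j| ≤ B) :
    |∑ j ∈ pixelBox a m, K.eval (pixelCoord j) * y j| ≤ C * B := by
  have hN : 0 < ∏ k, (m k : ℝ) := Finset.prod_pos fun k _ => by
    exact_mod_cast (Nat.succ_pos r).trans_le (hm k)
  refine (Finset.abs_sum_le_sum_abs _ _).trans ?_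
  calc _ ≤ ∑ j ∈ (pixelBox a m : Finset (Pixel d n)), C / (∏ k, (m k : ℝ)) * B :=
        Finset.sum_le_sum fun j hj => by
          rw [abs_mul]
          exact mul_le_mul (hK _ (isNearBox_of_mem hj)) (hy j hj) (abs_nonneg _)
            ((abs_nonneg _).trans (hK _ (isNearBox_of_mem hj)))
    _ = C * B := by
        rw [Finset.sum_const, nsmul_eq_mul, card_pixelBox hn]
        field_simp

/-- Least squares estimates with bounded data depend on the box in a stable manner. -/
theorem exists_abs_sub_le_of_subset (d r : ℕ) : ∃ C : ℝ, 1 ≤ C ∧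
    ∀ (n : ℕ) (a m a' m' : Fin d → ℕ),
    (∀ k, r + 1 ≤ m k) → (∀ k, a k + m k ≤ n) → (∀ k, r + 1 ≤ m' k) → (∀ k, a' k + m' k ≤ n) →
    (pixelBox a m : Finset (Pixel d n)) ⊆ pixelBox a' m' →
    (∀ j ∈ (pixelBox a' m' : Finset (Pixel d n)), IsNearBox a m (pixelCoord j)) →
    ∀ ε, ∏ k, (m' k : ℝ) ≤ (1 + ε) * ∏ k, (m k : ℝ) →
    ∀ (i : Pixel d n), i ∈ pixelBox a m → ∀ K K', IsKernel r (pixelBox a m) i K →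
    IsKernel r (pixelBox a' m') i K' → ∀ y : Pixel d n → ℝ, (∀ j, |y j| ≤ 1) →
      |∑ j ∈ pixelBox a m, K.eval (pixelCoord j) * y j -
        ∑ j ∈ pixelBox a' m', K'.eval (pixelCoord j) * y j| ≤ C * ε := by
  classical
  obtain ⟨C, hC1, hC⟩ := exists_abs_kernel_le d r
  refine ⟨C * (1 + C), by nlinarith, fun n a m a' m' hm hn hm' hn' hsub hnear ε hε i hi K K' hK hK'
    y hy => ?_⟩
  have hN : 0 < ∏ k, (m k : ℝ) := Finset.prod_pos fun k _ => by
    exact_mod_cast (Nat.succ_pos r).trans_le (hm k)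
  obtain ⟨P, hP⟩ := exists_isFit r (pixelBox a m) y
  obtain ⟨P', hP'⟩ := exists_isFit r (pixelBox a' m') y
  have hKb := hC n a m hm hn i hi K hK
  have hP'b : ∀ j ∈ (pixelBox a' m' : Finset (Pixel d n)), |P'.eval (pixelCoord j)| ≤ C := by
    intro j hj
    obtain ⟨L, hL⟩ := exists_isKernel r hj
    rw [← hL.sum_mul_eq hP']
    have := IsKernel.abs_sum_mul_le hm' hn' (hC n a' m' hm' hn' j hj L hL)
      fun j _ => hy j
    rwa [mul_one] at this
  -- On the small box, `K` reproduces `P'`, so the difference is the pairing of `K` with the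
  -- residual `y - P'`. Over the large box this pairing is zero, which leaves only the pixels
  -- between the boxes.
  have e : ∑ j ∈ pixelBox a m, K.eval (pixelCoord j) * y j -
      ∑ j ∈ pixelBox a' m', K'.eval (pixelCoord j) * y j =
      -∑ j ∈ pixelBox a' m' \ pixelBox a m,
        (y j - P'.eval (pixelCoord j)) * K.eval (pixelCoord j) := by
    rw [hK'.sum_mul_eq hP', ← hK.repro P' hP'.deg, ← Finset.sum_sub_distrib]
    have h1 := hP'.orth K hK.deg
    rw [← Finset.sum_sdiff hsub] at h1
    rw [← eq_neg_of_add_eq_zero_right h1]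
    exact Finset.sum_congr rfl fun j _ => by ring
  rw [e, abs_neg]
  refine (Finset.abs_sum_le_sum_abs _ _).trans ?_
  calc _ ≤ ∑ _j ∈ (pixelBox a' m' \ pixelBox a m : Finset (Pixel d n)),
        (1 + C) * (C / ∏ k, (m k : ℝ)) := Finset.sum_le_sum fun j hj => by
        have hj' := (Finset.mem_sdiff.1 hj).1
        rw [abs_mul]
        refine mul_le_mul ?_ (hKb _ (hnear j hj')) (abs_nonneg _) (by linarith)
        exact (abs_sub _ _).trans (add_le_add (hy j) (hP'b j hj'))
    _ = (∏ k, (m' k : ℝ) - ∏ k, (m k : ℝ)) * ((1 + C) * (C / ∏ k, (m k : ℝ))) := by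
        rw [Finset.sum_const, nsmul_eq_mul, Finset.cast_card_sdiff hsub, card_pixelBox hn,
          card_pixelBox hn']
    _ ≤ (ε * ∏ k, (m k : ℝ)) * ((1 + C) * (C / ∏ k, (m k : ℝ))) := by
        gcongr
        linarith
    _ = C * (1 + C) * ε := by field_simp

/-- Least squares fits to bounded data are slowly varying. -/
theorem exists_abs_fit_sub_le (d r : ℕ) : ∃ C : ℝ, 1 ≤ C ∧
    ∀ (n : ℕ) (a m : Fin d → ℕ), (∀ k, r + 1 ≤ m k) → (∀ k, a k + m k ≤ n) →
    ∀ (i i' : Pixel d n), i ∈ pixelBox a m → i' ∈ pixelBox a m →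
    ∀ ε, 0 ≤ ε → (∀ k, |pixelCoord i k - pixelCoord i' k| ≤ ε * m k) →
    ∀ K K', IsKernel r (pixelBox a m) i K → IsKernel r (pixelBox a m) i' K' →
    ∀ y : Pixel d n → ℝ, (∀ j, |y j| ≤ 1) →
      |∑ j ∈ pixelBox a m, K.eval (pixelCoord j) * y j -
        ∑ j ∈ pixelBox a m, K'.eval (pixelCoord j) * y j| ≤ C * ε := by
  obtain ⟨C, hC1, hC⟩ := exists_abs_kernel_le d r
  obtain ⟨D, hD1, hD⟩ := exists_box_weights d r
  refine ⟨D * C, by nlinarith, fun n a m hm hn i i' hi hi' ε hε hii K K' hK hK' y hy => ?_⟩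
  have hN : 0 < ∏ k, (m k : ℝ) := Finset.prod_pos fun k _ => by
    exact_mod_cast (Nat.succ_pos r).trans_le (hm k)
  obtain ⟨w, hw1, hw2, hw3⟩ := hD n a m hm hn
  obtain ⟨P, hP⟩ := exists_isFit r (pixelBox a m) y
  have hPb : ∀ j ∈ (pixelBox a m : Finset (Pixel d n)), |P.eval (pixelCoord j)| ≤ C := by
    intro j hj
    obtain ⟨L, hL⟩ := exists_isKernel r hj
    rw [← hL.sum_mul_eq hP]
    have := IsKernel.abs_sum_mul_le hm hn (hC n a m hm hn j hj L hL)
      fun j _ => hy j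
    rwa [mul_one] at this
  -- Both values belong to the same bounded fit `P`, so the explicit weights and their Lipschitz
  -- dependence on the point apply.
  rw [hK.sum_mul_eq hP, hK'.sum_mul_eq hP, ← hw1 P hP.deg, ← hw1 P hP.deg (pixelCoord i'),
    ← Finset.sum_sub_distrib]
  refine (Finset.abs_sum_le_sum_abs _ _).trans ?_
  calc _ ≤ ∑ _j ∈ (pixelBox a m : Finset (Pixel d n)), D / (∏ k, (m k : ℝ)) * ε * C :=
        Finset.sum_le_sum fun j hj => by
          rw [← sub_mul, abs_mul]
          exact mul_le_mul (hw3 _ _ ε hε (isNearBox_of_mem hi) (isNearBox_of_mem hi') hii j)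
            (hPb j hj) (abs_nonneg _) (by positivity)
    _ = D * C * ε := by
        rw [Finset.sum_const, nsmul_eq_mul, card_pixelBox hn]
        field_simp

/-! ### The linear filters as least squares estimates -/

/-- Affine substitution does not raise the degree; this permits passing between coordinates centred
at `x_i` and integer pixel coordinates. -/
theorem totalDegree_aeval_affine_le {d r : ℕ} (P : MvPolynomial (Fin d) ℝ) (hP : P.totalDegree ≤ r)
    (c : ℝ) (b : Fin d → ℝ) :
    (MvPolynomial.aeval (fun k => MvPolynomial.C c * MvPolynomial.X k + MvPolynomial.C (b k) :
      Fin d → MvPolynomial (Fin d) ℝ) P).totalDegree ≤ r := by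
  rw [MvPolynomial.aeval_def, MvPolynomial.eval₂_eq']
  refine (MvPolynomial.totalDegree_finsetSum_le fun s hs => ?_)
  refine (MvPolynomial.totalDegree_mul _ _).trans ?_
  rw [MvPolynomial.algebraMap_eq, MvPolynomial.totalDegree_C, zero_add]
  refine (MvPolynomial.totalDegree_finsetProd _ _).trans ?_
  refine le_trans (Finset.sum_le_sum fun k _ => ?_)
    (le_trans (le_of_eq (Finsupp.sum_fintype s (fun _ e => e) fun _ => rfl).symm)
      ((MvPolynomial.le_totalDegree hs).trans hP))
  refine (MvPolynomial.totalDegree_pow _ _).trans ?_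
  refine (Nat.mul_le_mul_left (s k) ?_).trans (mul_one _).le
  refine (MvPolynomial.totalDegree_add _ _).trans (max_le ?_ ?_)
  · refine (MvPolynomial.totalDegree_mul _ _).trans ?_
    rw [MvPolynomial.totalDegree_C, MvPolynomial.totalDegree_X, zero_add]
  · rw [MvPolynomial.totalDegree_C]
    exact zero_le_one

theorem eval_aeval_affine {d : ℕ} (P : MvPolynomial (Fin d) ℝ) (c : ℝ) (b z : Fin d → ℝ) :
    (MvPolynomial.aeval (fun k => MvPolynomial.C c * MvPolynomial.X k + MvPolynomial.C (b k) :
      Fin d → MvPolynomial (Fin d) ℝ) P).eval z = P.eval (c • z + b) := by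
  rw [MvPolynomial.aeval_def, MvPolynomial.eval₂_eq', MvPolynomial.eval_eq' _ P, map_sum]
  refine Finset.sum_congr rfl fun s _ => ?_
  simp [map_prod]

/-- The local polynomial with coefficients `a`, as a function of the pixel. -/
def localPoly {d n : ℕ} (r : ℕ) (i : Pixel d n) (a : multiIndices d r → ℝ) (j : Pixel d n) : ℝ :=
  ∑ s : multiIndices d r, a s * ∏ k, (gridPoint j k - gridPoint i k) ^ (s.1 k)

theorem gridPoint_sub_gridPoint {d n : ℕ} (i j : Pixel d n) :
    gridPoint j - gridPoint i = (n : ℝ)⁻¹ • (pixelCoord j - pixelCoord i) := by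
  ext k
  simp only [gridPoint, pixelCoord, Pi.sub_apply, Pi.smul_apply, smul_eq_mul]
  ring

theorem exists_eval_eq_localPoly {d n r : ℕ} (i : Pixel d n) (a : multiIndices d r → ℝ) :
    ∃ P : MvPolynomial (Fin d) ℝ, P.totalDegree ≤ r ∧
      ∀ j : Pixel d n, P.eval (pixelCoord j) = localPoly r i a j := by
  set P₀ : MvPolynomial (Fin d) ℝ :=
    ∑ s : multiIndices d r, MvPolynomial.C (a s) * ∏ k, MvPolynomial.X k ^ (s.1 k) with hP₀
  have hdeg : P₀.totalDegree ≤ r := by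
    refine MvPolynomial.totalDegree_finsetSum_le fun s _ => ?_
    refine (MvPolynomial.totalDegree_mul _ _).trans ?_
    rw [MvPolynomial.totalDegree_C, zero_add]
    refine (MvPolynomial.totalDegree_finsetProd _ _).trans ?_
    refine le_trans (Finset.sum_le_sum fun k _ => ?_) (mem_multiIndices.1 s.2)
    rw [MvPolynomial.totalDegree_X_pow]
  refine ⟨_, totalDegree_aeval_affine_le P₀ hdeg (n : ℝ)⁻¹ (-((n : ℝ)⁻¹ • pixelCoord i)),
    fun j => ?_⟩
  rw [eval_aeval_affine]
  have e : (n : ℝ)⁻¹ • pixelCoord j + -((n : ℝ)⁻¹ • pixelCoord i) = gridPoint j - gridPoint i := by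
    rw [gridPoint_sub_gridPoint, smul_sub, sub_eq_add_neg]
  rw [e, hP₀, map_sum]
  exact Finset.sum_congr rfl fun s _ => by simp [map_prod]

theorem exists_localPoly_eq_eval {d n r : ℕ} (i : Pixel d n) (P : MvPolynomial (Fin d) ℝ)
    (hP : P.totalDegree ≤ r) :
    ∃ a : multiIndices d r → ℝ, ∀ j : Pixel d n, localPoly r i a j = P.eval (pixelCoord j) := by
  set P₀ := MvPolynomial.aeval (fun k => MvPolynomial.C (n : ℝ) * MvPolynomial.X k +
    MvPolynomial.C (pixelCoord i k) : Fin d → MvPolynomial (Fin d) ℝ) P with hP₀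
  have hdeg : P₀.totalDegree ≤ r := totalDegree_aeval_affine_le P hP _ _
  refine ⟨fun s => P₀.coeff (Finsupp.equivFunOnFinite.symm s.1), fun j => ?_⟩
  have hev : P₀.eval (gridPoint j - gridPoint i) = P.eval (pixelCoord j) := by
    -- Undoing the scaling needs `n ≠ 0`, which follows from a coordinate of `i` if there is one;
    -- for `d = 0` all points agree.
    rcases Nat.eq_zero_or_pos d with hd | hd
    · subst hd
      rw [hP₀, eval_aeval_affine]
      congr 2
      exact Subsingleton.elim _ _
    have hn : (n : ℝ) ≠ 0 := by
      have := (i ⟨0, hd⟩).pos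
      exact_mod_cast this.ne'
    rw [hP₀, eval_aeval_affine, gridPoint_sub_gridPoint, smul_smul, mul_inv_cancel₀ hn, one_smul,
      sub_add_cancel]
  rw [← hev, MvPolynomial.eval_eq', localPoly]
  have e1 := Finset.sum_coe_sort (multiIndices d r) fun s =>
    P₀.coeff (Finsupp.equivFunOnFinite.symm s) * ∏ k, (gridPoint j k - gridPoint i k) ^ (s k)
  rw [e1]
  symm
  refine Finset.sum_bij_ne_zero (fun s _ _ => ⇑s) (fun s hs _ => ?_)
    (fun s _ _ t _ _ hst => DFunLike.coe_injective hst) (fun s hs hne => ?_) (fun s hs _ => ?_)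
  · rw [mem_multiIndices]
    refine le_trans (le_of_eq (Finsupp.sum_fintype s (fun _ e => e) fun _ => rfl).symm)
      ((MvPolynomial.le_totalDegree hs).trans hdeg)
  · have hc := left_ne_zero_of_mul hne
    exact ⟨Finsupp.equivFunOnFinite.symm s, MvPolynomial.mem_support_iff.2 hc, hne, rfl⟩
  · have : Finsupp.equivFunOnFinite.symm ⇑s = s := Finsupp.equivFunOnFinite.symm_apply_apply s
    simp [this]

theorem localPoly_self {d n r : ℕ} (i : Pixel d n) (a : multiIndices d r → ℝ) :
    localPoly r i a i = a (zeroIndex d r) := by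
  rw [localPoly, Finset.sum_eq_single (zeroIndex d r)]
  · simp [zeroIndex]
  · intro s _ hs
    obtain ⟨k, hk⟩ : ∃ k, s.1 k ≠ 0 := by
      by_contra hcon
      push Not at hcon
      exact hs (Subtype.ext (funext hcon))
    rw [Finset.prod_eq_zero (Finset.mem_univ k) (by rw [sub_self, zero_pow hk]), mul_zero]
  · simp

open Classical in
/-- The window of radius `h` around the pixel `i`. -/
def window {d n : ℕ} (h : ℝ) (i : Pixel d n) : Finset (Pixel d n) :=
  Finset.univ.filter fun j => ‖gridPoint i - gridPoint j‖ ≤ h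

theorem mem_window {d n : ℕ} {h : ℝ} {i j : Pixel d n} :
    j ∈ window h i ↔ ‖gridPoint i - gridPoint j‖ ≤ h := by
  simp [window]

theorem self_mem_window {d n : ℕ} {h : ℝ} (hh : 0 ≤ h) (i : Pixel d n) : i ∈ window h i := by
  rw [mem_window, sub_self, norm_zero]
  exact hh

theorem sum_boxWeight_mul {d n : ℕ} (h : ℝ) (i : Pixel d n) (F : Pixel d n → ℝ) :
    ∑ j, boxWeight h i j * F j = ∑ j ∈ window h i, F j := by
  simp only [boxWeight, window, Finset.sum_filter, ite_mul, one_mul, zero_mul]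

/-- By Pythagoras, the criterion at any coefficient vector exceeds its minimum by the squared
distance of the fitted values on the window. All minimisers therefore agree at `i`, a pixel of its
own window, even if the other coefficients are undetermined; the default value is never used for `h
≥ 0`. -/
theorem IsKernel.localPolynomial_eq {d n r : ℕ} {h : ℝ} (hh : 0 ≤ h) {i : Pixel d n}
    {K : MvPolynomial (Fin d) ℝ} (hK : IsKernel r (window h i) i K) (y : Pixel d n → ℝ) :
    localPolynomial r h y i = ∑ j ∈ window h i, K.eval (pixelCoord j) * y j := by
  obtain ⟨P, hP⟩ := exists_isFit r (window h i) y
  obtain ⟨a, ha⟩ := exists_localPoly_eq_eval i P hP.deg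
  have hcrit : ∀ b, lprCriterion r h y i b =
      ∑ j ∈ window h i, (y j - localPoly r i b j) ^ 2 := fun b => sum_boxWeight_mul h i _
  have hpyth : ∀ b, lprCriterion r h y i b = lprCriterion r h y i a +
      ∑ j ∈ window h i, (localPoly r i a j - localPoly r i b j) ^ 2 := by
    intro b
    obtain ⟨R, hR, hRb⟩ := exists_eval_eq_localPoly i b
    have h0 := hP.orth (P - R) (totalDegree_sub_le hP.deg hR)
    simp only [map_sub, ← ha, hRb] at h0
    rw [hcrit, hcrit, ← Finset.sum_add_distrib, ← sub_eq_zero, ← Finset.sum_sub_distrib,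
      ← mul_zero (2 : ℝ), ← h0, Finset.mul_sum]
    exact Finset.sum_congr rfl fun j _ => by ring
  have hval : ∀ v, IsLprValue r h y i v ↔ v = P.eval (pixelCoord i) := by
    intro v
    constructor
    · rintro ⟨b, hb, rfl⟩
      have h1 := hb a
      rw [hpyth b] at h1
      have h2 : ∑ j ∈ window h i, (localPoly r i a j - localPoly r i b j) ^ 2 ≤ 0 := by linarith
      have h3 := (Finset.sum_eq_zero_iff_of_nonneg fun j _ => sq_nonneg _).1
        (le_antisymm h2 (Finset.sum_nonneg fun j _ => sq_nonneg _)) i (self_mem_window hh i)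
      rw [← ha, ← localPoly_self i b]
      exact (sub_eq_zero.1 (pow_eq_zero_iff two_ne_zero |>.1 h3)).symm
    · rintro rfl
      refine ⟨a, fun b => ?_, by rw [← ha, localPoly_self]⟩
      rw [hpyth b]
      exact le_add_of_nonneg_right (Finset.sum_nonneg fun j _ => sq_nonneg _)
  have hex : ∃! v, IsLprValue r h y i v := ⟨_, (hval _).2 rfl, fun v hv => (hval v).1 hv⟩
  rw [localPolynomial, dif_pos hex, hK.sum_mul_eq hP]
  exact (hval _).1 hex.choose_spec.1

/-- The degree of the least squares problem that defines a linear filter. -/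
def Method.degree : Method → ℕ
  | .average => 0
  | .polynomial r => r

/-- The local average is the case of degree zero: a constant kernel with total mass one is the
reciprocal of the window size. -/
theorem IsKernel.linearFilter_eq {d n : ℕ} {method : Method} {h : ℝ} (hh : 0 ≤ h) {i : Pixel d n}
    {K : MvPolynomial (Fin d) ℝ} (hK : IsKernel method.degree (window h i) i K)
    (y : Pixel d n → ℝ) :
    linearFilter method h y i = ∑ j ∈ window h i, K.eval (pixelCoord j) * y j := by
  cases method with
  | polynomial r => exact hK.localPolynomial_eq hh y
  | average =>
    obtain ⟨c, hc⟩ : ∃ c, K = MvPolynomial.C c :=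
      ⟨_, MvPolynomial.totalDegree_eq_zero_iff_eq_C.1 (Nat.le_zero.1 hK.deg)⟩
    have h1 := hK.sum_eq_one
    have hcard : (0 : ℝ) < (window h i).card := by
      exact_mod_cast Finset.card_pos.2 ⟨i, self_mem_window hh i⟩
    simp only [hc, MvPolynomial.eval_C, Finset.sum_const, nsmul_eq_mul] at h1 ⊢
    have h2 := sum_boxWeight_mul h i fun _ => (1 : ℝ)
    simp only [mul_one, Finset.sum_const, nsmul_eq_mul] at h2
    change (∑ j, boxWeight h i j * y j) / ∑ j, boxWeight h i j = _
    rw [sum_boxWeight_mul, h2, ← Finset.mul_sum, div_eq_iff hcard.ne', mul_right_comm, mul_comm c,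
      h1, one_mul]

/-! ### Windows are boxes of pixels -/

/-- The smallest coordinates of the pixels in a window. -/
def windowLo {d n : ℕ} (h : ℝ) (i : Pixel d n) (k : Fin d) : ℕ := i k - ⌊n * h⌋₊

/-- The side lengths of a window. -/
def windowLen {d n : ℕ} (h : ℝ) (i : Pixel d n) (k : Fin d) : ℕ :=
  min n (i k + ⌊n * h⌋₊ + 1) - windowLo h i k

/-- For the sup norm the window is a product of intervals; truncated subtraction and the minimum
with `n` cut it off at the border. -/
theorem window_eq_pixelBox {d n : ℕ} {h : ℝ} (hh : 0 ≤ h) (i : Pixel d n) :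
    window h i = pixelBox (windowLo h i) (windowLen h i) := by
  ext j
  rw [mem_window, mem_pixelBox, pi_norm_le_iff_of_nonneg hh]
  refine forall_congr' fun k => ?_
  have hn : (0 : ℝ) < n := by exact_mod_cast (i k).pos
  have e : (gridPoint i - gridPoint j) k = (((i k : ℕ) : ℝ) - ((j k : ℕ) : ℝ)) / n := by
    simp only [gridPoint, Pi.sub_apply]; ring
  rw [e, Real.norm_eq_abs, abs_div, abs_of_pos hn, div_le_iff₀ hn, mul_comm h]
  have h1 : |((i k : ℕ) : ℝ) - ((j k : ℕ) : ℝ)| ≤ n * h ↔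
      (i k : ℕ) - (j k : ℕ) ≤ ⌊n * h⌋₊ ∧ (j k : ℕ) - (i k : ℕ) ≤ ⌊n * h⌋₊ := by
    rw [Nat.le_floor_iff (by positivity), Nat.le_floor_iff (by positivity)]
    rcases le_total (i k : ℕ) (j k : ℕ) with hij | hij
    · have hij' : ((i k : ℕ) : ℝ) ≤ (j k : ℕ) := by exact_mod_cast hij
      rw [Nat.sub_eq_zero_of_le hij, Nat.cast_sub hij, abs_of_nonpos (by linarith)]
      constructor
      · intro h2; exact ⟨by push_cast; positivity, by linarith⟩
      · intro h2; linarith [h2.2]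
    · have hij' : ((j k : ℕ) : ℝ) ≤ (i k : ℕ) := by exact_mod_cast hij
      rw [Nat.sub_eq_zero_of_le hij, Nat.cast_sub hij, abs_of_nonneg (by linarith)]
      constructor
      · intro h2; exact ⟨by linarith, by push_cast; positivity⟩
      · intro h2; linarith [h2.1]
  rw [h1, windowLen, windowLo]
  have := (i k).2
  have := (j k).2
  omega

theorem windowLo_add_windowLen_le {d n : ℕ} (h : ℝ) (i : Pixel d n) (k : Fin d) :
    windowLo h i k + windowLen h i k ≤ n := by
  have := (i k).2
  rw [windowLen, windowLo]
  omega

theorem mul_min_le_min_floor {n : ℕ} {h : ℝ} :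
    (n : ℝ) * min h 1 ≤ (min n (⌊n * h⌋₊ + 1) : ℕ) := by
  have hn : (0 : ℝ) ≤ n := Nat.cast_nonneg n
  rw [Nat.cast_min, le_min_iff]
  constructor
  · exact mul_le_of_le_one_right hn (min_le_right _ _)
  · push_cast
    exact (mul_le_mul_of_nonneg_left (min_le_left _ _) hn).trans (Nat.lt_floor_add_one _).le

/-- Even at a corner, a window keeps one full half, or the entire side of the image when `h` is
large. This is why `min h 1` replaces `h` in the estimates. -/
theorem mul_min_le_windowLen {d n : ℕ} (h : ℝ) (i : Pixel d n) (k : Fin d) :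
    (n : ℝ) * min h 1 ≤ windowLen h i k := by
  refine mul_min_le_min_floor.trans ?_
  have := (i k).2
  have h1 : min n (⌊n * h⌋₊ + 1) ≤ windowLen h i k := by
    rw [windowLen, windowLo]
    omega
  exact_mod_cast h1

theorem windowLen_le {d n : ℕ} {h : ℝ} (hh : 0 ≤ h) (i : Pixel d n) (k : Fin d) :
    (windowLen h i k : ℝ) ≤ 2 * (n * h) + 1 := by
  have h1 : windowLen h i k ≤ 2 * ⌊n * h⌋₊ + 1 := by
    rw [windowLen, windowLo]
    omega
  have h2 : (⌊n * h⌋₊ : ℝ) ≤ n * h := Nat.floor_le (by positivity)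
  calc (windowLen h i k : ℝ) ≤ 2 * ⌊n * h⌋₊ + 1 := by exact_mod_cast h1
    _ ≤ _ := by linarith

theorem card_window_le {d n : ℕ} {h : ℝ} (hh : 0 ≤ h) (i : Pixel d n) :
    ((window h i).card : ℝ) ≤ (2 * (n * h) + 1) ^ d := by
  rw [window_eq_pixelBox hh, card_pixelBox (windowLo_add_windowLen_le h i)]
  refine (Finset.prod_le_prod (fun _ _ => Nat.cast_nonneg _)
    fun k _ => windowLen_le hh i k).trans ?_
  rw [Finset.prod_const, Finset.card_univ, Fintype.card_fin]

theorem pow_le_prod_windowLen {d n : ℕ} {h : ℝ} (hh : 0 ≤ h) (i : Pixel d n) :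
    ((n : ℝ) * min h 1) ^ d ≤ ∏ k, (windowLen h i k : ℝ) := by
  have : ((n : ℝ) * min h 1) ^ d = ∏ _k : Fin d, ((n : ℝ) * min h 1) := by
    rw [Finset.prod_const, Finset.card_univ, Fintype.card_fin]
  rw [this]
  exact Finset.prod_le_prod (fun _ _ => mul_nonneg (Nat.cast_nonneg _) (le_min hh zero_le_one))
    fun k _ => mul_min_le_windowLen h i k

/-- The weights of a linear filter whose window is not too small. -/
theorem exists_abs_window_kernel_le (d r : ℕ) : ∃ C : ℝ, 1 ≤ C ∧ ∀ (n : ℕ) (h : ℝ), 0 < h →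
    ((r + 1 : ℕ) : ℝ) ≤ n * min h 1 → ∀ (i : Pixel d n) K, IsKernel r (window h i) i K →
    (∀ j ∈ window h i, |K.eval (pixelCoord j)| ≤ C / (n * min h 1) ^ d) ∧
    (∀ y : Pixel d n → ℝ, ∀ B, (∀ j ∈ window h i, |y j| ≤ B) →
      |∑ j ∈ window h i, K.eval (pixelCoord j) * y j| ≤ C * B) := by
  obtain ⟨C, hC1, hC⟩ := exists_abs_kernel_le d r
  refine ⟨C, hC1, fun n h hh hr i K hK => ?_⟩
  have hpos : 0 < (n : ℝ) * min h 1 := lt_of_lt_of_le (by positivity) hr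
  have hm : ∀ k, r + 1 ≤ windowLen h i k := fun k => by
    exact_mod_cast hr.trans (mul_min_le_windowLen h i k)
  have hi := self_mem_window hh.le i
  rw [window_eq_pixelBox hh.le] at hK hi ⊢
  have hKb := hC n _ _ hm (windowLo_add_windowLen_le h i) i hi K hK
  constructor
  · intro j hj
    refine (hKb _ (isNearBox_of_mem hj)).trans ?_
    exact div_le_div_of_nonneg_left (by linarith) (by positivity) (pow_le_prod_windowLen hh.le i)
  · intro y B hy
    exact IsKernel.abs_sum_mul_le hm (windowLo_add_windowLen_le h i) hKb hy

/-- The output of a linear filter is slowly varying. -/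
theorem exists_abs_filter_sub_le (d r : ℕ) : ∃ C : ℝ, 1 ≤ C ∧ ∀ (n : ℕ) (h : ℝ) (s : ℕ), 0 < h →
    ((r + 1 : ℕ) : ℝ) ≤ n * min h 1 → (s : ℝ) ≤ n * min h 1 → ∀ (i i' : Pixel d n) (k₀ : Fin d),
    (∀ k, k ≠ k₀ → i' k = i k) → ((i' k₀ : ℕ) = i k₀ + s) →
    ∀ K K', IsKernel r (window h i) i K → IsKernel r (window h i') i' K' →
    ∀ y : Pixel d n → ℝ, (∀ j, |y j| ≤ 1) →
      |∑ j ∈ window h i, K.eval (pixelCoord j) * y j -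
        ∑ j ∈ window h i', K'.eval (pixelCoord j) * y j| ≤ C * (s / (n * min h 1)) := by
  obtain ⟨C, hC1, hC⟩ := exists_abs_sub_le_of_subset d r
  obtain ⟨D, hD1, hD⟩ := exists_abs_fit_sub_le d r
  refine ⟨C + D + C, by linarith, fun n h s hh hr hs i i' k₀ hne hk₀ K K' hK hK' y hy => ?_⟩
  set m₀ : ℝ := n * min h 1 with hm₀
  have hpos : 0 < m₀ := lt_of_lt_of_le (by positivity) hr
  set ε : ℝ := s / m₀ with hε
  have hε0 : 0 ≤ ε := by positivity
  have hlen : ∀ (i : Pixel d n) k, m₀ ≤ windowLen h i k := mul_min_le_windowLen h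
  have hm : ∀ (i : Pixel d n) k, r + 1 ≤ windowLen h i k := fun i k => by
    exact_mod_cast hr.trans (hlen i k)
  have hsl : ∀ (i : Pixel d n) k, s ≤ windowLen h i k := fun i k => by
    exact_mod_cast hs.trans (hlen i k)
  have hsε : ∀ (i : Pixel d n) k, (s : ℝ) ≤ ε * windowLen h i k := fun i k => by
    rw [hε, div_mul_eq_mul_div, le_div_iff₀ hpos]
    exact mul_le_mul_of_nonneg_left (hlen i k) (Nat.cast_nonneg s)
  -- a box containing both windows
  set b : Fin d → ℕ := fun k => if k = k₀ then min n (i k₀ + s + ⌊n * h⌋₊ + 1) - windowLo h i k₀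
    else windowLen h i k with hb
  have hbk : b k₀ = min n (i k₀ + s + ⌊n * h⌋₊ + 1) - windowLo h i k₀ := by simp [hb]
  have hbne : ∀ k, k ≠ k₀ → b k = windowLen h i k := fun k hk => by simp [hb, hk]
  have hi0 := (i k₀).2
  have hi0' := (i' k₀).2
  have hlo' : ∀ k, k ≠ k₀ → windowLo h i' k = windowLo h i k := fun k hk => by
    rw [windowLo, windowLo, hne k hk]
  have hlen' : ∀ k, k ≠ k₀ → windowLen h i' k = windowLen h i k := fun k hk => by
    rw [windowLen, windowLen, hlo' k hk, hne k hk]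
  have hwl : windowLen h i k₀ = min n (i k₀ + ⌊n * h⌋₊ + 1) - windowLo h i k₀ := rfl
  have hwl' : windowLen h i' k₀ = min n (i' k₀ + ⌊n * h⌋₊ + 1) - windowLo h i' k₀ := rfl
  have hlo : windowLo h i k₀ = i k₀ - ⌊n * h⌋₊ := rfl
  have hlok' : windowLo h i' k₀ = i' k₀ - ⌊n * h⌋₊ := rfl
  have hble : windowLen h i k₀ ≤ b k₀ := by omega
  have hble2 : b k₀ ≤ windowLen h i k₀ + s := by omega
  have hble3 : b k₀ ≤ windowLen h i' k₀ + s := by omega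
  have hbn : ∀ k, windowLo h i k + b k ≤ n := fun k => by
    by_cases hk : k = k₀
    · subst hk; omega
    · rw [hbne k hk]; exact windowLo_add_windowLen_le h i k
  have hbr : ∀ k, r + 1 ≤ b k := fun k => by
    by_cases hk : k = k₀
    · subst hk; exact (hm i k).trans hble
    · rw [hbne k hk]; exact hm i k
  have hsub : (pixelBox (windowLo h i) (windowLen h i) : Finset (Pixel d n)) ⊆
      pixelBox (windowLo h i) b := fun j hj => by
    rw [mem_pixelBox] at hj ⊢
    intro k
    by_cases hk : k = k₀
    · subst hk; have := hj k; omega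
    · rw [hbne k hk]; exact hj k
  have hsub' : (pixelBox (windowLo h i') (windowLen h i') : Finset (Pixel d n)) ⊆
      pixelBox (windowLo h i) b := fun j hj => by
    rw [mem_pixelBox] at hj ⊢
    intro k
    by_cases hk : k = k₀
    · subst hk; have := hj k; omega
    · rw [hbne k hk, ← hlo' k hk, ← hlen' k hk]; exact hj k
  have hnear : ∀ (a m : Fin d → ℕ), (∀ k, a k ≤ windowLo h i k + m k) →
      (∀ k, windowLo h i k + b k ≤ a k + 2 * m k) →
      ∀ j ∈ (pixelBox (windowLo h i) b : Finset (Pixel d n)), IsNearBox a m (pixelCoord j) := by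
    intro a m h1 h2 j hj k
    have h3 := mem_pixelBox.1 hj k
    have h4 : a k ≤ (j k : ℕ) + m k := by have := h1 k; omega
    have h5 : (j k : ℕ) ≤ a k + 2 * m k := by have := h2 k; omega
    have h4' : (a k : ℝ) ≤ (j k : ℕ) + m k := by exact_mod_cast h4
    have h5' : ((j k : ℕ) : ℝ) ≤ a k + 2 * m k := by exact_mod_cast h5
    exact ⟨by simp only [pixelCoord]; linarith, h5'⟩
  have hprod : ∀ (m : Fin d → ℕ), (∀ k, k ≠ k₀ → b k = m k) → (b k₀ : ℝ) ≤ (1 + ε) * m k₀ →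
      ∏ k, (b k : ℝ) ≤ (1 + ε) * ∏ k, (m k : ℝ) := by
    intro m h1 h2
    rw [← Finset.mul_prod_erase _ _ (Finset.mem_univ k₀),
      ← Finset.mul_prod_erase _ (fun k => (m k : ℝ)) (Finset.mem_univ k₀), ← mul_assoc,
      Finset.prod_congr rfl fun k hk => by rw [h1 k (Finset.ne_of_mem_erase hk)]]
    exact mul_le_mul_of_nonneg_right h2 (Finset.prod_nonneg fun _ _ => Nat.cast_nonneg _)
  have hmem := self_mem_window hh.le i
  have hmem' := self_mem_window hh.le i'
  rw [window_eq_pixelBox hh.le] at hK hmem ⊢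
  rw [window_eq_pixelBox hh.le] at hK' hmem' ⊢
  obtain ⟨L, hL⟩ := exists_isKernel r (hsub hmem)
  obtain ⟨L', hL'⟩ := exists_isKernel r (hsub' hmem')
  -- The common box exceeds either window by at most `s` pixels in the direction `k₀`. The filter
  -- values are compared in three moves: enlarge the first window to the box, move from `i` to `i'`
  -- within the box, shrink to the second window.
  have b1 : (b k₀ : ℝ) ≤ windowLen h i k₀ + s := by exact_mod_cast hble2
  have b2 : (b k₀ : ℝ) ≤ windowLen h i' k₀ + s := by exact_mod_cast hble3
  have step1 := hC n _ _ _ _ (hm i) (windowLo_add_windowLen_le h i) hbr hbn hsub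
    (hnear _ _ (fun k => by omega) fun k => by
      by_cases hk : k = k₀
      · subst hk; have := hsl i k; omega
      · rw [hbne k hk]; omega)
    ε (hprod _ hbne (by linarith [hsε i k₀])) i hmem K L hK hL y hy
  have step3 := hC n _ _ _ _ (hm i') (windowLo_add_windowLen_le h i') hbr hbn hsub'
    (hnear _ _ (fun k => by
        by_cases hk : k = k₀
        · subst hk; have := hsl i' k; omega
        · rw [hlo' k hk]; omega) fun k => by
      by_cases hk : k = k₀
      · subst hk; have := hsl i' k; omega
      · rw [hbne k hk, hlo' k hk, hlen' k hk]; omega)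
    ε (hprod _ (fun k hk => by rw [hbne k hk, hlen' k hk]) (by linarith [hsε i' k₀]))
    i' hmem' K' L' hK' hL' y hy
  have step2 := hD n _ _ hbr hbn i i' (hsub hmem) (hsub' hmem') ε hε0 (fun k => by
    by_cases hk : k = k₀
    · subst hk
      have e : pixelCoord i k - pixelCoord i' k = -(s : ℝ) := by
        simp only [pixelCoord, hk₀]; push_cast; ring
      have h1 : (windowLen h i k : ℝ) ≤ b k := by exact_mod_cast hble
      rw [e, abs_neg, abs_of_nonneg (Nat.cast_nonneg s)]
      exact (hsε i k).trans (mul_le_mul_of_nonneg_left h1 hε0)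
    · simp only [pixelCoord, hne k hk, sub_self, abs_zero]
      positivity) L L' hL hL' y hy
  rw [abs_le] at step1 step2 step3 ⊢
  constructor <;> linarith [step1.1, step1.2, step2.1, step2.2, step3.1, step3.2]

/-! ### Moments of the noise -/

theorem IsWhiteNoise.integrable_mul {ι S : Type*} [MeasurableSpace S] {μ : Measure S} {σ : ℝ}
    {ε : ι → S → ℝ} (hε : IsWhiteNoise μ σ ε) (i j : ι) :
    Integrable (fun ω => ε i ω * ε j ω) μ :=
  MemLp.integrable_mul (p := 2) (q := 2) (hε.memLp i) (hε.memLp j)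

theorem IsWhiteNoise.memLp_sum {ι S : Type*} [MeasurableSpace S] {μ : Measure S}
    {σ : ℝ} {ε : ι → S → ℝ} (hε : IsWhiteNoise μ σ ε) (Q : Finset ι) (W : ι → ℝ) :
    MemLp (fun ω => ∑ j ∈ Q, W j * ε j ω) 2 μ :=
  memLp_finsetSum Q fun j _ => (hε.memLp j).const_mul (W j)

theorem IsWhiteNoise.integral_add_sum_sq {ι S : Type*} [MeasurableSpace S] {μ : Measure S}
    [IsProbabilityMeasure μ] {σ : ℝ} {ε : ι → S → ℝ} (hε : IsWhiteNoise μ σ ε) (Q : Finset ι)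
    (W : ι → ℝ) (b : ℝ) :
    Integrable (fun ω => (b + ∑ j ∈ Q, W j * ε j ω) ^ 2) μ ∧
      ∫ ω, (b + ∑ j ∈ Q, W j * ε j ω) ^ 2 ∂μ = b ^ 2 + σ ^ 2 * ∑ j ∈ Q, W j ^ 2 := by
  classical
  have hL := hε.memLp_sum Q W
  refine ⟨((memLp_const b).add hL).integrable_sq, ?_⟩
  have h1 : Integrable (fun ω => ∑ j ∈ Q, W j * ε j ω) μ := hL.integrable one_le_two
  have h2 : ∫ ω, ∑ j ∈ Q, W j * ε j ω ∂μ = 0 := by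
    rw [integral_finsetSum _ fun j _ => ((hε.memLp j).integrable one_le_two).const_mul _]
    simp [integral_const_mul, hε.mean]
  have h3 : ∫ ω, (∑ j ∈ Q, W j * ε j ω) ^ 2 ∂μ = σ ^ 2 * ∑ j ∈ Q, W j ^ 2 := by
    have e : ∀ ω, (∑ j ∈ Q, W j * ε j ω) ^ 2 =
        ∑ j ∈ Q, ∑ k ∈ Q, W j * W k * (ε j ω * ε k ω) := fun ω => by
      rw [sq, Finset.sum_mul_sum]
      exact Finset.sum_congr rfl fun j _ => Finset.sum_congr rfl fun k _ => by ring
    simp_rw [e]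
    rw [integral_finsetSum _ fun j _ => integrable_finsetSum _ fun k _ =>
      (hε.integrable_mul j k).const_mul _, Finset.mul_sum]
    refine Finset.sum_congr rfl fun j hj => ?_
    rw [integral_finsetSum _ fun k _ => (hε.integrable_mul j k).const_mul _,
      Finset.sum_eq_single j]
    · rw [integral_const_mul, ← hε.var j]
      simp_rw [← sq]
      ring
    · intro k _ hk
      rw [integral_const_mul, hε.uncorrelated j k hk.symm, mul_zero]
    · intro h
      exact absurd hj h
  have e : ∀ ω, (b + ∑ j ∈ Q, W j * ε j ω) ^ 2 =
      (b ^ 2 + 2 * b * ∑ j ∈ Q, W j * ε j ω) + (∑ j ∈ Q, W j * ε j ω) ^ 2 := fun ω => by ring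
  have h4 : Integrable (fun ω => b ^ 2 + 2 * b * ∑ j ∈ Q, W j * ε j ω) μ :=
    (integrable_const _).add (h1.const_mul _)
  simp_rw [e]
  rw [integral_add h4 hL.integrable_sq, integral_add (integrable_const _) (h1.const_mul _),
    integral_const_mul (2 * b), h2, h3]
  simp

theorem MemLp.integrable_pow {S : Type*} [MeasurableSpace S] {μ : Measure S}
    [IsProbabilityMeasure μ] {X : S → ℝ} (hX : MemLp X 4 μ) {p : ℕ} (hp : p ≤ 4) :
    Integrable (fun ω => X ω ^ p) μ := by
  have h1 : MemLp X p μ := hX.mono_exponent (by exact_mod_cast hp)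
  refine (integrable_norm_iff (hX.1.pow p)).1 ?_
  simpa [norm_pow] using h1.integrable_norm_pow'

/-- The fourth moment of a sum of independent centred variables of bounded kurtosis. -/
theorem integral_sum_pow_four_le {ι S : Type*} [MeasurableSpace S] {μ : Measure S}
    [IsProbabilityMeasure μ] {Y : ι → S → ℝ} (hY : iIndepFun Y μ) (hL : ∀ i, MemLp (Y i) 4 μ)
    (hmean : ∀ i, ∫ ω, Y i ω ∂μ = 0) {κ : ℝ} (hκ : 1 ≤ κ)
    (h4 : ∀ i, ∫ ω, Y i ω ^ 4 ∂μ ≤ κ * (∫ ω, Y i ω ^ 2 ∂μ) ^ 2) (Q : Finset ι) :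
    ∫ ω, (∑ i ∈ Q, Y i ω) ^ 2 ∂μ = ∑ i ∈ Q, ∫ ω, Y i ω ^ 2 ∂μ ∧
      ∫ ω, (∑ i ∈ Q, Y i ω) ^ 4 ∂μ ≤ 3 * κ * (∑ i ∈ Q, ∫ ω, Y i ω ^ 2 ∂μ) ^ 2 := by
  classical
  induction Q using Finset.induction_on with
  | empty => simp
  | insert i Q hi ih =>
    obtain ⟨ih2, ih4⟩ := ih
    set Z : S → ℝ := fun ω => ∑ j ∈ Q, Y j ω with hZ
    have hZL : MemLp Z 4 μ := memLp_finsetSum Q fun j _ => hL j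
    have hind : IndepFun Z (Y i) μ := by
      have := hY.indepFun_finsetSum_of_notMem₀ (fun j => (hL j).1.aemeasurable) hi
      convert this using 1
      ext ω
      simp [hZ]
    have hpq : ∀ p q : ℕ, p ≤ 4 → q ≤ 4 →
        Integrable (fun ω => Z ω ^ p * Y i ω ^ q) μ ∧
        ∫ ω, Z ω ^ p * Y i ω ^ q ∂μ = (∫ ω, Z ω ^ p ∂μ) * ∫ ω, Y i ω ^ q ∂μ := by
      intro p q hp hq
      have hi' : IndepFun (fun ω => Z ω ^ p) (fun ω => Y i ω ^ q) μ :=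
        hind.comp (φ := fun x => x ^ p) (ψ := fun x => x ^ q) (measurable_id.pow_const p)
          (measurable_id.pow_const q)
      exact ⟨hi'.integrable_mul (MemLp.integrable_pow hZL hp) (MemLp.integrable_pow (hL i) hq),
        hi'.integral_fun_mul_eq_mul_integral (hZL.1.pow p) ((hL i).1.pow q)⟩
    have hZm : ∫ ω, Z ω ^ 1 ∂μ = 0 := by
      simp only [pow_one, hZ]
      rw [integral_finsetSum _ fun j _ => (hL j).integrable (by norm_num)]
      simp [hmean]
    have hYm : ∫ ω, Y i ω ^ 1 ∂μ = 0 := by simpa using hmean i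
    have hs : ∀ ω, ∑ j ∈ insert i Q, Y j ω = Y i ω + Z ω := fun ω => Finset.sum_insert hi
    simp_rw [hs]
    rw [Finset.sum_insert hi]
    set A := ∫ ω, Y i ω ^ 2 ∂μ with hA
    have hA0 : 0 ≤ A := integral_nonneg fun ω => sq_nonneg _
    set V := ∑ j ∈ Q, ∫ ω, Y j ω ^ 2 ∂μ with hV
    have hV0 : 0 ≤ V := Finset.sum_nonneg fun j _ => integral_nonneg fun ω => sq_nonneg _
    have i2 := MemLp.integrable_pow (hL i) (p := 2) (by norm_num)
    have i4 := MemLp.integrable_pow (hL i) (p := 4) le_rfl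
    have z2 := MemLp.integrable_pow hZL (p := 2) (by norm_num)
    have z4 := MemLp.integrable_pow hZL (p := 4) le_rfl
    obtain ⟨m11, e11⟩ := hpq 1 1 (by norm_num) (by norm_num)
    obtain ⟨m31, e31⟩ := hpq 3 1 (by norm_num) (by norm_num)
    obtain ⟨m22, e22⟩ := hpq 2 2 (by norm_num) (by norm_num)
    obtain ⟨m13, e13⟩ := hpq 1 3 (by norm_num) (by norm_num)
    rw [hYm, mul_zero] at e11 e31
    rw [hZm, zero_mul] at e13
    rw [ih2] at e22
    constructor
    · have e : ∀ ω, (Y i ω + Z ω) ^ 2 = (Y i ω ^ 2 + Z ω ^ 2) + 2 * (Z ω ^ 1 * Y i ω ^ 1) :=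
        fun ω => by ring
      simp_rw [e]
      have j2 : Integrable (fun ω => Y i ω ^ 2 + Z ω ^ 2) μ := i2.add z2
      rw [integral_add j2 (m11.const_mul 2), integral_add i2 z2, integral_const_mul, e11,
        ih2]
      ring
    -- The terms with a first moment vanish, leaving at most `κ A² + 6 V A + 3 κ V²`, which is
    -- bounded by `3 κ (V + A)²` since `1 ≤ κ`.
    · have e : ∀ ω, (Y i ω + Z ω) ^ 4 = (Y i ω ^ 4 + Z ω ^ 4) + (4 * (Z ω ^ 3 * Y i ω ^ 1) +
          (6 * (Z ω ^ 2 * Y i ω ^ 2) + 4 * (Z ω ^ 1 * Y i ω ^ 3))) := fun ω => by ring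
      have j4 : Integrable (fun ω => Y i ω ^ 4 + Z ω ^ 4) μ := i4.add z4
      have jm : Integrable (fun ω => 6 * (Z ω ^ 2 * Y i ω ^ 2) + 4 * (Z ω ^ 1 * Y i ω ^ 3)) μ :=
        (m22.const_mul 6).add (m13.const_mul 4)
      have jmm : Integrable (fun ω => 4 * (Z ω ^ 3 * Y i ω ^ 1) +
          (6 * (Z ω ^ 2 * Y i ω ^ 2) + 4 * (Z ω ^ 1 * Y i ω ^ 3))) μ := (m31.const_mul 4).add jm
      simp_rw [e]
      rw [integral_add j4 jmm, integral_add i4 z4, integral_add (m31.const_mul 4) jm,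
        integral_add (m22.const_mul 6) (m13.const_mul 4), integral_const_mul, integral_const_mul,
        integral_const_mul, e31, e22, e13]
      have := h4 i
      have hVA : 0 ≤ V * A := mul_nonneg hV0 hA0
      nlinarith [mul_nonneg (sub_nonneg.2 hκ) hVA, mul_nonneg (by linarith : 0 ≤ κ) (sq_nonneg A)]

/-- The fourth moment of the error is controlled by the square of the second, so the error cannot
live on rare large values only. The constant is `8` from splitting off `b` times `3` from the moment
bound for sums. -/
theorem IsIndepKurtosis.integral_add_sum_pow_four_le {ι S : Type*} [MeasurableSpace S]
    {μ : Measure S} [IsProbabilityMeasure μ] {σ κ : ℝ} {ε : ι → S → ℝ} (hε : IsWhiteNoise μ σ ε)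
    (hε' : IsIndepKurtosis μ σ κ ε) (Q : Finset ι) (W : ι → ℝ) (b : ℝ) :
    Integrable (fun ω => (b + ∑ j ∈ Q, W j * ε j ω) ^ 4) μ ∧
      ∫ ω, (b + ∑ j ∈ Q, W j * ε j ω) ^ 4 ∂μ ≤
        24 * max κ 1 * (b ^ 2 + σ ^ 2 * ∑ j ∈ Q, W j ^ 2) ^ 2 := by
  set κ' := max κ 1 with hκ'
  have hκ1 : 1 ≤ κ' := le_max_right _ _
  have hL : ∀ j, MemLp (fun ω => W j * ε j ω) 4 μ := fun j => (hε'.memLp j).const_mul _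
  have hsq : ∀ j, ∫ ω, (W j * ε j ω) ^ 2 ∂μ = σ ^ 2 * W j ^ 2 := fun j => by
    simp_rw [mul_pow]
    rw [integral_const_mul, hε.var, mul_comm]
  have hX : MemLp (fun ω => ∑ j ∈ Q, W j * ε j ω) 4 μ := memLp_finsetSum Q fun j _ => hL j
  obtain ⟨-, hm4⟩ := integral_sum_pow_four_le (Y := fun j ω => W j * ε j ω)
    (hε'.indep.comp (fun j x => W j * x) fun j => measurable_const_mul _) hL
    (fun j => by rw [integral_const_mul, hε.mean, mul_zero]) hκ1 (fun j => by
      rw [hsq]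
      simp_rw [mul_pow]
      rw [integral_const_mul]
      have h1 : ∫ ω, ε j ω ^ 4 ∂μ ≤ κ' * σ ^ 4 :=
        (hε'.fourth j).trans (mul_le_mul_of_nonneg_right (le_max_left _ _) (by positivity))
      have h2 := mul_le_mul_of_nonneg_left h1 (by positivity : 0 ≤ W j ^ 4)
      linarith) Q
  simp_rw [hsq, ← Finset.mul_sum] at hm4
  set v := σ ^ 2 * ∑ j ∈ Q, W j ^ 2 with hv
  have hv0 : 0 ≤ v := by positivity
  refine ⟨MemLp.integrable_pow ((memLp_const b).add hX) le_rfl, ?_⟩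
  have hpt : ∀ ω, (b + ∑ j ∈ Q, W j * ε j ω) ^ 4 ≤ 8 * b ^ 4 + 8 * (∑ j ∈ Q, W j * ε j ω) ^ 4 := by
    intro ω
    set x := ∑ j ∈ Q, W j * ε j ω
    have h1 : (b + x) ^ 2 ≤ 2 * b ^ 2 + 2 * x ^ 2 := by nlinarith [sq_nonneg (b - x)]
    have h2 : ((b + x) ^ 2) ^ 2 ≤ (2 * b ^ 2 + 2 * x ^ 2) ^ 2 :=
      pow_le_pow_left₀ (sq_nonneg _) h1 2
    nlinarith [sq_nonneg (b ^ 2 - x ^ 2)]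
  have hXi := MemLp.integrable_pow hX (p := 4) le_rfl
  calc _ ≤ ∫ ω, (8 * b ^ 4 + 8 * (∑ j ∈ Q, W j * ε j ω) ^ 4) ∂μ :=
        integral_mono (MemLp.integrable_pow ((memLp_const b).add hX) le_rfl)
          ((integrable_const _).add (hXi.const_mul 8)) hpt
    _ = 8 * b ^ 4 + 8 * ∫ ω, (∑ j ∈ Q, W j * ε j ω) ^ 4 ∂μ := by
        rw [integral_add (integrable_const _) (hXi.const_mul 8),
          integral_const_mul 8 fun ω => (∑ j ∈ Q, W j * ε j ω) ^ 4]
        simp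
    _ ≤ 24 * κ' * (b ^ 2 + v) ^ 2 := by
        nlinarith [mul_nonneg (sub_nonneg.2 hκ1) (by positivity : 0 ≤ b ^ 4),
          mul_nonneg (by linarith : 0 ≤ κ') (mul_nonneg (sq_nonneg b) hv0)]

/-! ### The error at one pixel -/

theorem sq_clip_sub_le {f x : ℝ} (hf : f ∈ Set.Icc (0 : ℝ) 1) :
    (max 0 (min 1 x) - f) ^ 2 ≤ (x - f) ^ 2 := by
  rw [sq_le_sq]
  rcases le_total x 0 with h | h
  · rw [min_eq_right (h.trans zero_le_one), max_eq_left h, abs_of_nonpos (by linarith [hf.1]),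
      abs_of_nonpos (by linarith [hf.1])]
    linarith
  · rcases le_total x 1 with h1 | h1
    · rw [min_eq_right h1, max_eq_right h]
    · rw [min_eq_left h1, max_eq_right zero_le_one, abs_of_nonneg (by linarith [hf.2]),
        abs_of_nonneg (by linarith [hf.2])]
      linarith

/-- Values in `[1/4, 3/4]` keep a distance of `1/4` from both clipping levels, so clipping costs no
more than a truncation at `1/16`. -/
theorem min_sq_le_sq_clip_sub {f x : ℝ} (hf : f ∈ Set.Icc (1 / 4 : ℝ) (3 / 4)) :
    min ((x - f) ^ 2) (1 / 16) ≤ (max 0 (min 1 x) - f) ^ 2 := by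
  rcases le_total x 0 with h | h
  · rw [min_eq_right (h.trans zero_le_one), max_eq_left h]
    exact (min_le_right _ _).trans (by nlinarith [hf.1])
  · rcases le_total x 1 with h1 | h1
    · rw [min_eq_right h1, max_eq_right h]
      exact min_le_left _ _
    · rw [min_eq_left h1, max_eq_right zero_le_one]
      exact (min_le_right _ _).trans (by nlinarith [hf.2])

/-- A polynomial minorant of the truncated square, whose expectation involves only the second and
fourth moments. It rests on `x² - x⁴ / (4 T) ≤ T`, a completed square. -/
theorem truncated_sq_lower_bound {τ T : ℝ} (hτ : 0 < τ) (hT : τ ≤ T) (x : ℝ) :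
    τ / T * (x ^ 2 - x ^ 4 / (4 * T)) ≤ min (x ^ 2) τ := by
  have hT0 : 0 < T := hτ.trans_le hT
  have h1 : τ / T ≤ 1 := (div_le_one hT0).2 hT
  have h0 : 0 ≤ τ / T := by positivity
  refine le_min ?_ ?_
  · have : x ^ 2 - x ^ 4 / (4 * T) ≤ x ^ 2 := by
      have : 0 ≤ x ^ 4 / (4 * T) := by positivity
      linarith
    exact (mul_le_mul_of_nonneg_left this h0).trans (mul_le_of_le_one_left (sq_nonneg x) h1)
  · have h2 : x ^ 2 - x ^ 4 / (4 * T) ≤ T := by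
      rw [sub_le_iff_le_add, ← sub_le_iff_le_add', le_div_iff₀ (by positivity)]
      nlinarith [sq_nonneg (x ^ 2 - 2 * T)]
    calc _ ≤ τ / T * T := mul_le_mul_of_nonneg_left h2 h0
      _ = τ := div_mul_cancel₀ _ hT0.ne'

theorem ofReal_integral_le_lintegral {S : Type*} [MeasurableSpace S] {μ : Measure S} {g : S → ℝ}
    (hg : Integrable g μ) : ENNReal.ofReal (∫ ω, g ω ∂μ) ≤ ∫⁻ ω, ENNReal.ofReal (g ω) ∂μ := by
  rw [integral_eq_lintegral_pos_part_sub_lintegral_neg_part hg]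
  exact (ENNReal.ofReal_le_ofReal (sub_le_self _ ENNReal.toReal_nonneg)).trans
    ENNReal.ofReal_toReal_le

theorem linearFilter_sub_eq {d n : ℕ} {method : Method} {h : ℝ} (hh : 0 ≤ h) {i : Pixel d n}
    {K : MvPolynomial (Fin d) ℝ} (hK : IsKernel method.degree (window h i) i K)
    (f : Pixel d n → ℝ) (e : Pixel d n → ℝ) :
    linearFilter method h (fun j => f j + e j) i - f i =
      (∑ j ∈ window h i, K.eval (pixelCoord j) * f j - f i) +
        ∑ j ∈ window h i, K.eval (pixelCoord j) * e j := by
  rw [hK.linearFilter_eq hh]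
  simp_rw [mul_add]
  rw [Finset.sum_add_distrib]
  ring

theorem lintegral_error_le {d n : ℕ} {S : Type*} [MeasurableSpace S] {μ : Measure S}
    [IsProbabilityMeasure μ] {σ : ℝ} {ε : Pixel d n → S → ℝ} (hε : IsWhiteNoise μ σ ε)
    {method : Method} (clip : Bool) {h : ℝ} (hh : 0 ≤ h) {i : Pixel d n}
    {K : MvPolynomial (Fin d) ℝ} (hK : IsKernel method.degree (window h i) i K)
    {f : Pixel d n → ℝ} (hf : f i ∈ Set.Icc (0 : ℝ) 1) :
    ∫⁻ ω, ENNReal.ofReal ((estimator method clip h (fun j => f j + ε j ω) i - f i) ^ 2) ∂μ ≤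
      ENNReal.ofReal ((∑ j ∈ window h i, K.eval (pixelCoord j) * f j - f i) ^ 2 +
        σ ^ 2 * ∑ j ∈ window h i, K.eval (pixelCoord j) ^ 2) := by
  obtain ⟨hint, heq⟩ := hε.integral_add_sum_sq (window h i) (fun j => K.eval (pixelCoord j))
    (∑ j ∈ window h i, K.eval (pixelCoord j) * f j - f i)
  rw [← heq, ofReal_integral_eq_lintegral_ofReal hint
    (Filter.Eventually.of_forall fun ω => sq_nonneg _)]
  refine lintegral_mono fun ω => ENNReal.ofReal_le_ofReal ?_
  rw [← linearFilter_sub_eq hh hK f fun j => ε j ω]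
  cases clip
  · exact le_rfl
  · exact sq_clip_sub_le hf

/-- Without clipping this is the exact bias-variance identity. With clipping, the minorant is
applied with `T = 1/16 + B m`, `m` being the second moment: then the fourth moment term takes away
at most a quarter of `m`. -/
theorem exists_le_lintegral_error (κ : ℝ) : ∃ c : ℝ, 0 < c ∧ c ≤ 1 ∧
    ∀ {d n : ℕ} {S : Type u} [MeasurableSpace S] {μ : Measure S}
    [IsProbabilityMeasure μ] {σ : ℝ} {ε : Pixel d n → S → ℝ}, IsWhiteNoise μ σ ε →
    ∀ (method : Method) (clip : Bool), (clip = true → IsIndepKurtosis μ σ κ ε) →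
    ∀ {h : ℝ}, 0 ≤ h → ∀ {i : Pixel d n} {K : MvPolynomial (Fin d) ℝ},
    IsKernel method.degree (window h i) i K →
    ∀ {f : Pixel d n → ℝ}, f i ∈ Set.Icc (1 / 4 : ℝ) (3 / 4) →
    ENNReal.ofReal (c * min ((∑ j ∈ window h i, K.eval (pixelCoord j) * f j - f i) ^ 2 +
        σ ^ 2 * ∑ j ∈ window h i, K.eval (pixelCoord j) ^ 2) 1) ≤
    ∫⁻ ω, ENNReal.ofReal ((estimator method clip h (fun j => f j + ε j ω) i - f i) ^ 2) ∂μ := by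
  set B : ℝ := 24 * max κ 1 with hB
  have hB24 : 24 ≤ B := by
    have : (1 : ℝ) ≤ max κ 1 := le_max_right _ _
    linarith
  -- The value at `m = 1` of the resulting bound `(1/16) / (1/16 + B m) * (3/4) m`.
  set c : ℝ := 3 / 4 * (1 / 16) / (1 / 16 + B) with hc
  have hc0 : 0 < c := by positivity
  have hc1 : c ≤ 1 := (div_le_one (by positivity)).2 (by linarith)
  refine ⟨c, hc0, hc1, ?_⟩
  intro d n S _ μ _ σ ε hε method clip hclip h hh i K hK f hf
  obtain ⟨hint, heq⟩ := hε.integral_add_sum_sq (window h i) (fun j => K.eval (pixelCoord j))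
    (∑ j ∈ window h i, K.eval (pixelCoord j) * f j - f i)
  set b := ∑ j ∈ window h i, K.eval (pixelCoord j) * f j - f i with hb
  set v := σ ^ 2 * ∑ j ∈ window h i, K.eval (pixelCoord j) ^ 2 with hv
  have hv0 : 0 ≤ v := by positivity
  have hm0 : 0 ≤ b ^ 2 + v := by positivity
  cases clip
  · calc _ ≤ ENNReal.ofReal (b ^ 2 + v) := ENNReal.ofReal_le_ofReal <| by
          have h1 : 0 ≤ min (b ^ 2 + v) 1 := le_min hm0 zero_le_one
          exact (mul_le_of_le_one_left h1 hc1).trans (min_le_left _ _)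
      _ = _ := by
          rw [← heq, ofReal_integral_eq_lintegral_ofReal hint
            (Filter.Eventually.of_forall fun ω => sq_nonneg _)]
          refine lintegral_congr fun ω => ?_
          rw [← linearFilter_sub_eq hh hK f fun j => ε j ω]
          rfl
  · obtain ⟨hint4, hle4⟩ := IsIndepKurtosis.integral_add_sum_pow_four_le hε (hclip rfl)
      (window h i) (fun j => K.eval (pixelCoord j)) b
    set m := b ^ 2 + v with hm
    set T := 1 / 16 + B * m with hT
    have hBm : 0 ≤ B * m := by positivity
    have hTτ : 1 / 16 ≤ T := by linarith
    have hT0 : 0 < T := by linarith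
    set X : S → ℝ := fun ω => b + ∑ j ∈ window h i, K.eval (pixelCoord j) * ε j ω with hX
    have hgint : Integrable (fun ω => 1 / 16 / T * (X ω ^ 2 - X ω ^ 4 / (4 * T))) μ :=
      (hint.sub (hint4.div_const _)).const_mul _
    have hgval : c * min m 1 ≤ ∫ ω, 1 / 16 / T * (X ω ^ 2 - X ω ^ 4 / (4 * T)) ∂μ := by
      rw [integral_const_mul, integral_sub hint (hint4.div_const _), integral_div, heq]
      have h1 : (∫ ω, X ω ^ 4 ∂μ) / (4 * T) ≤ m / 4 := by
        rw [div_le_iff₀ (by positivity)]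
        calc ∫ ω, X ω ^ 4 ∂μ ≤ B * m ^ 2 := hle4
          _ ≤ m / 4 * (4 * T) := by rw [hT]; nlinarith
      have h2 : 3 / 4 * m ≤ m - (∫ ω, X ω ^ 4 ∂μ) / (4 * T) := by linarith
      refine le_trans ?_ (mul_le_mul_of_nonneg_left h2 (by positivity))
      have e : 1 / 16 / T * (3 / 4 * m) = 3 / 4 * (1 / 16) * m / T := by ring
      rw [e, hc, le_div_iff₀ hT0, div_mul_eq_mul_div, div_mul_eq_mul_div,
        div_le_iff₀ (by positivity), hT]
      rcases le_total m 1 with h3 | h3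
      · rw [min_eq_left h3]
        nlinarith [mul_nonneg (mul_nonneg (by linarith : 0 ≤ B) hm0) (sub_nonneg.2 h3)]
      · rw [min_eq_right h3]
        nlinarith
    refine (ENNReal.ofReal_le_ofReal hgval).trans ((ofReal_integral_le_lintegral hgint).trans ?_)
    refine lintegral_mono fun ω => ENNReal.ofReal_le_ofReal ?_
    refine (truncated_sq_lower_bound (by norm_num) hTτ (X ω)).trans ?_
    have e : X ω = linearFilter method h (fun j => f j + ε j ω) i - f i :=
      (linearFilter_sub_eq hh hK f fun j => ε j ω).symm
    rw [e]
    exact min_sq_le_sq_clip_sub hf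

/-! ### The upper bound for the risk -/

theorem gridPoint_mem_cube {d n : ℕ} (i : Pixel d n) : gridPoint i ∈ cube d := by
  refine ⟨fun k => ?_, fun k => ?_⟩
  · simp only [gridPoint, Pi.zero_apply]
    positivity
  · have hn : (0 : ℝ) < n := by exact_mod_cast (i k).pos
    have h1 : ((i k : ℕ) : ℝ) + 1 ≤ n := by exact_mod_cast (i k).2
    simp only [gridPoint, Pi.one_apply]
    rw [div_le_one hn]
    linarith

theorem mse_le_ofReal {d n : ℕ} {S : Type*} [MeasurableSpace S] {μ : Measure S}
    {ε : Pixel d n → S → ℝ} {method : Method} {clip : Bool} {h : ℝ} {f : (Fin d → ℝ) → ℝ}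
    (hn : 0 < n) {b : Pixel d n → ℝ} {B : ℝ} (hb0 : ∀ i, 0 ≤ b i)
    (hb : ∀ i, ∫⁻ ω, ENNReal.ofReal ((estimator method clip h
      (fun j => f (gridPoint j) + ε j ω) i - f (gridPoint i)) ^ 2) ∂μ ≤ ENNReal.ofReal (b i))
    (hB : ∑ i, b i ≤ B * n ^ d) : mse μ ε method clip h f ≤ ENNReal.ofReal B := by
  have hn' : (0 : ℝ) < (n : ℝ) ^ d := by positivity
  have e : ((n : ℝ≥0∞)) ^ d = ENNReal.ofReal ((n : ℝ) ^ d) := by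
    rw [ENNReal.ofReal_pow (Nat.cast_nonneg n), ENNReal.ofReal_natCast]
  rw [mse, e]
  refine ENNReal.div_le_of_le_mul ?_
  rw [← ENNReal.ofReal_mul' hn'.le]
  refine (Finset.sum_le_sum fun i _ => hb i).trans ?_
  rw [← ENNReal.ofReal_sum_of_nonneg fun i _ => hb0 i]
  exact ENNReal.ofReal_le_ofReal hB

theorem ofReal_le_mse {d n : ℕ} {S : Type*} [MeasurableSpace S] {μ : Measure S}
    {ε : Pixel d n → S → ℝ} {method : Method} {clip : Bool} {h : ℝ} {f : (Fin d → ℝ) → ℝ}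
    (hn : 0 < n) {b : Pixel d n → ℝ} {B : ℝ} (hb0 : ∀ i, 0 ≤ b i)
    (hb : ∀ i, ENNReal.ofReal (b i) ≤ ∫⁻ ω, ENNReal.ofReal ((estimator method clip h
      (fun j => f (gridPoint j) + ε j ω) i - f (gridPoint i)) ^ 2) ∂μ)
    (hB : B * n ^ d ≤ ∑ i, b i) : ENNReal.ofReal B ≤ mse μ ε method clip h f := by
  have hn' : (0 : ℝ) < (n : ℝ) ^ d := by positivity
  have e : ((n : ℝ≥0∞)) ^ d = ENNReal.ofReal ((n : ℝ) ^ d) := by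
    rw [ENNReal.ofReal_pow (Nat.cast_nonneg n), ENNReal.ofReal_natCast]
  rw [mse, e, ENNReal.le_div_iff_mul_le (Or.inl (ENNReal.ofReal_pos.2 hn').ne')
    (Or.inl ENNReal.ofReal_ne_top), ← ENNReal.ofReal_mul' hn'.le]
  refine (ENNReal.ofReal_le_ofReal hB).trans ?_
  rw [ENNReal.ofReal_sum_of_nonneg fun i _ => hb0 i]
  exact Finset.sum_le_sum fun i _ => hb i

theorem IsKernel.bias_eq {d n r : ℕ} {Q : Finset (Pixel d n)} {i : Pixel d n}
    {K : MvPolynomial (Fin d) ℝ} (hK : IsKernel r Q i K) (f : Pixel d n → ℝ) :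
    ∑ j ∈ Q, K.eval (pixelCoord j) * f j - f i =
      ∑ j ∈ Q, K.eval (pixelCoord j) * (f j - f i) := by
  simp_rw [mul_sub]
  rw [Finset.sum_sub_distrib, ← Finset.sum_mul, hK.sum_eq_one, one_mul]

theorem mem_Icc_of_mem_cartoonClass {d : ℕ} {α C₀ : ℝ} {f : (Fin d → ℝ) → ℝ}
    (hf : f ∈ cartoonClass d α C₀) {x : Fin d → ℝ} (hx : x ∈ cube d) :
    f x ∈ Set.Icc (0 : ℝ) 1 := by
  obtain ⟨Ω, fin, fout, -, hin, hout, -, heq⟩ := hf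
  rw [heq x hx]
  split_ifs
  · exact hin.mem_unit x hx
  · exact hout.mem_unit x hx

/-- Weights that sum to one turn the bias into a weighted sum of differences `f (x_j) - f (x_i)`.
These are at most `1` at boundary pixels and of order `h` elsewhere, where the whole window sees one
Lipschitz piece. -/
theorem exists_risk_le (d : ℕ) (hd : 1 ≤ d) {α C₀ : ℝ} (hα : 1 ≤ α) (hC : 0 < C₀)
    (method : Method) (clip : Bool) : ∃ C M : ℝ, 0 < C ∧ 0 < M ∧
    ∀ (n : ℕ) (σ : ℝ) (S : Type u) [MeasurableSpace S] (μ : Measure S) [IsProbabilityMeasure μ]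
      (ε : Pixel d n → S → ℝ), IsWhiteNoise μ σ ε → ∀ h : ℝ, 0 < h → h ≤ 1 → M ≤ n * h →
      risk μ ε α C₀ method clip h ≤ ENNReal.ofReal (C * (h + σ ^ 2 / (n * h) ^ d)) := by
  obtain ⟨C₁, hC₁, hker⟩ := exists_abs_window_kernel_le d method.degree
  obtain ⟨C₂, hC₂, hcount⟩ := exists_card_boundaryPixels_le d hC
  set L : ℝ := d * C₀ with hL
  have hL0 : 0 ≤ L := by positivity
  refine ⟨(C₁ * L) ^ 2 + C₁ ^ 2 * C₂ + C₁, ((method.degree + 1 : ℕ) : ℝ), by positivity,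
    by positivity, ?_⟩
  intro n σ S _ μ _ ε hε h hh hh1 hM
  have hn : 0 < n := by
    by_contra hn
    have h0 : n = 0 := by omega
    rw [h0, Nat.cast_zero, zero_mul] at hM
    exact absurd hM (not_le.2 (by positivity))
  have hnh : 0 < (n : ℝ) * h := by positivity
  have hnh1 : 1 ≤ (n : ℝ) * h := le_trans (by push_cast; linarith
    [(Nat.cast_nonneg method.degree : (0 : ℝ) ≤ method.degree)]) hM
  have hmin : min h 1 = h := min_eq_left hh1
  refine iSup₂_le fun f hf => ?_
  obtain ⟨Ω, fin, fout, hΩ, hin, hout, -, heq⟩ := id hf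
  choose K hK using fun i : Pixel d n => exists_isKernel method.degree (self_mem_window hh.le i)
  set A : Finset (Pixel d n) := boundaryPixels Ω h with hA
  set b : Pixel d n → ℝ := fun i => ((C₁ * L) ^ 2 * h + C₁ * (σ ^ 2 / (n * h) ^ d)) +
    if i ∈ A then C₁ ^ 2 else 0 with hb
  refine mse_le_ofReal hn (b := b) (fun i => ?_) (fun i => ?_) ?_
  · simp only [hb]
    split_ifs <;> positivity
  · refine (lintegral_error_le hε clip hh.le (hK i) (f := fun j => f (gridPoint j))
      (mem_Icc_of_mem_cartoonClass hf (gridPoint_mem_cube i))).trans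
      (ENNReal.ofReal_le_ofReal ?_)
    obtain ⟨hk1, hk2⟩ := hker n h hh (by rw [hmin]; exact hM) i (K i) (hK i)
    rw [hmin] at hk1
    have hvar : σ ^ 2 * ∑ j ∈ window h i, (K i).eval (pixelCoord j) ^ 2 ≤
        C₁ * (σ ^ 2 / (n * h) ^ d) := by
      rw [(hK i).sum_sq_eq]
      calc _ ≤ σ ^ 2 * (C₁ / (n * h) ^ d) := by
            gcongr
            exact (le_abs_self _).trans (hk1 i (self_mem_window hh.le i))
        _ = _ := by ring
    rw [(hK i).bias_eq]
    by_cases hi : i ∈ A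
    · have h1 : |∑ j ∈ window h i, (K i).eval (pixelCoord j) *
          (f (gridPoint j) - f (gridPoint i))| ≤ C₁ * 1 := hk2 _ 1 fun j _ => by
        have hj := mem_Icc_of_mem_cartoonClass hf (gridPoint_mem_cube j)
        have hi := mem_Icc_of_mem_cartoonClass hf (gridPoint_mem_cube i)
        exact abs_le.2 ⟨by linarith [hj.1, hi.2], by linarith [hj.2, hi.1]⟩
      have h2 := sq_le_sq' (neg_le_of_abs_le h1) (le_of_abs_le h1)
      rw [mul_one] at h2
      simp only [hb, if_pos hi]
      have : 0 ≤ (C₁ * L) ^ 2 * h := by positivity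
      linarith
    · have h1 : |∑ j ∈ window h i, (K i).eval (pixelCoord j) *
          (f (gridPoint j) - f (gridPoint i))| ≤ C₁ * (L * h) := hk2 _ (L * h) fun j hj => by
        rw [mem_window] at hj
        have hside : ¬ (gridPoint i ∈ Ω ↔ gridPoint j ∉ Ω) := fun hiff =>
          hi (mem_boundaryPixels.2 ⟨j, hj, hiff⟩)
        have hLip : ∀ g : (Fin d → ℝ) → ℝ, HolderClass d α C₀ g →
            |g (gridPoint j) - g (gridPoint i)| ≤ L * h := fun g hg => by
          refine (hg.norm_sub_le hα hC.le hd (gridPoint_mem_cube j) (gridPoint_mem_cube i)).trans ?_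
          rw [norm_sub_rev]
          exact mul_le_mul_of_nonneg_left hj hL0
        rw [heq _ (gridPoint_mem_cube i), heq _ (gridPoint_mem_cube j)]
        by_cases h1 : gridPoint i ∈ Ω <;> by_cases h2 : gridPoint j ∈ Ω
        · simpa [h1, h2] using hLip fin hin
        · exact absurd ⟨fun _ => h2, fun _ => h1⟩ hside
        · exact absurd ⟨fun h3 => absurd h3 h1, fun h3 => absurd h2 h3⟩ hside
        · simpa [h1, h2] using hLip fout hout
      have h2 := sq_le_sq' (neg_le_of_abs_le h1) (le_of_abs_le h1)
      have h3 : (C₁ * (L * h)) ^ 2 ≤ (C₁ * L) ^ 2 * h := by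
        have e : (C₁ * (L * h)) ^ 2 = (C₁ * L) ^ 2 * (h * h) := by ring
        rw [e]
        gcongr
        exact mul_le_of_le_one_left hh.le hh1
      simp only [hb, if_neg hi, add_zero]
      linarith
  · simp only [hb]
    rw [Finset.sum_add_distrib, Finset.sum_const, Finset.card_univ, card_pixel, nsmul_eq_mul,
      Finset.sum_ite_mem, Finset.univ_inter, Finset.sum_const, nsmul_eq_mul]
    have h1 := hcount n h hnh1 Ω hΩ
    have h2 : (A.card : ℝ) * C₁ ^ 2 ≤ C₂ * h * n ^ d * C₁ ^ 2 :=
      mul_le_mul_of_nonneg_right h1 (by positivity)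
    have hs : 0 ≤ σ ^ 2 / (n * h) ^ d := by positivity
    set v := σ ^ 2 / (n * h) ^ d
    push_cast
    have h3 : 0 ≤ ((C₁ * L) ^ 2 + C₁ ^ 2 * C₂) * v * n ^ d := by positivity
    have h4 : 0 ≤ C₁ * h * (n : ℝ) ^ d := by positivity
    nlinarith

/-! ### A test image -/

/-- The Euclidean ball of radius `1 / C₀` around the centre of the cube. -/
def testDisc (d : ℕ) (C₀ : ℝ) : Set (Fin d → ℝ) := {x | ∑ k, (x k - 1 / 2) ^ 2 < 1 / C₀ ^ 2}

theorem mem_testDisc {d : ℕ} {C₀ : ℝ} {x : Fin d → ℝ} :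
    x ∈ testDisc d C₀ ↔ ∑ k, (x k - 1 / 2) ^ 2 < 1 / C₀ ^ 2 := Iff.rfl

open Classical in
/-- The image with value `3 / 4` on a disc and `1 / 4` elsewhere. -/
def testImage (d : ℕ) (C₀ : ℝ) (x : Fin d → ℝ) : ℝ := if x ∈ testDisc d C₀ then 3 / 4 else 1 / 4

/-- The map is a dilation by `1 / C₀` about the centre, whose inverse has Lipschitz constant exactly
`C₀`; `2 ≤ C₀` keeps the disc in the open cube. -/
theorem isForeground_testDisc (d : ℕ) {C₀ : ℝ} (hC : 2 ≤ C₀) :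
    IsForeground d C₀ (testDisc d C₀) := by
  have hC0 : 0 < C₀ := by linarith
  have hCinv : C₀⁻¹ ≤ C₀ := (inv_le_one_of_one_le₀ (by linarith)).trans (by linarith)
  constructor
  · intro x hx k
    rw [mem_testDisc] at hx
    have h1 := Finset.single_le_sum (f := fun k => (x k - 1 / 2) ^ 2) (fun _ _ => sq_nonneg _)
      (Finset.mem_univ k)
    have h2 : 1 / C₀ ^ 2 ≤ 1 / 2 ^ 2 := by gcongr
    have h3 : (x k - 1 / 2) ^ 2 < (1 / 2) ^ 2 := lt_of_le_of_lt h1 (by linarith)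
    have h4 := abs_lt.1 (abs_lt_of_sq_lt_sq h3 (by norm_num))
    constructor <;> linarith [h4.1, h4.2]
  · have hsub : ∀ x y : Fin d → ℝ, ((fun _ => 1 / 2) + C₀⁻¹ • x) - ((fun _ => 1 / 2) + C₀⁻¹ • y) =
        C₀⁻¹ • (x - y) := fun x y => by rw [add_sub_add_left_eq_sub, smul_sub]
    have hnorm : ∀ x y : Fin d → ℝ,
        ‖((fun _ => 1 / 2) + C₀⁻¹ • x) - ((fun _ => 1 / 2) + C₀⁻¹ • y)‖ = C₀⁻¹ * ‖x - y‖ :=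
      fun x y => by rw [hsub, norm_smul, Real.norm_eq_abs, abs_of_pos (inv_pos.2 hC0)]
    refine ⟨fun x => (fun _ => 1 / 2) + C₀⁻¹ • x, fun x y hxy => ?_, fun x y => ?_, fun x y => ?_, ?_⟩
    · exact smul_right_injective _ (inv_ne_zero hC0.ne') (add_left_cancel hxy)
    · rw [hnorm]
      gcongr
    · rw [hnorm, mul_inv_cancel_left₀ hC0.ne']
    · ext y
      have key : ∀ x : Fin d → ℝ, ((fun _ => 1 / 2) + C₀⁻¹ • x ∈ testDisc d C₀) ↔
          x ∈ euclideanBall d := by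
        intro x
        have e : ∑ k, (((fun _ => 1 / 2) + C₀⁻¹ • x : Fin d → ℝ) k - 1 / 2) ^ 2 =
            (∑ k, x k ^ 2) / C₀ ^ 2 := by
          rw [Finset.sum_div]
          refine Finset.sum_congr rfl fun k _ => ?_
          simp only [Pi.add_apply, Pi.smul_apply, smul_eq_mul, add_sub_cancel_left]
          field_simp
        rw [mem_testDisc, e, div_lt_div_iff_of_pos_right (by positivity)]
        rfl
      constructor
      · intro hy
        have e : y = (fun _ => 1 / 2) + C₀⁻¹ • (C₀ • (y - fun _ => 1 / 2)) := by
          rw [smul_smul, inv_mul_cancel₀ hC0.ne', one_smul, add_sub_cancel]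
        rw [e] at hy
        exact ⟨_, (key _).1 hy, e.symm⟩
      · rintro ⟨x, hx, rfl⟩
        exact (key x).2 hx

theorem testImage_mem_cartoonClass (d : ℕ) {α C₀ : ℝ} (hC : 2 ≤ C₀) :
    testImage d C₀ ∈ cartoonClass d α C₀ := by
  refine ⟨testDisc d C₀, fun _ => 3 / 4, fun _ => 1 / 4, isForeground_testDisc d hC,
    HolderClass.const d (by linarith) (by norm_num), HolderClass.const d (by linarith)
    (by norm_num), fun x _ => ?_, fun x _ => rfl⟩
  have h1 : 1 / C₀ ≤ 1 / 2 := by gcongr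
  norm_num at h1 ⊢
  exact h1

theorem testImage_mem_Icc (d : ℕ) (C₀ : ℝ) (x : Fin d → ℝ) :
    testImage d C₀ x ∈ Set.Icc (1 / 4 : ℝ) (3 / 4) := by
  unfold testImage
  split_ifs <;> norm_num

/-- The risk is at least of the order of the variance. -/
theorem exists_variance_le_risk (d : ℕ) {α C₀ : ℝ} (hC : 2 ≤ C₀) (method : Method) (clip : Bool)
    (κ : ℝ) : ∃ c : ℝ, 0 < c ∧ c ≤ 1 ∧
    ∀ (n : ℕ) (σ : ℝ) (S : Type u) [MeasurableSpace S] (μ : Measure S) [IsProbabilityMeasure μ]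
      (ε : Pixel d n → S → ℝ), 0 < n → IsWhiteNoise μ σ ε →
      (clip = true → IsIndepKurtosis μ σ κ ε) → ∀ h : ℝ, 0 < h →
      ENNReal.ofReal (c * min (σ ^ 2 / (2 * (n * h) + 1) ^ d) 1) ≤
        risk μ ε α C₀ method clip h := by
  obtain ⟨c, hc0, hc1, hc⟩ := exists_le_lintegral_error.{u} κ
  refine ⟨c, hc0, hc1, ?_⟩
  intro n σ S _ μ _ ε hn hε hclip h hh
  refine le_trans ?_ (le_iSup₂ (f := fun f _ => mse μ ε method clip h f) _
    (testImage_mem_cartoonClass d hC))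
  refine ofReal_le_mse hn
    (b := fun _ => c * min (σ ^ 2 / (2 * (n * h) + 1) ^ d) 1) (fun i => by positivity)
    (fun i => ?_) ?_
  · obtain ⟨K, hK⟩ := exists_isKernel method.degree (self_mem_window hh.le i)
    refine le_trans (ENNReal.ofReal_le_ofReal ?_) (hc hε method clip hclip hh.le hK
      (f := fun j => testImage d C₀ (gridPoint j)) (testImage_mem_Icc d C₀ _))
    have h1 : σ ^ 2 / (2 * (n * h) + 1) ^ d ≤
        σ ^ 2 * ∑ j ∈ window h i, K.eval (pixelCoord j) ^ 2 := by
      rw [div_eq_mul_one_div]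
      refine mul_le_mul_of_nonneg_left (le_trans ?_ hK.inv_card_le) (sq_nonneg σ)
      refine one_div_le_one_div_of_le ?_ (card_window_le hh.le i)
      exact_mod_cast Finset.card_pos.2 ⟨i, self_mem_window hh.le i⟩
    refine mul_le_mul_of_nonneg_left (min_le_min_right 1 ?_) hc0.le
    exact h1.trans (le_add_of_nonneg_left (sq_nonneg _))
  · rw [Finset.sum_const, Finset.card_univ, card_pixel, nsmul_eq_mul]
    push_cast
    linarith

/-! ### Pixels between which the test image jumps -/

theorem exists_transition {p : ℕ → Prop} {L : ℕ} (h0 : p 0) (hL : ¬ p L) :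
    ∃ l < L, p l ∧ ¬ p (l + 1) := by
  induction L with
  | zero => exact absurd h0 hL
  | succ L ih =>
    by_cases h : p L
    · exact ⟨L, Nat.lt_succ_self L, h, hL⟩
    · obtain ⟨l, hl, hp⟩ := ih h
      exact ⟨l, hl.trans (Nat.lt_succ_self L), hp⟩

theorem sum_sq_sub_eq {d n : ℕ} (i : Pixel d n) (k₀ : Fin d) :
    ∑ k, (gridPoint i k - 1 / 2) ^ 2 = (((i k₀ : ℕ) + 1 / 2 : ℝ) / n - 1 / 2) ^ 2 +
      ∑ k ∈ Finset.univ.erase k₀, (gridPoint i k - 1 / 2) ^ 2 := by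
  rw [← Finset.add_sum_erase _ _ (Finset.mem_univ k₀)]
  rfl

set_option maxHeartbeats 800000 in
/-- Many pixels `i` in the disc of the test image are such that the pixel at distance `s` in a
given coordinate direction is outside of the disc. -/
theorem exists_jump_pixels (d : ℕ) (k₀ : Fin d) {C₀ : ℝ} (hC : 2 ≤ C₀) (hC1 : d = 1 → 2 < C₀) :
    ∃ c η : ℝ, 0 < c ∧ 0 < η ∧ ∃ N : ℝ, ∀ n s : ℕ, 0 < n → 1 ≤ s → (s : ℝ) ≤ η * n → N ≤ n →
      ∃ (A : Finset (Pixel d n)) (T : Pixel d n → Pixel d n),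
        (∀ i ∈ A, (∀ k, k ≠ k₀ → T i k = i k) ∧ ((T i k₀ : ℕ) = i k₀ + s) ∧
          gridPoint i ∈ testDisc d C₀ ∧ gridPoint (T i) ∉ testDisc d C₀) ∧
        c * s * n ^ d ≤ A.card * n := by
  classical
  have hC0 : 0 < C₀ := by linarith
  have hd : 1 ≤ d := (Nat.zero_le _).trans_lt k₀.2
  have hd' : (1 : ℝ) ≤ d := by exact_mod_cast hd
  -- Small enough that a point with all offsets from the centre at most `δ` lies in the disc.
  set δ : ℝ := 1 / (2 * d * C₀) with hδ
  have hδ0 : 0 < δ := by positivity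
  have hδ4 : δ ≤ 1 / 4 := by
    rw [hδ]
    apply one_div_le_one_div_of_le (by norm_num)
    nlinarith
  have hdδ : d * δ ^ 2 < 1 / C₀ ^ 2 := by
    have e : d * δ ^ 2 = 1 / (4 * d) * (1 / C₀ ^ 2) := by
      rw [hδ]; field_simp; norm_num
    rw [e]
    have h1 : 1 / (4 * (d : ℝ)) < 1 := by
      rw [div_lt_one (by positivity)]; linarith
    have h2 : 0 < 1 / C₀ ^ 2 := by positivity
    nlinarith
  -- the margin by which the disc stays away from the face of the cube on good lines
  obtain ⟨γ, hγ0, hγ2, hγ⟩ : ∃ γ : ℝ, 0 < γ ∧ γ ≤ 1 / 2 ∧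
      1 / C₀ ^ 2 ≤ (1 / 2 - γ) ^ 2 + (d - 1) * (δ / 2) ^ 2 := by
    -- In dimension one the margin requires `2 < C₀`. Otherwise a good line is off the centre by at
    -- least `δ / 2` in another coordinate, and `γ = (δ / 2)²` is compensated by that offset even if
    -- `C₀ = 2`.
    rcases hd.eq_or_lt with h1 | h1
    · have h2 := hC1 h1.symm
      have h3 : 1 / C₀ < 1 / 2 := one_div_lt_one_div_of_lt (by norm_num) h2
      have h4 : 0 < 1 / C₀ := by positivity
      refine ⟨1 / 2 - 1 / C₀, by linarith, by linarith, ?_⟩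
      rw [← h1]
      simp
    · have h2 : (2 : ℝ) ≤ d := by exact_mod_cast h1
      have h3 : 1 / C₀ ^ 2 ≤ 1 / 2 ^ 2 := by gcongr
      refine ⟨(δ / 2) ^ 2, by positivity, by nlinarith, ?_⟩
      nlinarith [sq_nonneg ((δ / 2) ^ 2), sq_nonneg (δ / 2)]
  refine ⟨(δ / 8) ^ d, min (δ / 2) γ / 2, by positivity, by positivity, 16 / δ, ?_⟩
  intro n s hn hs hsn hN
  have hn' : (0 : ℝ) < n := by exact_mod_cast hn
  have hs' : (1 : ℝ) ≤ s := by exact_mod_cast hs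
  have hnδ : 16 ≤ n * δ := by rwa [div_le_iff₀ hδ0] at hN
  have hnδ4 : n * δ ≤ n / 4 := by
    have := mul_le_mul_of_nonneg_left hδ4 hn'.le
    linarith
  have hsδ : (s : ℝ) ≤ n * δ / 4 := hsn.trans (by
    have := min_le_left (δ / 2) γ
    nlinarith)
  have hsγ : (s : ℝ) ≤ γ * n := hsn.trans (by
    have := min_le_right (δ / 2) γ
    nlinarith)
  -- the good lines
  set m : Fin d → ℕ := fun k => if k = k₀ then 1 else ⌊n * δ / 4⌋₊ with hm
  set a : Fin d → ℕ := fun k => if k = k₀ then 0 else ⌈n * (1 / 2 + δ / 2)⌉₊ with ha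
  set Λ : Finset (Pixel d n) := pixelBox a m with hΛ
  have hfl : (⌊n * δ / 4⌋₊ : ℝ) ≤ n * δ / 4 := Nat.floor_le (by positivity)
  have hfl' : n * δ / 8 ≤ (⌊n * δ / 4⌋₊ : ℝ) := by
    have := Nat.lt_floor_add_one (n * δ / 4)
    linarith
  have hce : (⌈n * (1 / 2 + δ / 2)⌉₊ : ℝ) < n * (1 / 2 + δ / 2) + 1 :=
    Nat.ceil_lt_add_one (by positivity)
  have hce' : n * (1 / 2 + δ / 2) ≤ (⌈n * (1 / 2 + δ / 2)⌉₊ : ℝ) := Nat.le_ceil _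
  have ham : ∀ k, a k + m k ≤ n := fun k => by
    by_cases hk : k = k₀
    · simp only [ha, hm, hk, if_true]; omega
    · simp only [ha, hm, hk, if_false]
      have : (⌈n * (1 / 2 + δ / 2)⌉₊ + ⌊n * δ / 4⌋₊ : ℝ) ≤ n := by linarith
      exact_mod_cast this
  -- There is one element per line, hence about `n ^ (d - 1)` of them; the factor `n` avoids the
  -- subtraction in the exponent.
  have hΛcard : (δ / 8) ^ d * (n : ℝ) ^ d ≤ Λ.card * n := by
    rw [hΛ, card_pixelBox ham, ← mul_pow, ← Finset.mul_prod_erase _ _ (Finset.mem_univ k₀)]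
    have e : (δ / 8 * (n : ℝ)) ^ d = (δ / 8 * n) * ∏ _k ∈ Finset.univ.erase k₀, (δ / 8 * (n : ℝ)) := by
      rw [Finset.mul_prod_erase Finset.univ (fun _ => δ / 8 * (n : ℝ)) (Finset.mem_univ k₀)]
      simp
    rw [e]
    have h1 : ∏ _k ∈ Finset.univ.erase k₀, (δ / 8 * (n : ℝ)) ≤
        ∏ k ∈ Finset.univ.erase k₀, (m k : ℝ) :=
      Finset.prod_le_prod (fun _ _ => by positivity) fun k hk => by
        simp only [hm, Finset.ne_of_mem_erase hk, if_false]
        linarith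
    have h2 : δ / 8 * (n : ℝ) ≤ n := by linarith
    have h3 : (m k₀ : ℝ) = 1 := by simp [hm]
    have h4 : (0 : ℝ) ≤ ∏ _k ∈ Finset.univ.erase k₀, (δ / 8 * (n : ℝ)) :=
      Finset.prod_nonneg fun _ _ => by positivity
    rw [h3, one_mul, mul_comm (δ / 8 * (n : ℝ))]
    exact mul_le_mul h1 h2 (by positivity) (h4.trans h1)
  have hline : ∀ ℓ ∈ Λ, ∀ k, k ≠ k₀ →
      δ / 2 ≤ gridPoint ℓ k - 1 / 2 ∧ gridPoint ℓ k - 1 / 2 ≤ δ := by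
    intro ℓ hℓ k hk
    have h1 := mem_pixelBox.1 hℓ k
    simp only [ha, hm, hk, if_false] at h1
    have h2 : (⌈n * (1 / 2 + δ / 2)⌉₊ : ℝ) ≤ (ℓ k : ℕ) := by exact_mod_cast h1.1
    have h3 : ((ℓ k : ℕ) : ℝ) + 1 ≤ ⌈n * (1 / 2 + δ / 2)⌉₊ + ⌊n * δ / 4⌋₊ := by
      exact_mod_cast h1.2
    simp only [gridPoint]
    constructor
    · rw [le_sub_iff_add_le, le_div_iff₀ hn']
      linarith
    · rw [sub_le_iff_le_add, div_le_iff₀ hn']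
      linarith
  -- the shift by `s` pixels
  set T : Pixel d n → Pixel d n := fun i =>
    if h : (i k₀ : ℕ) + s < n then Function.update i k₀ ⟨i k₀ + s, h⟩ else i with hT
  set A : Finset (Pixel d n) := Finset.univ.filter fun i =>
    (i k₀ : ℕ) + s < n ∧ gridPoint i ∈ testDisc d C₀ ∧ gridPoint (T i) ∉ testDisc d C₀ with hA
  refine ⟨A, T, fun i hi => ?_, ?_⟩
  · obtain ⟨h1, h2, h3⟩ := (Finset.mem_filter.1 hi).2
    refine ⟨fun k hk => ?_, ?_, h2, h3⟩
    · simp only [hT, dif_pos h1, Function.update_of_ne hk]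
    · simp only [hT, dif_pos h1, Function.update_self]
  -- on every good line there is a jump in every residue class modulo `s`
  have hex : ∀ p : Pixel d n × ℕ, ∃ i : Pixel d n, p ∈ Λ ×ˢ Finset.range s →
      i ∈ A ∧ (∀ k, k ≠ k₀ → i k = p.1 k) ∧ ∃ l, (i k₀ : ℕ) = n / 2 + p.2 + l * s := by
    rintro ⟨ℓ, b⟩
    by_cases hp : (ℓ, b) ∈ Λ ×ˢ Finset.range s
    swap
    · exact ⟨ℓ, fun h => absurd h hp⟩
    obtain ⟨hℓ, hb⟩ := Finset.mem_product.1 hp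
    have hb' := Finset.mem_range.1 hb
    set S : ℝ := ∑ k ∈ Finset.univ.erase k₀, (gridPoint ℓ k - 1 / 2) ^ 2 with hS
    have hcard : ((Finset.univ.erase k₀).card : ℝ) = d - 1 := by
      rw [Finset.card_erase_of_mem (Finset.mem_univ k₀), Finset.card_univ, Fintype.card_fin,
        Nat.cast_sub hd, Nat.cast_one]
    have hS1 : S ≤ (d - 1) * δ ^ 2 := by
      rw [← hcard, ← nsmul_eq_mul, hS]
      refine Finset.sum_le_card_nsmul _ _ _ fun k hk => ?_
      have := hline ℓ hℓ k (Finset.ne_of_mem_erase hk)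
      exact pow_le_pow_left₀ (by linarith) this.2 2
    have hS2 : (d - 1) * (δ / 2) ^ 2 ≤ S := by
      rw [← hcard, ← nsmul_eq_mul, hS]
      refine Finset.card_nsmul_le_sum _ _ _ fun k hk => ?_
      have := hline ℓ hℓ k (Finset.ne_of_mem_erase hk)
      exact pow_le_pow_left₀ (by linarith) this.1 2
    set q : ℕ → Prop := fun t => (((t : ℕ) + 1 / 2 : ℝ) / n - 1 / 2) ^ 2 + S < 1 / C₀ ^ 2 with hq
    have hqmem : ∀ i : Pixel d n, (∀ k, k ≠ k₀ → i k = ℓ k) →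
        (gridPoint i ∈ testDisc d C₀ ↔ q (i k₀)) := by
      intro i hi
      rw [mem_testDisc, sum_sq_sub_eq i k₀, hq]
      have : ∑ k ∈ Finset.univ.erase k₀, (gridPoint i k - 1 / 2) ^ 2 = S :=
        Finset.sum_congr rfl fun k hk => by
          simp only [gridPoint, hi k (Finset.ne_of_mem_erase hk)]
      rw [this]
    have hdiv1 : ((n / 2 : ℕ) : ℝ) ≤ n / 2 := Nat.cast_div_le
    have hdiv2 : (n : ℝ) / 2 - 1 / 2 ≤ ((n / 2 : ℕ) : ℝ) := by
      have : n ≤ 2 * (n / 2) + 1 := by omega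
      have : (n : ℝ) ≤ 2 * ((n / 2 : ℕ) : ℝ) + 1 := by exact_mod_cast this
      linarith
    have hbR : (b : ℝ) + 1 ≤ s := by exact_mod_cast hb'
    have hlast : n / 2 + b ≤ n - 1 := by
      have : (((n / 2 : ℕ) : ℝ) + b + 1) ≤ n := by linarith
      have : n / 2 + b + 1 ≤ n := by exact_mod_cast this
      omega
    -- Steps of length `s` start near the centre, inside the disc, and end after `L` of them within
    -- `s` pixels of the face, outside the disc by the margin `γ`. Some step must leave the disc.
    set L : ℕ := (n - 1 - (n / 2 + b)) / s with hL
    have hL1 : n / 2 + b + L * s ≤ n - 1 := by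
      have := Nat.div_mul_le_self (n - 1 - (n / 2 + b)) s
      rw [← hL] at this
      omega
    have hL2 : n - 1 < n / 2 + b + L * s + s := by
      have := Nat.lt_div_mul_add (a := n - 1 - (n / 2 + b)) hs
      rw [← hL] at this
      omega
    have hq0 : q (n / 2 + b + 0 * s) := by
      simp only [hq, zero_mul, add_zero]
      push_cast
      have h1 : 0 ≤ (((n / 2 : ℕ) : ℝ) + b + 1 / 2) / n - 1 / 2 := by
        rw [sub_nonneg, le_div_iff₀ hn']
        have : (0 : ℝ) ≤ b := Nat.cast_nonneg b
        linarith
      have h2 : (((n / 2 : ℕ) : ℝ) + b + 1 / 2) / n - 1 / 2 ≤ δ := by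
        rw [sub_le_iff_le_add, div_le_iff₀ hn']
        linarith
      have h3 := pow_le_pow_left₀ h1 h2 2
      linarith
    have hqL : ¬ q (n / 2 + b + L * s) := by
      simp only [hq, not_lt]
      have h0 : (n : ℝ) ≤ ((n / 2 + b + L * s : ℕ) : ℝ) + s := by
        have : n ≤ n / 2 + b + L * s + s := by omega
        exact_mod_cast this
      have h1 : 1 / 2 - γ ≤ (((n / 2 + b + L * s : ℕ) : ℝ) + 1 / 2) / n - 1 / 2 := by
        rw [le_sub_iff_add_le, le_div_iff₀ hn']
        linarith
      have h2 := pow_le_pow_left₀ (by linarith) h1 2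
      linarith
    obtain ⟨l, hl, hql, hql'⟩ := exists_transition (p := fun l => q (n / 2 + b + l * s)) hq0 hqL
    have hls : (l + 1) * s ≤ L * s := Nat.mul_le_mul_right s hl
    have hle : n / 2 + b + l * s + s ≤ n - 1 := by
      rw [add_mul, one_mul] at hls
      omega
    have hlt : n / 2 + b + l * s < n := by omega
    set i : Pixel d n := Function.update ℓ k₀ ⟨n / 2 + b + l * s, hlt⟩ with hi
    have hik : (i k₀ : ℕ) = n / 2 + b + l * s := by simp [hi]
    have hine : ∀ k, k ≠ k₀ → i k = ℓ k := fun k hk => by simp [hi, hk]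
    have his : (i k₀ : ℕ) + s < n := by omega
    refine ⟨i, fun _ => ⟨?_, hine, l, hik⟩⟩
    rw [hA, Finset.mem_filter]
    refine ⟨Finset.mem_univ _, his, ?_, ?_⟩
    · rw [hqmem i hine, hik]
      exact hql
    · have hTi : T i = Function.update i k₀ ⟨i k₀ + s, his⟩ := by simp only [hT, dif_pos his]
      rw [hqmem (T i) fun k hk => by rw [hTi, Function.update_of_ne hk, hine k hk], hTi,
        Function.update_self]
      have e : (i k₀ : ℕ) + s = n / 2 + b + (l + 1) * s := by rw [hik]; ring
      simp only [e]
      exact hql'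
  choose g hg using hex
  -- Line and residue can be recovered from the jump pixel, the residue by reduction modulo `s`, so
  -- every line contributes at least `s` different pixels.
  have hcardle : (Λ ×ˢ Finset.range s).card ≤ A.card := by
    refine Finset.card_le_card_of_injOn g (fun p hp => (hg p hp).1) ?_
    intro p hp p' hp' hpp
    have hp1 := Finset.mem_product.1 (Finset.mem_coe.1 hp)
    have hp1' := Finset.mem_product.1 (Finset.mem_coe.1 hp')
    obtain ⟨-, h1, l, h2⟩ := hg p hp
    obtain ⟨-, h1', l', h2'⟩ := hg p' hp'
    rw [hpp] at h1 h2
    refine Prod.ext (funext fun k => ?_) ?_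
    · by_cases hk : k = k₀
      · have e1 := mem_pixelBox.1 hp1.1 k
        have e2 := mem_pixelBox.1 hp1'.1 k
        simp only [ha, hm, hk, if_true] at e1 e2
        rw [hk]
        exact Fin.ext (by omega)
      · rw [← h1 k hk, ← h1' k hk]
    · have e : p.2 + l * s = p'.2 + l' * s := by omega
      have e1 := congrArg (· % s) e
      simp only [Nat.add_mul_mod_self_right] at e1
      rwa [Nat.mod_eq_of_lt (Finset.mem_range.1 hp1.2),
        Nat.mod_eq_of_lt (Finset.mem_range.1 hp1'.2)] at e1
  rw [Finset.card_product, Finset.card_range] at hcardle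
  have h1 : (Λ.card * s : ℝ) ≤ A.card := by exact_mod_cast hcardle
  calc (δ / 8) ^ d * s * (n : ℝ) ^ d = ((δ / 8) ^ d * (n : ℝ) ^ d) * s := by ring
    _ ≤ (Λ.card * n) * s := by gcongr
    _ = (Λ.card * s) * n := by ring
    _ ≤ A.card * n := by gcongr

/-! ### The lower bound for the bias -/

/-- For a shift `s` of order `n * min h 1`, small against the window width, the noise-free output is
almost constant between `i` and `T i`, whereas the test image drops by `1/2`. The jump pixels make
up a fraction of order `s / n`. -/
theorem exists_bandwidth_le_risk (d : ℕ) (hd : 1 ≤ d) {α C₀ : ℝ} (hC : 2 ≤ C₀)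
    (hC1 : d = 1 → 2 < C₀) (method : Method) (clip : Bool) (κ : ℝ) :
    ∃ c M : ℝ, 0 < c ∧ 0 < M ∧
    ∀ (n : ℕ) (σ : ℝ) (S : Type u) [MeasurableSpace S] (μ : Measure S) [IsProbabilityMeasure μ]
      (ε : Pixel d n → S → ℝ), IsWhiteNoise μ σ ε →
      (clip = true → IsIndepKurtosis μ σ κ ε) → ∀ h : ℝ, 0 < h → M ≤ n * min h 1 →
      ENNReal.ofReal (c * min h 1) ≤ risk μ ε α C₀ method clip h := by
  set k₀ : Fin d := ⟨0, hd⟩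
  obtain ⟨c₁, hc₁, -, hlow⟩ := exists_le_lintegral_error.{u} κ
  obtain ⟨C, hC1', hsmooth⟩ := exists_abs_filter_sub_le d method.degree
  obtain ⟨c₂, η₂, hc₂, hη₂, N, hjump⟩ := exists_jump_pixels d k₀ hC hC1
  -- The three bounds serve the supply of jump pixels, a change of the output of at most `1/4`, and
  -- `s ≤ m₀`.
  set η : ℝ := min (min η₂ (1 / (4 * C))) 1 with hη
  have hη0 : 0 < η := by positivity
  have hη1 : η ≤ 1 := min_le_right _ _
  have hηη : η ≤ η₂ := (min_le_left _ _).trans (min_le_left _ _)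
  have hηC : C * η ≤ 1 / 4 := by
    have h1 : η ≤ 1 / (4 * C) := (min_le_left _ _).trans (min_le_right _ _)
    calc C * η ≤ C * (1 / (4 * C)) := by gcongr
      _ = 1 / 4 := by field_simp
  refine ⟨c₁ * (c₂ * η / 256), max (max (2 / η) N) ((method.degree + 1 : ℕ) : ℝ),
    by positivity, lt_max_of_lt_right (by positivity), ?_⟩
  intro n σ S _ μ _ ε hε hclip h hh hM
  have hMη : 2 / η ≤ n * min h 1 := ((le_max_left _ _).trans (le_max_left _ _)).trans hM
  have hMN : N ≤ n * min h 1 := ((le_max_right _ _).trans (le_max_left _ _)).trans hM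
  have hMr : ((method.degree + 1 : ℕ) : ℝ) ≤ n * min h 1 := (le_max_right _ _).trans hM
  set m₀ : ℝ := n * min h 1 with hm₀
  have hm₀pos : 0 < m₀ := lt_of_lt_of_le (by positivity) hMη
  have hm₀n : m₀ ≤ n := mul_le_of_le_one_right (Nat.cast_nonneg n) (min_le_right _ _)
  have hn' : (0 : ℝ) < n := hm₀pos.trans_le hm₀n
  have hn : 0 < n := by exact_mod_cast hn'
  have hηm : 2 ≤ η * m₀ := by
    rw [div_le_iff₀ hη0] at hMη
    linarith
  set s : ℕ := ⌊η * m₀⌋₊ with hs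
  have hs1 : 1 ≤ s := Nat.le_floor (by push_cast; linarith)
  have hsle : (s : ℝ) ≤ η * m₀ := Nat.floor_le (by positivity)
  have hsge : η * m₀ / 2 ≤ s := by
    have := Nat.lt_floor_add_one (η * m₀)
    rw [← hs] at this
    linarith
  have hsm : (s : ℝ) ≤ m₀ := hsle.trans (mul_le_of_le_one_left hm₀pos.le hη1)
  obtain ⟨A, T, hAT, hAcard⟩ := hjump n s hn hs1
    (hsle.trans (mul_le_mul hηη hm₀n hm₀pos.le hη₂.le)) (hMN.trans hm₀n)
  choose K hK using fun i : Pixel d n => exists_isKernel method.degree (self_mem_window hh.le i)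
  set f : Pixel d n → ℝ := fun j => testImage d C₀ (gridPoint j) with hf
  have hfI : ∀ j, f j ∈ Set.Icc (1 / 4 : ℝ) (3 / 4) := fun j => testImage_mem_Icc d C₀ _
  set F : Pixel d n → ℝ := fun i => ∑ j ∈ window h i, (K i).eval (pixelCoord j) * f j with hF
  set v : Pixel d n → ℝ := fun i =>
    σ ^ 2 * ∑ j ∈ window h i, (K i).eval (pixelCoord j) ^ 2 with hv
  have hv0 : ∀ i, 0 ≤ v i := fun i => by positivity
  set e : Pixel d n → ℝ := fun i => min ((F i - f i) ^ 2 + v i) 1 with he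
  have he0 : ∀ i, 0 ≤ e i := fun i => le_min (add_nonneg (sq_nonneg _) (hv0 i)) zero_le_one
  have hpair : ∀ i ∈ A, 1 / 64 ≤ e i + e (T i) := by
    intro i hi
    obtain ⟨h1, h2, h3, h4⟩ := hAT i hi
    have hd := hsmooth n h s hh hMr hsm i (T i) k₀ h1 h2 (K i) (K (T i)) (hK i) (hK (T i)) f
      fun j => abs_le.2 ⟨by linarith [(hfI j).1], by linarith [(hfI j).2]⟩
    have hd' : |F i - F (T i)| ≤ 1 / 4 := by
      refine hd.trans (le_trans (mul_le_mul_of_nonneg_left ?_ (by linarith)) hηC)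
      rw [div_le_iff₀ hm₀pos]
      exact hsle
    have hfi : f i = 3 / 4 := by simp [hf, testImage, h3]
    have hfT : f (T i) = 1 / 4 := by simp [hf, testImage, h4]
    -- A jump of `1/2` against a change of at most `1/4` leaves `1/4` to be shared by the two
    -- errors.
    have hor : 1 / 8 ≤ |F i - f i| ∨ 1 / 8 ≤ |F (T i) - f (T i)| := by
      by_contra hcon
      push Not at hcon
      have h5 := abs_lt.1 hcon.1
      have h6 := abs_lt.1 hcon.2
      have h7 := abs_le.1 hd'
      rw [hfi] at h5
      rw [hfT] at h6
      linarith [h5.1, h6.2, h7.2, h7.1]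
    have hbig : ∀ j, 1 / 8 ≤ |F j - f j| → 1 / 64 ≤ e j := fun j hj => by
      refine le_min ?_ (by norm_num)
      have h5 : (1 / 8 : ℝ) ^ 2 ≤ |F j - f j| ^ 2 := pow_le_pow_left₀ (by norm_num) hj 2
      rw [sq_abs] at h5
      have := hv0 j
      norm_num at h5 ⊢
      linarith
    rcases hor with h5 | h5
    · linarith [hbig i h5, he0 (T i)]
    · linarith [hbig (T i) h5, he0 i]
  -- Injectivity ensures that every pixel is counted at most twice in the sum over pairs.
  have hTinj : Set.InjOn T A := by
    intro i hi j hj hij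
    obtain ⟨h1, h2, -, -⟩ := hAT i hi
    obtain ⟨h1', h2', -, -⟩ := hAT j hj
    funext k
    by_cases hk : k = k₀
    · rw [hk]
      rw [hij] at h2
      exact Fin.ext (by omega)
    · rw [← h1 k hk, ← h1' k hk, hij]
  have hsum : (A.card : ℝ) * (1 / 64) ≤ 2 * ∑ i, e i := by
    classical
    calc (A.card : ℝ) * (1 / 64) = ∑ _i ∈ A, (1 / 64 : ℝ) := by
          rw [Finset.sum_const, nsmul_eq_mul]
      _ ≤ ∑ i ∈ A, (e i + e (T i)) := Finset.sum_le_sum hpair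
      _ = ∑ i ∈ A, e i + ∑ i ∈ A.image T, e i := by
          rw [Finset.sum_add_distrib, Finset.sum_image hTinj]
      _ ≤ ∑ i, e i + ∑ i, e i := add_le_add
          (Finset.sum_le_univ_sum_of_nonneg he0) (Finset.sum_le_univ_sum_of_nonneg he0)
      _ = 2 * ∑ i, e i := by ring
  refine le_trans ?_ (le_iSup₂ (f := fun f _ => mse μ ε method clip h f) _
    (testImage_mem_cartoonClass d hC))
  refine ofReal_le_mse hn (b := fun i => c₁ * e i) (fun i => mul_nonneg hc₁.le (he0 i))
    (fun i => hlow hε method clip hclip hh.le (hK i) (f := f) (hfI i)) ?_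
  rw [← Finset.mul_sum, mul_assoc, mul_assoc]
  refine mul_le_mul_of_nonneg_left ?_ hc₁.le
  have h1 : c₂ * (η * m₀ / 2) * (n : ℝ) ^ d ≤ A.card * n :=
    le_trans (by gcongr) hAcard
  have h2 : c₂ * (η * min h 1 / 2) * (n : ℝ) ^ d ≤ A.card := by
    refine le_of_mul_le_mul_right ?_ hn'
    calc _ = c₂ * (η * m₀ / 2) * (n : ℝ) ^ d := by rw [hm₀]; ring
      _ ≤ _ := h1
  calc c₂ * η / 256 * (min h 1 * (n : ℝ) ^ d) =
        c₂ * (η * min h 1 / 2) * (n : ℝ) ^ d * (1 / 64) / 2 := by ring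
    _ ≤ A.card * (1 / 64) / 2 := by gcongr
    _ ≤ ∑ i, e i := by linarith

/-! ### Comparison with the rate -/

theorem Regime.mono {d n : ℕ} {σ M M' : ℝ} (h : Regime d n σ M') (hM : M ≤ M') :
    Regime d n σ M :=
  ⟨h.1, hM.trans h.2.1, (mul_le_mul_of_nonneg_right hM (sq_nonneg σ)).trans h.2.2⟩

/-- Since `rate ^ (d + 1) = σ² / n ^ d`, one has `(n * rate) ^ (d + 1) = n σ²`. The two conditions
of `Regime` are thus the `(d + 1)`-th powers of `Y ≤ n * rate` and `Y * rate ≤ 1`. -/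
theorem exists_rate_bounds (d : ℕ) (X : ℝ) : ∃ M : ℝ, 0 < M ∧ ∀ (n : ℕ) (σ : ℝ),
    Regime d n σ M → 0 < n ∧ 0 < rate d n σ ∧ X ≤ n * rate d n σ ∧ X * rate d n σ ≤ 1 ∧
      σ ^ 2 = (n : ℝ) ^ d * rate d n σ ^ (d + 1) := by
  have hX1 : (1 : ℝ) ≤ max X 1 := le_max_right _ _
  set Y := max X 1 with hY
  have hY0 : 0 < Y := by linarith
  refine ⟨Y ^ (d + 1), by positivity, fun n σ ⟨hσ, h1, h2⟩ => ?_⟩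
  have hn' : (0 : ℝ) < n := by
    have : 0 < n * σ ^ 2 := lt_of_lt_of_le (by positivity) h1
    exact pos_of_mul_pos_left this (sq_nonneg σ)
  have hρ : 0 < rate d n σ := Real.rpow_pos_of_pos (by positivity) _
  have hpow : rate d n σ ^ (d + 1) = σ ^ 2 / (n : ℝ) ^ d := by
    rw [rate, one_div, ← Nat.cast_succ]
    exact Real.rpow_inv_natCast_pow (by positivity) (Nat.succ_ne_zero d)
  have h3 : σ ^ 2 = (n : ℝ) ^ d * rate d n σ ^ (d + 1) := by
    rw [hpow]; field_simp
  refine ⟨by exact_mod_cast hn', hρ, (le_max_left X 1).trans ?_, ?_, h3⟩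
  · refine le_of_pow_le_pow_left₀ (n := d + 1) (Nat.succ_ne_zero d) (by positivity) (h1.trans_eq ?_)
    rw [h3]; ring
  · refine (mul_le_mul_of_nonneg_right (le_max_left X 1) hρ.le).trans ?_
    refine le_of_pow_le_pow_left₀ (n := d + 1) (Nat.succ_ne_zero d) zero_le_one ?_
    rw [mul_pow, one_pow]
    have h4 : 0 < (n : ℝ) ^ d := by positivity
    refine le_of_mul_le_mul_right ?_ h4
    calc Y ^ (d + 1) * rate d n σ ^ (d + 1) * (n : ℝ) ^ d = Y ^ (d + 1) * σ ^ 2 := by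
          rw [h3]; ring
      _ ≤ 1 * (n : ℝ) ^ d := by rwa [one_mul]

theorem exists_risk_le_rate (d : ℕ) (hd : 1 ≤ d) {α C₀ : ℝ} (hα : 1 ≤ α) (hC : 0 < C₀)
    (method : Method) (clip : Bool) {a b : ℝ} (ha : 0 < a) (hab : a ≤ b) :
    ∃ C M : ℝ, 0 < C ∧ 0 < M ∧ ∀ (n : ℕ) (σ : ℝ), Regime d n σ M →
      ∀ (S : Type u) [MeasurableSpace S] (μ : Measure S) [IsProbabilityMeasure μ]
        (ε : Pixel d n → S → ℝ), IsWhiteNoise μ σ ε →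
      ∀ h : ℝ, a * rate d n σ ≤ h → h ≤ b * rate d n σ →
        risk μ ε α C₀ method clip h ≤ ENNReal.ofReal (C * rate d n σ) := by
  obtain ⟨C, M₁, hC', -, hrisk⟩ := exists_risk_le.{u} d hd hα hC method clip
  obtain ⟨M, hM, hrate⟩ := exists_rate_bounds d (max b (M₁ / a))
  have hb : 0 < b := ha.trans_le hab
  refine ⟨C * (b + 1 / a ^ d), M, by positivity, hM, ?_⟩
  intro n σ hR S _ μ _ ε hε h h1 h2
  obtain ⟨hn, hρ, h3, h4, h5⟩ := hrate n σ hR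
  set ρ := rate d n σ
  have hn' : (0 : ℝ) < n := by exact_mod_cast hn
  have hbρ : b * ρ ≤ 1 := (mul_le_mul_of_nonneg_right (le_max_left _ _) hρ.le).trans h4
  have hM₁ : M₁ ≤ n * h := by
    have h6 : M₁ / a ≤ n * ρ := (le_max_right _ _).trans h3
    rw [div_le_iff₀ ha] at h6
    calc M₁ ≤ n * (a * ρ) := by linarith
      _ ≤ n * h := by gcongr
  have h0 : 0 < h := lt_of_lt_of_le (by positivity) h1
  refine (hrisk n σ S μ ε hε h h0 (h2.trans hbρ) hM₁).trans (ENNReal.ofReal_le_ofReal ?_)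
  rw [mul_assoc]
  refine mul_le_mul_of_nonneg_left ?_ hC'.le
  have h7 : σ ^ 2 / (n * h) ^ d ≤ ρ / a ^ d := by
    calc σ ^ 2 / (n * h) ^ d ≤ σ ^ 2 / (n * (a * ρ)) ^ d := by gcongr
      _ = ρ / a ^ d := by
        rw [h5, mul_pow, mul_pow, pow_succ]
        field_simp
  calc h + σ ^ 2 / (n * h) ^ d ≤ b * ρ + ρ / a ^ d := add_le_add h2 h7
    _ = (b + 1 / a ^ d) * ρ := by ring

/-- The order of the variance of the filter is at least a multiple of the rate for bandwidths at
most `t` times the rate. -/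
theorem rate_div_le_variance {d n : ℕ} {σ t h ρ : ℝ} (hn : 0 < n) (hρ : 0 < ρ)
    (hσ : σ ^ 2 = (n : ℝ) ^ d * ρ ^ (d + 1)) (ht : 0 < t) (h0 : 0 < h) (hh : h ≤ t * ρ)
    (hnt : 1 ≤ t * (n * ρ)) :
    ρ / (3 * t) ^ d ≤ σ ^ 2 / (2 * (n * h) + 1) ^ d := by
  have hn' : (0 : ℝ) < n := by exact_mod_cast hn
  have h1 : 2 * (n * h) + 1 ≤ 3 * t * (n * ρ) := by
    have : n * h ≤ n * (t * ρ) := by gcongr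
    linarith
  calc ρ / (3 * t) ^ d = σ ^ 2 / (3 * t * (n * ρ)) ^ d := by
        rw [hσ, mul_pow _ (n * ρ), mul_pow (n : ℝ), pow_succ]
        field_simp
    _ ≤ σ ^ 2 / (2 * (n * h) + 1) ^ d := by gcongr

end LinearFilter

end

/-! ### Optimal risk and optimal bandwidths -/

theorem theorem1 (d : ℕ) (hd : 1 ≤ d) (α : ℝ) (hα : 1 ≤ α)
    (C₀ : ℝ) (hC : 2 ≤ C₀) (hC1 : d = 1 → 2 < C₀)
    (method : LinearFilter.Method)
    (hr : ∀ r, method = LinearFilter.Method.polynomial r → LinearFilter.strictFloor α ≤ r)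
    (clip : Bool) (κ : ℝ) :
    -- the optimised worst-case risk is of exact order `rate`
    (∃ c C M : ℝ, 0 < c ∧ 0 < C ∧ 0 < M ∧
      ∀ (n : ℕ) (σ : ℝ), LinearFilter.Regime d n σ M →
      ∀ (S : Type u) [MeasurableSpace S] (μ : Measure S) [IsProbabilityMeasure μ]
        (ε : LinearFilter.Pixel d n → S → ℝ), LinearFilter.IsWhiteNoise μ σ ε →
        LinearFilter.optimalRisk μ ε α C₀ method clip
            ≤ ENNReal.ofReal (C * LinearFilter.rate d n σ) ∧
        ((clip = true → LinearFilter.IsIndepKurtosis μ σ κ ε) →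
          ENNReal.ofReal (c * LinearFilter.rate d n σ)
            ≤ LinearFilter.optimalRisk μ ε α C₀ method clip)) ∧
    -- every bandwidth of order `rate` achieves the optimal order
    (∀ a b : ℝ, 0 < a → a ≤ b → ∃ C M : ℝ, 0 < C ∧ 0 < M ∧
      ∀ (n : ℕ) (σ : ℝ), LinearFilter.Regime d n σ M →
      ∀ (S : Type u) [MeasurableSpace S] (μ : Measure S) [IsProbabilityMeasure μ]
        (ε : LinearFilter.Pixel d n → S → ℝ), LinearFilter.IsWhiteNoise μ σ ε →
      ∀ h : ℝ, a * LinearFilter.rate d n σ ≤ h → h ≤ b * LinearFilter.rate d n σ →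
        LinearFilter.risk μ ε α C₀ method clip h
          ≤ ENNReal.ofReal (C * LinearFilter.rate d n σ)) ∧
    -- every bandwidth that is optimal up to a constant factor is of order `rate`
    (∀ K : ℝ, 1 ≤ K → ∃ a b M : ℝ, 0 < a ∧ a ≤ b ∧ 0 < M ∧
      ∀ (n : ℕ) (σ : ℝ), LinearFilter.Regime d n σ M →
      ∀ (S : Type u) [MeasurableSpace S] (μ : Measure S) [IsProbabilityMeasure μ]
        (ε : LinearFilter.Pixel d n → S → ℝ), LinearFilter.IsWhiteNoise μ σ ε →
        (clip = true → LinearFilter.IsIndepKurtosis μ σ κ ε) →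
      ∀ h : ℝ, 0 < h →
        LinearFilter.risk μ ε α C₀ method clip h
          ≤ ENNReal.ofReal K * LinearFilter.optimalRisk μ ε α C₀ method clip →
        a * LinearFilter.rate d n σ ≤ h ∧ h ≤ b * LinearFilter.rate d n σ) := by
  have hC₀ : 0 < C₀ := by linarith
  obtain ⟨C, M₁, hC', hM₁, hupper⟩ :=
    LinearFilter.exists_risk_le_rate.{u} d hd hα hC₀ method clip one_pos le_rfl
  obtain ⟨c₂, hc₂, -, hvar⟩ :=
    LinearFilter.exists_variance_le_risk.{u} d (α := α) hC method clip κ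
  obtain ⟨c₃, M₃, hc₃, -, hbias⟩ :=
    LinearFilter.exists_bandwidth_le_risk.{u} d hd (α := α) hC hC1 method clip κ
  refine ⟨?_, fun a b ha hab =>
    LinearFilter.exists_risk_le_rate d hd hα hC₀ method clip ha hab, ?_⟩
  · obtain ⟨M₂, -, hrate⟩ := LinearFilter.exists_rate_bounds d (max 1 M₃)
    refine ⟨min (c₂ / 3 ^ d) c₃, C, max M₁ M₂, by positivity, hC', lt_max_of_lt_left hM₁, ?_⟩
    intro n σ hR S _ μ _ ε hε
    have hR₁ := hR.mono (le_max_left M₁ M₂)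
    obtain ⟨hn, hρ, h1, h2, h3⟩ := hrate n σ (hR.mono (le_max_right M₁ M₂))
    set ρ := LinearFilter.rate d n σ
    have h1' : 1 ≤ n * ρ := (le_max_left _ _).trans h1
    have hρ1 : ρ ≤ 1 := by
      have := mul_le_mul_of_nonneg_right (le_max_left 1 M₃) hρ.le
      linarith
    refine ⟨(iInf₂_le ρ hρ).trans
      (hupper n σ hR₁ S μ ε hε ρ (one_mul _).le (one_mul _).ge), fun hclip => ?_⟩
    refine le_iInf₂ fun h h0 => ?_
    -- Below the rate the variance alone is large enough, above it the bias alone.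
    rcases le_total h ρ with hh | hh
    · refine le_trans (ENNReal.ofReal_le_ofReal ?_) (hvar n σ S μ ε hn hε hclip h h0)
      have h4 := LinearFilter.rate_div_le_variance hn hρ h3 one_pos h0 (by rwa [one_mul])
        (by rwa [one_mul])
      rw [mul_one] at h4
      have h5 : ρ / 3 ^ d ≤ 1 := div_le_one_of_le₀
        (hρ1.trans (one_le_pow₀ (by norm_num))) (by positivity)
      calc min (c₂ / 3 ^ d) c₃ * ρ ≤ c₂ / 3 ^ d * ρ := by gcongr; exact min_le_left _ _
        _ = c₂ * (ρ / 3 ^ d) := by ring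
        _ ≤ _ := mul_le_mul_of_nonneg_left (le_min h4 h5) hc₂.le
    · have h4 : ρ ≤ min h 1 := le_min hh hρ1
      refine le_trans (ENNReal.ofReal_le_ofReal ?_) (hbias n σ S μ ε hε hclip h h0
        (((le_max_right _ _).trans h1).trans (by gcongr)))
      exact mul_le_mul (min_le_right _ _) h4 hρ.le hc₃.le
  · intro K hK
    have hKC : 0 < K * C := by positivity
    -- Below `a * ρ` the variance bound, and above `b * ρ` the bias bound, is at least `2 * (K * C)
    -- * ρ`, twice what near-optimality allows. The bound `3 * a ≤ 1` gives `(3 * a) ^ d ≤ 3 * a`.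
    set a : ℝ := min (1 / 3) (c₂ / (6 * (K * C))) with ha
    set b : ℝ := max 1 (2 * (K * C) / c₃) with hb
    have ha0 : 0 < a := by positivity
    have ha3 : 3 * a ≤ 1 := by
      have := min_le_left (1 / 3) (c₂ / (6 * (K * C)))
      linarith
    have hac : 3 * a * (2 * (K * C)) ≤ c₂ := by
      have := min_le_right (1 / 3) (c₂ / (6 * (K * C)))
      rw [← ha, le_div_iff₀ (by positivity)] at this
      linarith
    have hb1 : 1 ≤ b := le_max_left _ _
    have hbc : 2 * (K * C) ≤ b * c₃ := by
      have := le_max_right 1 (2 * (K * C) / c₃)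
      rwa [← hb, div_le_iff₀ hc₃] at this
    -- These make `n * a * ρ ≥ 1`, satisfy the condition of the bias bound, keep the truncation of
    -- the variance bound at `1` harmless, and give `b * ρ ≤ 1`.
    obtain ⟨M₂, -, hrate⟩ := LinearFilter.exists_rate_bounds d
      (max (max (1 / a) M₃) (max (2 * (K * C) / c₂) (max b (2 * (K * C) / c₃))))
    refine ⟨a, b, max M₁ M₂, ha0, by linarith, lt_max_of_lt_left hM₁, ?_⟩
    intro n σ hR S _ μ _ ε hε hclip h h0 hopt
    have hR₁ := hR.mono (le_max_left M₁ M₂)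
    obtain ⟨hn, hρ, h1, h2, h3⟩ := hrate n σ (hR.mono (le_max_right M₁ M₂))
    set ρ := LinearFilter.rate d n σ
    have hn' : (0 : ℝ) < n := by exact_mod_cast hn
    simp only [max_mul_of_nonneg _ _ hρ.le, max_le_iff] at h1 h2
    obtain ⟨⟨h1a, h1b⟩, -⟩ := h1
    obtain ⟨-, h2a, h2b, h2c⟩ := h2
    rw [div_mul_eq_mul_div, div_le_one hc₂] at h2a
    rw [div_mul_eq_mul_div, div_le_one hc₃] at h2c
    have hle : LinearFilter.risk μ ε α C₀ method clip h ≤ ENNReal.ofReal (K * C * ρ) := by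
      refine hopt.trans ?_
      rw [mul_assoc, ENNReal.ofReal_mul (by linarith)]
      gcongr
      exact (iInf₂_le ρ hρ).trans
        (hupper n σ hR₁ S μ ε hε ρ (one_mul _).le (one_mul _).ge)
    have hKCρ : 0 < K * C * ρ := by positivity
    -- a lower bound by twice the upper bound is absurd
    have habs : ∀ x, ENNReal.ofReal x ≤ LinearFilter.risk μ ε α C₀ method clip h →
        ¬ 2 * (K * C) * ρ ≤ x := fun x hx hx' => by
      have h4 := (ENNReal.ofReal_le_ofReal_iff hKCρ.le).1 (hx.trans hle)
      linarith
    constructor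
    · by_contra! hh
      refine habs _ (hvar n σ S μ ε hn hε hclip h h0) ?_
      have h4 := LinearFilter.rate_div_le_variance hn hρ h3 ha0 h0 hh.le (by
        rw [div_le_iff₀ ha0] at h1a
        linarith)
      have h5 : ρ / (3 * a) ≤ ρ / (3 * a) ^ d := by
        gcongr
        exact pow_le_of_le_one (by positivity) ha3 (by omega)
      rw [mul_min_of_nonneg _ _ hc₂.le, mul_one]
      refine le_min ?_ h2a
      refine le_trans ?_ (mul_le_mul_of_nonneg_left (h5.trans h4) hc₂.le)
      rw [mul_div_assoc', le_div_iff₀ (by positivity)]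
      calc 2 * (K * C) * ρ * (3 * a) = 3 * a * (2 * (K * C)) * ρ := by ring
        _ ≤ c₂ * ρ := by gcongr
    · by_contra! hh
      have h4 : b * ρ ≤ min h 1 := le_min hh.le h2b
      have h5 : ρ ≤ b * ρ := le_mul_of_one_le_left hρ.le hb1
      refine habs _ (hbias n σ S μ ε hε hclip h h0 (h1b.trans ?_)) ?_
      · gcongr
        exact h5.trans h4
      · calc 2 * (K * C) * ρ ≤ b * c₃ * ρ := by gcongr
          _ = c₃ * (b * ρ) := by ring
          _ ≤ c₃ * min h 1 := by gcongr
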